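/- **Framework.** Let $\mathfrak g\subset M_N(\mathbb C)$ be a simple classical Lie algebra in its defining representation: $\mathfrak{sl}(d,\mathbb C)$ with $d\ge2$ (type A), $\mathfrak{so}(n,\mathbb C)$ with $n\ge 3$, $n\neq4$ (types B, D), or $\mathfrak{sp}(2n,\mathbb C)$ with $n\ge1$ (type C). Let $G$ be $SL(d,\mathbb C)$, $SO(n,\mathbb C)$ or $Sp(2n,\mathbb C)$ respectively. Let $\sigma$ be an automorphism of $\mathfrak g$ of finite order $T\ge 1$ (for $\mathfrak{so}(8,\mathbb C)$: conjugation by an orthogonal matrix), $\omega$ a primitive $T$-th root of unity, $C_{12}=\sum_a T^a\otimes T_a$ the Casimir tensor for bases of $\mathfrak g$ with $\mathrm{Tr}(T^aT_b)=\delta^a_b$, and $\varphi\ne0$ a rational function (the twist function) with $\varphi(\omega\lambda)=\omega^{-1}\varphi(\lambda)$. Put $$\mathcal R_{12}(\lambda,\mu)=\frac1T\sum_{k=0}^{T-1}\frac{\sigma_1^kC_{12}}{\mu-\omega^{-k}\lambda}\;\varphi(\mu)^{-1}.$$ Space is $\mathbb R$ or the circle $\mathbb R/2\pi\mathbb Z$.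 The phase space carries a Poisson bracket, defined on an algebra of observables (smooth complex functions) each of which has a Hamiltonian vector field; for an observable $F$ and a function $K$ on phase space, $\{F,K\}$ is the derivative of $K$ along the Hamiltonian vector field of $F$, and the differentiability of $K$ in this direction is part of any claim on $\{F,K\}$. The Lax matrix $\mathcal L(\lambda,x)\in\mathfrak g$ is a function on phase space that is smooth in all variables and holomorphic in $\lambda$ in an open set $D\subset\mathbb C$ with $\omega D\subset D$, with $\sigma(\mathcal L(\lambda,x))=\mathcal L(\omega\lambda,x)$. On the circle $\mathcal L$ is periodic in $x$; on the line $\mathcal L$ and its first variations along smooth curves in phase space are $O(1/(1+x^2))$, locally uniformly in $\lambda$ and in the curve parameter. The entries of $\int f(x)\mathcal L(\lambda,x)\,dx$ are observables for all test functions $f$ (smooth, and compactly supported on the line), and, in the sense of distributions in $x,y$, $$\{\mathcal L(\lambda,x)_1,\mathcal L(\mu,y)_2\}=[\mathcal R_{12}(\lambda,\mu),\mathcal L(\lambda,x)_1]\delta_{xy}-[\mathcal R_{21}(\mu,\lambda),\mathcal L(\mu,y)_2]\delta_{xy}-(\mathcal R_{12}(\lambda,\mu)+\mathcal R_{21}(\mu,\lambda))\,\partial_x\delta_{xy}$$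 for all $\lambda,\mu\in D$ that are neither zeros nor poles of $\varphi$ and satisfy $\lambda^T\ne\mu^T$. **Local charges.** A regular zero is a zero $\lambda_0\in\mathbb C$ of $\varphi$ that has a punctured neighbourhood in $D$ and is such that $\varphi(\lambda)\mathcal L(\lambda,x)$ extends holomorphically to $\lambda_0$. Let $\mathcal Z$ be a finite set of regular zeros whose orbits under multiplication by $\omega$ are pairwise disjoint. Put $\mathscr T_n(\lambda,x)=\mathrm{Tr}\big(\varphi(\lambda)^n\mathcal L(\lambda,x)^n\big)$, continued holomorphically to the regular zeros. The point $\lambda_0$ is called cyclotomic if $\lambda_0=0$ and $T>1$. Set $$\mathcal W_n(\lambda,x)=\Big[\exp\Big(-\frac{n-1}{d}\sum_{k\ge2}\frac{\mu^k}{k}\mathscr T_k(\lambda,x)\Big)\Big]_{\mu^n}$$ for $\mathfrak g=\mathfrak{sl}(d,\mathbb C)$, except when $\lambda_0$ is cyclotomic and $\sigma$ is inner; in that case and in types B, C, D set $\mathcal W_n=\mathscr T_n$. Let $r_n\in\{0,\dots,T-1\}$ be congruent modulo $T$ to $-n(1+\frac T2)$ if $\mathfrak g$ is of type A and $\sigma$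 is not inner (then $T$ is even), and to $-n$ otherwise. Let $\mathscr K^{\lambda_0}_n(x)$ be $\mathcal W_n(\lambda_0,x)$ if $\lambda_0$ is not cyclotomic, and the coefficient of $\lambda^{r_n}$ in the Taylor expansion of $\mathcal W_n(\lambda,x)$ at $0$ if $\lambda_0=0$ is cyclotomic. Put $\mathcal Q_n^{\lambda_0}=\int\mathscr K_n^{\lambda_0}(x)\,dx$ over the whole space. Let $\mathcal E_{\lambda_0}$ be the set of $n\ge2$ with $n\not\equiv1\pmod d$ for $\mathfrak{sl}(d,\mathbb C)$, and $n$ even in types B, C, D, and, if $\lambda_0$ is cyclotomic, also $r_n\ne T-1$. The charges $\mathcal Q^{\lambda_0}_n$ with $\lambda_0\in\mathcal Z$, $n\in\mathcal E_{\lambda_0}$ are supposed to be observables. **Monodromy.** For $\lambda\in D$ let $T(\lambda)$ be the path-ordered exponential $\mathrm P\overleftarrow{\exp}\big(-\int dz\,\mathcal L(\lambda,z)\big)$ over $\mathbb R$, or over $[0,2\pi]$ if space is the circle. A central function is a conjugation-invariant holomorphic function $f$ on $G$. **Theorem.** Let $\lambda_0\in\mathcal Z$, $n\in\mathcal E_{\lambda_0}$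 and $\lambda\in D$. (i) If space is the line, then $\{\mathcal Q_n^{\lambda_0},T(\lambda)_{ij}\}=0$ for all entries of $T(\lambda)$. (ii) If space is the circle, then $\{\mathcal Q_n^{\lambda_0},f(T(\lambda))\}=0$ for every central function $f$. (iii) Let $\mathcal P$ be an observable with $\{\mathcal P,\mathcal L(\lambda,x)\}=\partial_x\mathcal L(\lambda,x)$ for all $\lambda\in D$ (the momentum), and let the Hamiltonian be an observable of the form $\mathcal H=\sum_{\mu_0\in\mathcal Z}a_{\mu_0}\mathcal Q^{\mu_0}_2+b\,\mathcal P$ with $a_{\mu_0},b\in\mathbb C$. Then the entries of $T(\lambda)$ (line), respectively the functions $f(T(\lambda))$ with $f$ central (circle), are conserved: their Poisson brackets with $\mathcal H$ vanish, and they are constant along every motion generated by $\mathcal H$. -/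

import Mathlib

open Filter Topology Diffeology
open scoped ContDiff Kronecker Matrix

noncomputable section

namespace TwistModel

attribute [local instance 100] LieRing.ofAssociativeRing LieAlgebra.ofAssociativeAlgebra

/-! ### Space -/

/-- The space of the field theory: the real line, or the circle `ℝ / 2πℤ`
(functions on the circle are `2π`-periodic functions of `x : ℝ`). -/
inductive Space
  | line
  | circle

/-- Integration over the whole space. -/
def Space.integral : Space → (ℝ → ℂ) → ℂ
  | .line, f => ∫ x, f x
  | .circle, f => ∫ x in (0 : ℝ)..(2 * Real.pi), f x

/-- Test functions used to smear the fields. -/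
def Space.IsTest : Space → (ℝ → ℂ) → Prop
  | .line, f => ContDiff ℝ ∞ f ∧ HasCompactSupport f
  | .circle, f => ContDiff ℝ ∞ f ∧ Function.Periodic f (2 * Real.pi)

/-! ### Phase spaces and Poisson brackets

A phase space (usually infinite-dimensional) is a diffeological space `M`. -/

/-- A complexified tangent vector at `m`, `re'(0) + i im'(0)`, represented by two smooth curves
through `m`. -/
structure CTangent {M : Type*} [DiffeologicalSpace M] (m : M) where
  re : ℝ → M
  im : ℝ → M
  re_smooth : DSmooth re
  im_smooth : DSmooth im
  re_zero : re 0 = m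
  im_zero : im 0 = m

/-- `G` is differentiable along the complexified tangent vector `X`, with derivative `z`. -/
def CTangent.HasDeriv {M : Type*} [DiffeologicalSpace M] {m : M} (X : CTangent m)
    (G : M → ℂ) (z : ℂ) : Prop :=
  ∃ u v : ℂ, HasDerivAt (fun t : ℝ => G (X.re t)) u 0 ∧
    HasDerivAt (fun t : ℝ => G (X.im t)) v 0 ∧ z = u + Complex.I * v

/-- A Poisson structure on a phase space: a Poisson algebra `obs` of smooth complex functions
(the observables), all of which have Hamiltonian vector fields, that is, `{F, ·}` is at each point
the derivative along a complexified tangent vector. -/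
structure PoissonStructure (M : Type*) [DiffeologicalSpace M] where
  obs : Subalgebra ℂ (M → ℂ)
  smooth : ∀ F ∈ obs, ∀ γ : ℝ → M, DSmooth γ → ContDiff ℝ ∞ (fun t => F (γ t))
  bracket : obs → obs → obs
  bracket_add : ∀ F G H, bracket F (G + H) = bracket F G + bracket F H
  bracket_smul : ∀ (c : ℂ) (F G), bracket F (c • G) = c • bracket F G
  bracket_skew : ∀ F G, bracket F G = -bracket G F
  bracket_leibniz : ∀ F G H, bracket F (G * H) = bracket F G * H + G * bracket F H
  bracket_jacobi : ∀ F G H,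
    bracket F (bracket G H) + bracket G (bracket H F) + bracket H (bracket F G) = 0
  exists_hamiltonian : ∀ (F : obs) (m : M), ∃ X : CTangent m, ∀ G : obs,
    X.HasDeriv (G : M → ℂ) ((bracket F G : M → ℂ) m)

namespace PoissonStructure

variable {M : Type*} [DiffeologicalSpace M] (P : PoissonStructure M)

/-- `X` is a Hamiltonian vector of `F` at `m`. -/
def IsHamiltonian (F : P.obs) {m : M} (X : CTangent m) : Prop :=
  ∀ G : P.obs, X.HasDeriv (G : M → ℂ) ((P.bracket F G : M → ℂ) m)

/-- `{F, G}(m) = z`, for an observable `F` and an arbitrary function `G` on phase space (such as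
a matrix entry of the monodromy): `G` is differentiable along the Hamiltonian vector of `F`
at `m`, whichever representative is used, and the derivative is `z`. -/
def HasBracket (F : P.obs) (G : M → ℂ) (m : M) (z : ℂ) : Prop :=
  ∀ X : CTangent m, P.IsHamiltonian F X → X.HasDeriv G z

/-- `{F, G} = 0`. -/
def InInvolution (F : P.obs) (G : M → ℂ) : Prop := ∀ m, P.HasBracket F G m 0

/-- `γ` is a motion of the system with Hamiltonian `H`, that is, `dG/dt = {H, G}` along `γ`. -/
def IsMotion (H : P.obs) (γ : ℝ → M) : Prop :=
  DSmooth γ ∧ ∀ (G : P.obs) (t : ℝ),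
    HasDerivAt (fun s => (G : M → ℂ) (γ s)) ((P.bracket H G : M → ℂ) (γ t)) t

/-- `G` is conserved by the Hamiltonian `H`: `{H, G} = 0`, and `G` is constant on all motions. -/
def IsConserved (H : P.obs) (G : M → ℂ) : Prop :=
  P.InInvolution H G ∧ ∀ γ, P.IsMotion H γ → ∀ s t, G (γ s) = G (γ t)

end PoissonStructure

/-! ### The classical Lie algebras in their defining representations -/

/-- `A d` is `sl(d, ℂ)`, `BD n` is `so(n, ℂ)`, `C n` is `sp(2n, ℂ)`. -/
inductive ClassicalType
  | A (d : ℕ)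
  | BD (n : ℕ)
  | C (n : ℕ)

namespace ClassicalType

/-- The parameters for which the Lie algebra is simple. -/
def Simple : ClassicalType → Prop
  | A d => 2 ≤ d
  | BD n => 3 ≤ n ∧ n ≠ 4
  | C n => 1 ≤ n

/-- Indices of the matrices of the defining representation. -/
def Idx : ClassicalType → Type
  | A d => Fin d
  | BD n => Fin n
  | C n => Fin n ⊕ Fin n

instance instFintypeIdx : (t : ClassicalType) → Fintype t.Idx
  | A d => inferInstanceAs (Fintype (Fin d))
  | BD n => inferInstanceAs (Fintype (Fin n))
  | C n => inferInstanceAs (Fintype (Fin n ⊕ Fin n))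

instance instDecidableEqIdx : (t : ClassicalType) → DecidableEq t.Idx
  | A d => inferInstanceAs (DecidableEq (Fin d))
  | BD n => inferInstanceAs (DecidableEq (Fin n))
  | C n => inferInstanceAs (DecidableEq (Fin n ⊕ Fin n))

/-- Matrices of the defining representation. -/
abbrev Mat (t : ClassicalType) : Type := Matrix t.Idx t.Idx ℂ

/-- The Lie algebra `𝔤`. -/
def alg : (t : ClassicalType) → LieSubalgebra ℂ t.Mat
  | A d => LieAlgebra.SpecialLinear.sl (Fin d) ℂ
  | BD n => LieAlgebra.Orthogonal.so (Fin n) ℂ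
  | C n => LieAlgebra.Symplectic.sp (Fin n) ℂ

/-- The connected matrix group with Lie algebra `𝔤`: `SL(d, ℂ)`, `SO(n, ℂ)`, `Sp(2n, ℂ)`. -/
def group : (t : ClassicalType) → Set t.Mat
  | A d => {g : Matrix (Fin d) (Fin d) ℂ | g.det = 1}
  | BD n => {g : Matrix (Fin n) (Fin n) ℂ | gᵀ * g = 1 ∧ g.det = 1}
  | C n => {g : Matrix (Fin n ⊕ Fin n) (Fin n ⊕ Fin n) ℂ |
      gᵀ * Matrix.J (Fin n) ℂ * g = Matrix.J (Fin n) ℂ}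

/-- `n - 1` is an exponent of the untwisted affine algebra of `𝔤`
(without the Pfaffian exponents in type D). -/
def IsDegree : ClassicalType → ℕ → Prop
  | A d, n => 2 ≤ n ∧ ¬ n ≡ 1 [MOD d]
  | BD _, n => 2 ≤ n ∧ Even n
  | C _, n => 2 ≤ n ∧ Even n

/-- A central function on the group: a holomorphic function of `g ∈ G` (near each point of `G`
the restriction to `G` of a holomorphic function of the matrix entries) that is invariant under
conjugation. The values of `f` outside of `G` are irrelevant. -/
def IsCentralFunction (t : ClassicalType) (f : t.Mat → ℂ) : Prop :=
  (∀ g ∈ t.group, ∀ h ∈ t.group, f (g * h * g⁻¹) = f h) ∧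
  ∀ h ∈ t.group, ∃ F : (t.Idx → t.Idx → ℂ) → ℂ, AnalyticAt ℂ F (Matrix.of.symm h) ∧
    ∀ᶠ g in 𝓝 h, g ∈ t.group → f g = F (Matrix.of.symm g)

end ClassicalType

/-! ### Automorphism, twist function and `R`-matrix -/

/-- The data of the `R`-matrix: an automorphism `σ` of `𝔤` of finite order `T`, a primitive `T`-th
root of unity `root = ω`, dual bases of `𝔤` for the trace form, and the twist function `φ`. -/
structure TwistData (t : ClassicalType) where
  T : ℕ
  T_pos : 0 < T
  σ : t.alg ≃ₗ⁅ℂ⁆ t.alg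
  σ_order : ∀ k : ℕ, σ^[k] = id ↔ T ∣ k
  /-- The special automorphisms of `so(8, ℂ)` (triality) are excluded. -/
  σ_natural : t = .BD 8 → ∃ Q : t.Mat, Qᵀ * Q = 1 ∧
    ∀ X : t.alg, (σ X : t.Mat) = Q * (X : t.Mat) * Qᵀ
  root : ℂ
  root_prim : IsPrimitiveRoot root T
  r : ℕ
  up : Module.Basis (Fin r) ℂ t.alg
  dn : Module.Basis (Fin r) ℂ t.alg
  dual : ∀ a b, ((up a : t.Mat) * (dn b : t.Mat)).trace = if a = b then 1 else 0
  φ : RatFunc ℂ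
  φ_ne : φ ≠ 0
  φ_equivariant : ∀ z : ℂ,
    φ.eval (RingHom.id ℂ) (root * z) = root⁻¹ * φ.eval (RingHom.id ℂ) z

namespace TwistData

variable {t : ClassicalType} (τ : TwistData t)

/-- The value `φ(z)` (meaningful where `φ` has no pole). -/
def φval (z : ℂ) : ℂ := τ.φ.eval (RingHom.id ℂ) z

/-- `z` is neither a zero nor a pole of `φ`. -/
def IsGeneric (z : ℂ) : Prop := τ.φ.num.eval z ≠ 0 ∧ τ.φ.denom.eval z ≠ 0

/-- `R⁰₁₂(z, w) = T⁻¹ ∑ₖ σᵏ₁ C₁₂ / (w - ω⁻ᵏ z)`, where `C₁₂ = ∑ₐ Tᵃ ⊗ Tₐ`. -/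
def R0 (z w : ℂ) : Matrix (t.Idx × t.Idx) (t.Idx × t.Idx) ℂ :=
  (τ.T : ℂ)⁻¹ • ∑ k ∈ Finset.range τ.T, (w - (τ.root ^ k)⁻¹ * z)⁻¹ •
    ∑ a, (((τ.σ^[k] (τ.up a) : t.alg) : t.Mat) ⊗ₖ ((τ.dn a : t.alg) : t.Mat))

/-- `R₁₂(z, w) = R⁰₁₂(z, w) φ(w)⁻¹`. -/
def R12 (z w : ℂ) : Matrix (t.Idx × t.Idx) (t.Idx × t.Idx) ℂ :=
  (τ.φval w)⁻¹ • τ.R0 z w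

/-- `R₂₁(z, w)`: the matrix `R₁₂(z, w)` with its two tensor factors exchanged. -/
def R21 (z w : ℂ) : Matrix (t.Idx × t.Idx) (t.Idx × t.Idx) ℂ :=
  (τ.R12 z w).submatrix Prod.swap Prod.swap

/-- `σ` is the conjugation by an invertible matrix (for `sl(d, ℂ)`: `σ` is inner). -/
def IsInner : Prop :=
  ∃ Q : t.Mat, IsUnit Q ∧ ∀ X : t.alg, (τ.σ X : t.Mat) = Q * (X : t.Mat) * Q⁻¹

/-- The finite cyclotomic point is the origin, when `T > 1`. -/
def IsCyclotomic (z : ℂ) : Prop := z = 0 ∧ 1 < τ.T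

/-- `𝔤` is of type A and `σ` is not inner. -/
def IsOuterA : Prop := (∃ d, t = .A d) ∧ ¬ τ.IsInner

open Classical in
/-- The remainder `rₙ` of the Euclidean division by `T` of `-n`, or of `-n (1 + T / 2)` in type A
with `σ` not inner (then `T` is even). -/
def rem (n : ℕ) : ℕ :=
  if τ.IsOuterA then (-((n : ℤ) + (n : ℤ) * τ.T / 2) % (τ.T : ℤ)).toNat
  else (-(n : ℤ) % (τ.T : ℤ)).toNat

/-- The set of degrees `n` of the charges attached to a regular zero `z₀`. -/
def degrees (z₀ : ℂ) : Set ℕ :=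
  {n | t.IsDegree n ∧ (τ.IsCyclotomic z₀ → τ.rem n ≠ τ.T - 1)}

end TwistData

/-! ### Path-ordered exponentials -/

/-- The terms of the Dyson series:
`Dₙ(x) = ∫_{y ≤ x₁ ≤ ⋯ ≤ xₙ ≤ x} A(xₙ) ⋯ A(x₁)`, through `Dₙ₊₁(x) = ∫_y^x A(z) Dₙ(z) dz`. -/
def dysonTerm {n : Type*} [Fintype n] [DecidableEq n] (A : ℝ → Matrix n n ℂ) (y : ℝ) :
    ℕ → ℝ → Matrix n n ℂ
  | 0, _ => 1
  | k + 1, x => Matrix.of fun i j => ∫ z in y..x, (A z * dysonTerm A y k z) i j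

/-- The path-ordered exponential `P exp ∫_y^x A(z) dz` (larger arguments to the left), the solution
of `U'(x) = A(x) U(x)`, `U(y) = 1`. -/
def pathOrderedExp {n : Type*} [Fintype n] [DecidableEq n] (A : ℝ → Matrix n n ℂ) (x y : ℝ) :
    Matrix n n ℂ :=
  Matrix.of fun i j => ∑' k, dysonTerm A y k x i j

/-! ### Non-ultralocal models with twist function -/

/-- The coefficient of `μⁿ` in `exp (-(n - 1)/d ∑_{k ≥ 2} μᵏ sₖ / k)` (the exponential series is
cut off at the power `n`, which does not change this coefficient). -/
def expCoeff (d n : ℕ) (s : ℕ → ℂ) : ℂ :=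
  ∑ j ∈ Finset.range (n + 1), ((j.factorial : ℂ))⁻¹ *
    PowerSeries.coeff n
      ((PowerSeries.mk fun k => if 2 ≤ k then -(((n : ℂ) - 1) / d) * (s k / k) else 0) ^ j)

/-- A model on the phase space `M` whose Lax matrix `L(z, x)` satisfies an `r/s`-system with twist
function. `D` is the domain of the spectral parameter. -/
structure Model (t : ClassicalType) (S : Space) {M : Type*} [DiffeologicalSpace M]
    (P : PoissonStructure M) extends TwistData t where
  D : Set ℂ
  D_open : IsOpen D
  /-- `lax z x m` is the value of `L(z, x)` at the point `m` of phase space. -/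
  lax : ℂ → ℝ → M → t.alg
  /-- `L` depends smoothly on all variables, and holomorphically on the spectral parameter. -/
  lax_smooth : ∀ γ : ℝ → M, DSmooth γ → ∀ i j, ContDiffOn ℝ ∞
    (fun p : ℂ × ℝ × ℝ => (lax p.1 p.2.1 (γ p.2.2) : t.Mat) i j) (D ×ˢ Set.univ)
  lax_holomorphic : ∀ x m i j, DifferentiableOn ℂ (fun z => (lax z x m : t.Mat) i j) D
  lax_equivariant : ∀ z ∈ D, toTwistData.root * z ∈ D ∧
    ∀ x m, toTwistData.σ (lax z x m) = lax (toTwistData.root * z) x m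
  /-- On the circle the fields are periodic. -/
  lax_periodic : S = .circle → ∀ z ∈ D, ∀ x m, lax z (x + 2 * Real.pi) m = lax z x m
  /-- On the line the fields decrease at infinity, like `1 / x²`, locally uniformly along smooth
  curves and in the spectral parameter; so do their variations. -/
  lax_decay : S = .line → ∀ γ : ℝ → M, DSmooth γ → ∀ K ⊆ D, IsCompact K → ∀ b : ℝ,
    ∃ c : ℝ, ∀ z ∈ K, ∀ s ∈ Set.Icc (-b) b, ∀ x i j,
      ‖(lax z x (γ s) : t.Mat) i j‖ ≤ c / (1 + x ^ 2) ∧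
      ‖deriv (fun u => (lax z x (γ u) : t.Mat) i j) s‖ ≤ c / (1 + x ^ 2)
  /-- The smeared Lax matrices `∫ f(x) L(z, x) dx` are observables. -/
  smeared_mem : ∀ z ∈ D, ∀ f, S.IsTest f → ∀ i j,
    (fun m => S.integral fun x => f x * (lax z x m : t.Mat) i j) ∈ P.obs
  /-- The bracket
  `{L₁(z,x), L₂(w,y)} = [R₁₂(z,w), L₁(z,x)] δ(x-y) - [R₂₁(w,z), L₂(w,y)] δ(x-y)
  - (R₁₂(z,w) + R₂₁(w,z)) δ'(x-y)`, integrated against `f(x) h(y)`. -/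
  maillet : ∀ (z : ℂ) (hz : z ∈ D) (w : ℂ) (hw : w ∈ D), toTwistData.IsGeneric z →
    toTwistData.IsGeneric w → z ^ toTwistData.T ≠ w ^ toTwistData.T →
    ∀ (f : ℝ → ℂ) (hf : S.IsTest f) (h : ℝ → ℂ) (hh : S.IsTest h) (i j k l : t.Idx) (m : M),
    (P.bracket ⟨_, smeared_mem z hz f hf i j⟩ ⟨_, smeared_mem w hw h hh k l⟩ : M → ℂ) m =
      (S.integral fun x => f x * h x *
        ((toTwistData.R12 z w * ((lax z x m : t.Mat) ⊗ₖ (1 : t.Mat))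
            - ((lax z x m : t.Mat) ⊗ₖ (1 : t.Mat)) * toTwistData.R12 z w)
          - (toTwistData.R21 w z * ((1 : t.Mat) ⊗ₖ (lax w x m : t.Mat))
            - ((1 : t.Mat) ⊗ₖ (lax w x m : t.Mat)) * toTwistData.R21 w z)) (i, k) (j, l))
      + (toTwistData.R12 z w + toTwistData.R21 w z) (i, k) (j, l) *
        S.integral fun x => deriv f x * h x

namespace Model

variable {t : ClassicalType} {S : Space} {M : Type*} [DiffeologicalSpace M]
  {P : PoissonStructure M} (𝓜 : Model t S P)

/-- `φ(z) L(z, x)`, extended by continuity to the points where it has a removable singularity. -/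
def scaledLax (z : ℂ) (x : ℝ) (m : M) : t.Mat :=
  Matrix.of fun i j => limUnder (𝓝[≠] z) fun w => 𝓜.φval w * (𝓜.lax w x m : t.Mat) i j

/-- `z₀ ∈ ℂ` is a regular zero: a zero of `φ` at which `φ(z) L(z, x)` is holomorphic. -/
def IsRegularZero (z₀ : ℂ) : Prop :=
  𝓜.φ.num.eval z₀ = 0 ∧ (∀ᶠ z in 𝓝[≠] z₀, z ∈ 𝓜.D) ∧
  ∀ x m i j, ∃ s : ℂ → ℂ, AnalyticAt ℂ s z₀ ∧
    ∀ᶠ z in 𝓝[≠] z₀, s z = 𝓜.φval z * (𝓜.lax z x m : t.Mat) i j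

/-- A set `𝓩` of regular zeros whose orbits under multiplication by `ω` are pairwise disjoint. -/
def IsRegularZeroSet (Z : Finset ℂ) : Prop :=
  (∀ z₀ ∈ Z, 𝓜.IsRegularZero z₀) ∧
  ∀ z₀ ∈ Z, ∀ w₀ ∈ Z, z₀ ≠ w₀ → ∀ k : ℕ, 𝓜.root ^ k * z₀ ≠ w₀

/-- `Tr (φ(z)ⁿ L(z, x)ⁿ)`. -/
def tracePow (n : ℕ) (z : ℂ) (x : ℝ) (m : M) : ℂ := (𝓜.scaledLax z x m ^ n).trace

open Classical in
/-- The functions `𝓦ₙ(z, x)` from which the current at the zero `z₀` is extracted: the trace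
of the `n`-th power in types B, C, D, and in type A when `σ` is inner and `z₀` is cyclotomic;
otherwise in type A the coefficient of `μⁿ` in `det (1 - μ φ(z) L(z, x)) ^ ((n - 1) / d)`. -/
def W (z₀ : ℂ) (n : ℕ) (z : ℂ) (x : ℝ) (m : M) : ℂ :=
  match t with
  | .A d =>
    if 𝓜.IsCyclotomic z₀ ∧ 𝓜.IsInner then 𝓜.tracePow n z x m
    else expCoeff d n fun k => 𝓜.tracePow k z x m
  | .BD _ => 𝓜.tracePow n z x m
  | .C _ => 𝓜.tracePow n z x m

open Classical in
/-- The current at the regular zero `z₀`: the value of `𝓦ₙ` at `z₀` if `z₀` is not cyclotomic, and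
the coefficient of `z ^ rₙ` in the power series expansion of `𝓦ₙ` at `z₀ = 0` otherwise. -/
def current (z₀ : ℂ) (n : ℕ) (x : ℝ) (m : M) : ℂ :=
  if 𝓜.IsCyclotomic z₀ then
    iteratedDeriv (𝓜.rem n) (fun z => 𝓜.W z₀ n z x m) 0 / ((𝓜.rem n).factorial : ℂ)
  else 𝓜.W z₀ n z₀ x m

/-- The local charge: the integral of the current over space. -/
def charge (z₀ : ℂ) (n : ℕ) (m : M) : ℂ := S.integral fun x => 𝓜.current z₀ n x m

/-- The transfer matrix `T(z; x, y)`, the path-ordered exponential of `-∫_y^x L(z, u) du`. -/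
def transfer (z : ℂ) (x y : ℝ) (m : M) : t.Mat :=
  pathOrderedExp (fun u => -(𝓜.lax z u m : t.Mat)) x y

/-- The monodromy `T(z)`: from `-∞` to `∞` on the line, from `0` to `2π` on the circle. -/
def monodromy (z : ℂ) (m : M) : t.Mat :=
  match S with
  | .line => Matrix.of fun i j =>
      limUnder (atTop ×ˢ atBot) fun p : ℝ × ℝ => 𝓜.transfer z p.1 p.2 m i j
  | .circle => 𝓜.transfer z (2 * Real.pi) 0 m

/-- The non-local charges: on the line the matrix entries of the monodromy, on the circle its
central functions. -/
def nonLocalCharges : Set (M → ℂ) :=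
  match S with
  | .line => {G | ∃ z ∈ 𝓜.D, ∃ i j, G = fun m => 𝓜.monodromy z m i j}
  | .circle => {G | ∃ z ∈ 𝓜.D, ∃ f, t.IsCentralFunction f ∧ G = fun m => f (𝓜.monodromy z m)}

/-- `p` acts as a momentum: `{p, L(z, x)} = ∂ₓ L(z, x)`, integrated against `f(x)`. -/
def IsMomentum (p : P.obs) : Prop :=
  ∀ (z : ℂ) (hz : z ∈ 𝓜.D) (f : ℝ → ℂ) (hf : S.IsTest f) (i j : t.Idx) (m : M),
    (P.bracket p ⟨_, 𝓜.smeared_mem z hz f hf i j⟩ : M → ℂ) m =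
      -S.integral fun x => deriv f x * (𝓜.lax z x m : t.Mat) i j

end Model

end TwistModel

end

/-! A local charge acts on the Lax matrix by an infinitesimal gauge transformation. For all but
isolated `z`, one has {Q, L(z,x)} = ∂ₓN − [N, L(z,x)], where N takes values in 𝔤, is periodic on the
circle and tends to zero at both infinities of the line. The monodromy then varies by a commutator
with the boundary value of N. On the line this value is zero; on the circle the derivative of a
central function vanishes on such a commutator.

The gauge form is obtained as follows. The current at a regular zero z₀ is a Taylor coefficient of
order r of G(φ(w)L(w,x)), where G is an invariant function whose gradient Γ commutes with its
argument (`exists_W_eq`). By Cauchy's formula it is a contour integral over a small circle around z₀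
that stays inside D (`IsDisc.current_eq`). On this circle w is generic, so the bracket of Lax
matrices gives the response of L(w) to L(z). It is paired with φ(w)Γ and traced over the second
factor (`trace_mul_variation`). The term [R₂₁, L(w)₂] drops out, because Γ commutes with L(w). In
the R₁₂ terms φ(w) cancels against 1/φ(w), and what remains is governed by N, the contour integral
of Tr₂(R⁰₁₂Γ₂). The R₂₁ term in front of the derivative of the delta function keeps the factor φ(w).
It contributes nothing, since φ vanishes at z₀ to order at least r + 1 and all other factors are
holomorphic in the disc. This order is where the restriction on degrees enters. At a cyclotomic
point, equivariance forces T to divide the order of the zero plus one, while r = rₙ ≤ T − 2;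
elsewhere r = 0 (`exists_factor`, `exists_isDisc`). The result is `exists_isGauge_charge`.

The analytic side differentiates the monodromy along curves in phase space. The decay c/(1 + x²)
makes the Dyson series converge uniformly on the whole line; Duhamel's formula and dominated
convergence then give the variation (`hasDerivAt_transport`), and a gauge variation integrates to
boundary terms (`transport_gauge`). Exceptional values of the spectral parameter are reached by
continuity in `inInvolution_of_isGauge`.

For the Hamiltonian, gauge actions add up, and the momentum is one of them, with N = L. The
quadratic charges are always admissible (`two_mem_degrees`). Vanishing brackets imply constancy
because the velocity of a motion is a Hamiltonian vector. -/

noncomputable section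

namespace TwistModel

/-! ### Path-ordered exponentials in Banach algebras -/

section Dyson

open MeasureTheory Set

variable {𝔸 : Type*} [NormedRing 𝔸] [NormedAlgebra ℝ 𝔸]

/-- The terms of the Dyson series in a Banach algebra. -/
def dyson (A : ℝ → 𝔸) (y : ℝ) : ℕ → ℝ → 𝔸
  | 0, _ => 1
  | k + 1, x => ∫ z in y..x, A z * dyson A y k z

/-- The path-ordered exponential in a Banach algebra. -/
def pexp (A : ℝ → 𝔸) (x y : ℝ) : 𝔸 := ∑' k, dyson A y k x

/-- The inverse of the path-ordered exponential: the solution of `V' = -V A`, `V y = 1`. -/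
def pexpInv (A : ℝ → 𝔸) (x y : ℝ) : 𝔸 :=
  MulOpposite.unop (pexp (fun u => MulOpposite.op (-A u)) x y)

/-- The majorant c/(1 + u²) of a connection is the derivative of c·arctan u, so its iterated
integrals are powers divided by factorials. -/
lemma hasDerivAt_mul_arctan_pow (c y : ℝ) (k : ℕ) (u : ℝ) :
    HasDerivAt (fun u => (c * (Real.arctan u - Real.arctan y)) ^ (k + 1) / ((k + 1).factorial : ℝ))
      (c / (1 + u ^ 2) * ((c * (Real.arctan u - Real.arctan y)) ^ k / (k.factorial : ℝ))) u := by
  have h := ((((Real.hasDerivAt_arctan u).sub_const (Real.arctan y)).const_mul c).pow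
    (k + 1)).div_const ((k + 1).factorial : ℝ)
  convert! h using 1
  have : (k.factorial : ℝ) ≠ 0 := by positivity
  have : (1 + u ^ 2 : ℝ) ≠ 0 := by positivity
  simp only [Nat.factorial_succ, Nat.cast_mul, Nat.cast_add, Nat.cast_one, add_tsub_cancel_right]
  field_simp

lemma integral_mul_arctan_pow (c y x : ℝ) (k : ℕ) :
    ∫ u in y..x, c / (1 + u ^ 2) * ((c * (Real.arctan u - Real.arctan y)) ^ k / (k.factorial : ℝ))
      = (c * (Real.arctan x - Real.arctan y)) ^ (k + 1) / ((k + 1).factorial : ℝ) := by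
  rw [intervalIntegral.integral_eq_sub_of_hasDerivAt
    (fun u _ => hasDerivAt_mul_arctan_pow c y k u)]
  · simp
  · apply Continuous.intervalIntegrable
    have : ∀ u : ℝ, 1 + u ^ 2 ≠ 0 := fun u => by positivity
    have := Real.continuous_arctan
    fun_prop (disch := assumption)

/-- The bound is the volume of an ordered simplex in the variable c·arctan x. An arbitrary
order-connected `J` covers the line, the closed interval of the circle, and the bounded open
intervals used for local estimates. -/
lemma norm_dyson_le {A : ℝ → 𝔸} {J : Set ℝ} (hJ : J.OrdConnected) {c : ℝ} (hc : 0 ≤ c)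
    (hA : ∀ x ∈ J, ‖A x‖ ≤ c / (1 + x ^ 2)) (h1 : ‖(1 : 𝔸)‖ ≤ 1) {y : ℝ} (hy : y ∈ J) (k : ℕ) :
    ∀ x ∈ J, ‖dyson A y k x‖ ≤ (c * |Real.arctan x - Real.arctan y|) ^ k / (k.factorial : ℝ) := by
  have hcont : ∀ k, Continuous fun u : ℝ =>
      c / (1 + u ^ 2) * ((c * (Real.arctan u - Real.arctan y)) ^ k / (k.factorial : ℝ)) := by
    intro k
    have : ∀ u : ℝ, 1 + u ^ 2 ≠ 0 := fun u => by positivity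
    have := Real.continuous_arctan
    fun_prop (disch := assumption)
  have hcont' : ∀ k, Continuous fun u : ℝ =>
      c / (1 + u ^ 2) * ((c * |Real.arctan u - Real.arctan y|) ^ k / (k.factorial : ℝ)) := by
    intro k
    have : ∀ u : ℝ, 1 + u ^ 2 ≠ 0 := fun u => by positivity
    have := Real.continuous_arctan
    fun_prop (disch := assumption)
  induction k with
  | zero => intro x _; simpa [dyson] using h1
  | succ k ih =>
    intro x hx
    have hb : ∀ u ∈ J, ‖A u * dyson A y k u‖ ≤
        c / (1 + u ^ 2) * ((c * |Real.arctan u - Real.arctan y|) ^ k / (k.factorial : ℝ)) :=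
      fun u hu => (norm_mul_le _ _).trans
        (mul_le_mul (hA u hu) (ih u hu) (norm_nonneg _) (by positivity))
    simp only [dyson]
    rcases le_total y x with h | h
    · calc _ ≤ ∫ u in y..x, c / (1 + u ^ 2) *
            ((c * |Real.arctan u - Real.arctan y|) ^ k / (k.factorial : ℝ)) :=
          intervalIntegral.norm_integral_le_of_norm_le h
            (.of_forall fun u hu => hb u (hJ.out hy hx (Ioc_subset_Icc_self hu)))
            ((hcont' k).intervalIntegrable _ _)
        _ = ∫ u in y..x, c / (1 + u ^ 2) *
            ((c * (Real.arctan u - Real.arctan y)) ^ k / (k.factorial : ℝ)) := by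
          refine intervalIntegral.integral_congr fun u hu => ?_
          rw [uIcc_of_le h] at hu
          rw [abs_of_nonneg (sub_nonneg.2 (Real.arctan_strictMono.monotone hu.1))]
        _ = _ := by
          rw [integral_mul_arctan_pow,
            abs_of_nonneg (sub_nonneg.2 (Real.arctan_strictMono.monotone h))]
    -- To the left of y the absolute value produces the sign (-1)^k; reversing the interval supplies
    -- the remaining sign for the power k + 1.
    · rw [intervalIntegral.integral_symm, norm_neg]
      calc _ ≤ ∫ u in x..y, c / (1 + u ^ 2) *
            ((c * |Real.arctan u - Real.arctan y|) ^ k / (k.factorial : ℝ)) :=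
          intervalIntegral.norm_integral_le_of_norm_le h
            (.of_forall fun u hu => hb u (hJ.out hx hy (Ioc_subset_Icc_self hu)))
            ((hcont' k).intervalIntegrable _ _)
        _ = ∫ u in x..y, (-1) ^ k * (c / (1 + u ^ 2) *
            ((c * (Real.arctan u - Real.arctan y)) ^ k / (k.factorial : ℝ))) := by
          refine intervalIntegral.integral_congr fun u hu => ?_
          rw [uIcc_of_le h] at hu
          rw [abs_of_nonpos (sub_nonpos.2 (Real.arctan_strictMono.monotone hu.2)), mul_neg,
            neg_pow (c * (Real.arctan u - Real.arctan y))]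
          ring
        _ = _ := by
          rw [intervalIntegral.integral_const_mul, intervalIntegral.integral_symm,
            integral_mul_arctan_pow,
            abs_of_nonpos (sub_nonpos.2 (Real.arctan_strictMono.monotone h)), mul_neg, mul_neg,
            neg_pow (c * (Real.arctan x - Real.arctan y))]
          ring

lemma abs_arctan_sub_le (x y : ℝ) : |Real.arctan x - Real.arctan y| ≤ Real.pi := by
  have := Real.arctan_lt_pi_div_two x
  have := Real.arctan_lt_pi_div_two y
  have := Real.neg_pi_div_two_lt_arctan x
  have := Real.neg_pi_div_two_lt_arctan y
  rw [abs_le]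
  constructor <;> linarith

/-- Since arctan has bounded range, the estimate becomes uniform in both endpoints, even on the
whole line. -/
lemma norm_dyson_le_pi {A : ℝ → 𝔸} {J : Set ℝ} (hJ : J.OrdConnected) {c : ℝ} (hc : 0 ≤ c)
    (hA : ∀ x ∈ J, ‖A x‖ ≤ c / (1 + x ^ 2)) (h1 : ‖(1 : 𝔸)‖ ≤ 1) {x y : ℝ} (hx : x ∈ J)
    (hy : y ∈ J) (k : ℕ) : ‖dyson A y k x‖ ≤ (c * Real.pi) ^ k / (k.factorial : ℝ) := by
  refine (norm_dyson_le hJ hc hA h1 hy k x hx).trans ?_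
  have := abs_arctan_sub_le x y
  gcongr

lemma norm_pexp_le {A : ℝ → 𝔸} {J : Set ℝ} (hJ : J.OrdConnected) {c : ℝ} (hc : 0 ≤ c)
    (hA : ∀ x ∈ J, ‖A x‖ ≤ c / (1 + x ^ 2)) (h1 : ‖(1 : 𝔸)‖ ≤ 1) {x y : ℝ} (hx : x ∈ J)
    (hy : y ∈ J) : ‖pexp A x y‖ ≤ Real.exp (c * Real.pi) := by
  rw [Real.exp_eq_exp_ℝ]
  exact tsum_of_norm_bounded (NormedSpace.expSeries_div_hasSum_exp (c * Real.pi))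
    (norm_dyson_le_pi hJ hc hA h1 hx hy)

lemma norm_pexpInv_le {A : ℝ → 𝔸} {J : Set ℝ} (hJ : J.OrdConnected) {c : ℝ} (hc : 0 ≤ c)
    (hA : ∀ x ∈ J, ‖A x‖ ≤ c / (1 + x ^ 2)) (h1 : ‖(1 : 𝔸)‖ ≤ 1) {x y : ℝ} (hx : x ∈ J)
    (hy : y ∈ J) : ‖pexpInv A x y‖ ≤ Real.exp (c * Real.pi) := by
  rw [pexpInv, MulOpposite.norm_unop]
  exact norm_pexp_le hJ hc (by simpa [MulOpposite.norm_op] using hA)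
    (by rwa [← MulOpposite.op_one, MulOpposite.norm_op]) hx hy

lemma pexp_self (A : ℝ → 𝔸) (y : ℝ) : pexp A y y = 1 := by
  rw [pexp, tsum_eq_single 0]
  · rfl
  · rintro (_ | k) hk
    · exact absurd rfl hk
    · simp [dyson]

lemma pexpInv_self (A : ℝ → 𝔸) (y : ℝ) : pexpInv A y y = 1 := by
  simp [pexpInv, pexp_self]

/-- On a bounded interval continuity alone gives a majorant of the same shape, so the differential
equation for the transport needs no decay. -/
lemma exists_bound_on_Ioo {A : ℝ → 𝔸} (hA : Continuous A) (R : ℝ) :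
    ∃ c, 0 ≤ c ∧ ∀ x ∈ Ioo (-R) R, ‖A x‖ ≤ c / (1 + x ^ 2) := by
  obtain ⟨C, hC⟩ := (isCompact_Icc (a := -R) (b := R)).exists_bound_of_continuousOn
    (f := fun x => (1 + x ^ 2) • A x) (by fun_prop)
  refine ⟨max C 0, le_max_right _ _, fun x hx => ?_⟩
  have h := hC x (Ioo_subset_Icc_self hx)
  rw [norm_smul, Real.norm_of_nonneg (by positivity)] at h
  rw [le_div_iff₀ (by positivity), mul_comm]
  exact h.trans (le_max_left _ _)

variable [CompleteSpace 𝔸]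

/-- The two claims are proved together: continuity of each term allows the next one to be
differentiated. -/
lemma hasDerivAt_dyson_succ {A : ℝ → 𝔸} (hA : Continuous A) (y : ℝ) (k : ℕ) :
    Continuous (dyson A y k) ∧
      ∀ x, HasDerivAt (dyson A y (k + 1)) (A x * dyson A y k x) x := by
  induction k with
  | zero =>
    have h : Continuous (dyson A y 0) := continuous_const
    exact ⟨h, fun x => intervalIntegral.integral_hasDerivAt_right
      ((hA.mul h).intervalIntegrable _ _) ((hA.mul h).stronglyMeasurableAtFilter _ _)
      (hA.mul h).continuousAt⟩
  | succ k ih =>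
    have h : Continuous (dyson A y (k + 1)) :=
      continuous_iff_continuousAt.2 fun x => (ih.2 x).continuousAt
    exact ⟨h, fun x => intervalIntegral.integral_hasDerivAt_right
      ((hA.mul h).intervalIntegrable _ _) ((hA.mul h).stronglyMeasurableAtFilter _ _)
      (hA.mul h).continuousAt⟩

lemma summable_dyson {A : ℝ → 𝔸} (hA : Continuous A) (h1 : ‖(1 : 𝔸)‖ ≤ 1) (x y : ℝ) :
    Summable fun k => dyson A y k x := by
  obtain ⟨c, hc, hb⟩ := exists_bound_on_Ioo hA (max |x| |y| + 1)
  refine .of_norm_bounded (NormedSpace.expSeries_div_summable (c * Real.pi))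
    (norm_dyson_le_pi ordConnected_Ioo hc hb h1 ?_ ?_)
  · rw [mem_Ioo, ← abs_lt]; exact (le_max_left _ _).trans_lt (lt_add_one _)
  · rw [mem_Ioo, ← abs_lt]; exact (le_max_right _ _).trans_lt (lt_add_one _)

lemma hasDerivAt_pexp {A : ℝ → 𝔸} (hA : Continuous A) (h1 : ‖(1 : 𝔸)‖ ≤ 1) (x y : ℝ) :
    HasDerivAt (fun x => pexp A x y) (A x * pexp A x y) x := by
  set R := max |x| |y| + 1
  obtain ⟨c, hc, hb⟩ := exists_bound_on_Ioo hA R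
  have hx : x ∈ Ioo (-R) R := by
    rw [mem_Ioo, ← abs_lt]; exact (le_max_left _ _).trans_lt (lt_add_one _)
  have hy : y ∈ Ioo (-R) R := by
    rw [mem_Ioo, ← abs_lt]; exact (le_max_right _ _).trans_lt (lt_add_one _)
  have hsum : Summable fun k : ℕ => c * ((c * Real.pi) ^ k / (k.factorial : ℝ)) :=
    (NormedSpace.expSeries_div_summable (c * Real.pi)).mul_left c
  -- The constant zeroth term is set aside, so that the derivative of every remaining term is A
  -- times its predecessor.
  have key := hasDerivAt_tsum_of_isPreconnected (g := fun k x => dyson A y (k + 1) x)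
    (g' := fun k x => A x * dyson A y k x) hsum isOpen_Ioo isPreconnected_Ioo
    (fun k x _ => (hasDerivAt_dyson_succ hA y k).2 x)
    (fun k x hx => by
      refine (norm_mul_le _ _).trans (mul_le_mul ((hb x hx).trans ?_)
        (norm_dyson_le_pi ordConnected_Ioo hc hb h1 hx hy k) (norm_nonneg _) hc)
      exact div_le_self hc (by nlinarith [sq_nonneg x]))
    hy ((summable_nat_add_iff 1).2 (summable_dyson hA h1 y y)) hx
  have h0 : (fun x => pexp A x y) = fun x => 1 + ∑' k, dyson A y (k + 1) x := by
    ext x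
    exact (summable_dyson hA h1 x y).tsum_eq_zero_add
  rw [h0, pexp, ← (summable_dyson hA h1 x y).tsum_mul_left]
  exact key.const_add 1

/-- In the opposite algebra the equation V' = -V A takes the form solved by `pexp`. -/
lemma hasDerivAt_pexpInv {A : ℝ → 𝔸} (hA : Continuous A) (h1 : ‖(1 : 𝔸)‖ ≤ 1) (x y : ℝ) :
    HasDerivAt (fun x => pexpInv A x y) (-(pexpInv A x y * A x)) x := by
  have h := hasDerivAt_pexp (A := fun u => MulOpposite.op (-A u))
    (MulOpposite.continuous_op.comp hA.neg)
    (by rwa [← MulOpposite.op_one, MulOpposite.norm_op]) x y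
  have h2 := ((MulOpposite.opContinuousLinearEquiv ℝ (M := 𝔸)).symm :
    𝔸ᵐᵒᵖ →L[ℝ] 𝔸).hasFDerivAt.comp_hasDerivAt x h
  convert! h2 using 1
  simp [pexpInv]

/-- The variation of constants formula. -/
lemma hasDerivAt_pexpInv_mul_mul {A B N : ℝ → 𝔸} (hA : Continuous A) (hB : Continuous B)
    (h1 : ‖(1 : 𝔸)‖ ≤ 1) {x y : ℝ} {N' : 𝔸} (hN : HasDerivAt N N' x) :
    HasDerivAt (fun x => pexpInv A x y * N x * pexp B x y)
      (pexpInv A x y * (N' + N x * B x - A x * N x) * pexp B x y) x := by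
  convert! ((hasDerivAt_pexpInv hA h1 x y).mul hN).mul (hasDerivAt_pexp hB h1 x y) using 1
  simp only [Pi.mul_apply]
  noncomm_ring

lemma continuous_pexp {A : ℝ → 𝔸} (hA : Continuous A) (h1 : ‖(1 : 𝔸)‖ ≤ 1) (y : ℝ) :
    Continuous fun x => pexp A x y :=
  continuous_iff_continuousAt.2 fun x => (hasDerivAt_pexp hA h1 x y).continuousAt

lemma continuous_pexpInv {A : ℝ → 𝔸} (hA : Continuous A) (h1 : ‖(1 : 𝔸)‖ ≤ 1) (y : ℝ) :
    Continuous fun x => pexpInv A x y :=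
  continuous_iff_continuousAt.2 fun x => (hasDerivAt_pexpInv hA h1 x y).continuousAt

/-- Duhamel's formula: variation of constants with N = 1. It compares the transports of two
connections exactly, without linearization. -/
lemma pexpInv_mul_pexp_sub {A B : ℝ → 𝔸} (hA : Continuous A) (hB : Continuous B)
    (h1 : ‖(1 : 𝔸)‖ ≤ 1) (x x' y : ℝ) :
    pexpInv A x y * pexp B x y - pexpInv A x' y * pexp B x' y =
      ∫ u in x'..x, pexpInv A u y * (B u - A u) * pexp B u y := by
  have h : ∀ u ∈ uIcc x' x, HasDerivAt (fun x => pexpInv A x y * pexp B x y)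
      (pexpInv A u y * (B u - A u) * pexp B u y) u := fun u _ => by
    simpa using hasDerivAt_pexpInv_mul_mul hA hB h1 (y := y) (hasDerivAt_const u (1 : 𝔸))
  rw [intervalIntegral.integral_eq_sub_of_hasDerivAt h]
  exact (((continuous_pexpInv hA h1 y).mul (hB.sub hA)).mul
    (continuous_pexp hB h1 y)).intervalIntegrable _ _

lemma pexpInv_mul_pexp {A : ℝ → 𝔸} (hA : Continuous A) (h1 : ‖(1 : 𝔸)‖ ≤ 1) (x y : ℝ) :
    pexpInv A x y * pexp A x y = 1 := by
  have := pexpInv_mul_pexp_sub hA hA h1 x y y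
  simpa [pexp_self, pexpInv_self, sub_eq_zero] using this

lemma pexp_mul_pexpInv [IsDedekindFiniteMonoid 𝔸] {A : ℝ → 𝔸} (hA : Continuous A) (h1 : ‖(1 : 𝔸)‖ ≤ 1) (x y : ℝ) :
    pexp A x y * pexpInv A x y = 1 :=
  mul_eq_one_comm.1 (pexpInv_mul_pexp hA h1 x y)

end Dyson

/-! ### Integration over space -/

section SpaceIntegral

open MeasureTheory Set

/-- The domain of integration of a space. -/
def Space.carrier : Space → Set ℝ
  | .line => univ
  | .circle => Icc 0 (2 * Real.pi)

/-- The filter of points tending to the right end of a space. -/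
def Space.right : Space → Filter ℝ
  | .line => atTop
  | .circle => pure (2 * Real.pi)

/-- The filter of points tending to the left end of a space. -/
def Space.left : Space → Filter ℝ
  | .line => atBot
  | .circle => pure 0

variable (S : Space)

lemma Space.integral_eq (f : ℝ → ℂ) : S.integral f = ∫ x in S.carrier, f x := by
  cases S
  · simp [Space.integral, Space.carrier]
  · rw [Space.integral, Space.carrier, intervalIntegral.integral_of_le (by positivity),
      integral_Icc_eq_integral_Ioc]

lemma Space.ordConnected_carrier : S.carrier.OrdConnected := by
  cases S
  · exact ordConnected_univ
  · exact ordConnected_Icc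

lemma Space.zero_mem : (0 : ℝ) ∈ S.carrier := by
  cases S
  · trivial
  · exact ⟨le_rfl, by positivity⟩

lemma Space.measurableSet_carrier : MeasurableSet S.carrier := by
  cases S
  · exact MeasurableSet.univ
  · exact measurableSet_Icc

instance : S.right.NeBot := by
  cases S
  · exact inferInstanceAs (atTop : Filter ℝ).NeBot
  · exact inferInstanceAs (pure _ : Filter ℝ).NeBot

instance : S.left.NeBot := by
  cases S
  · exact inferInstanceAs (atBot : Filter ℝ).NeBot
  · exact inferInstanceAs (pure _ : Filter ℝ).NeBot

lemma Space.eventually_right_mem : ∀ᶠ x in S.right, x ∈ S.carrier := by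
  cases S
  · exact .of_forall fun _ => trivial
  · exact eventually_pure.2 ⟨by positivity, le_rfl⟩

lemma Space.eventually_left_mem : ∀ᶠ x in S.left, x ∈ S.carrier := by
  cases S
  · exact .of_forall fun _ => trivial
  · exact eventually_pure.2 ⟨le_rfl, by positivity⟩

lemma Space.integrableOn_bound (c : ℝ) : IntegrableOn (fun x => c / (1 + x ^ 2)) S.carrier := by
  have := (integrable_inv_one_add_sq.const_mul c).integrableOn (s := S.carrier)
  simpa only [div_eq_mul_inv] using this

variable {E : Type*} [NormedAddCommGroup E] {S}

lemma Space.integrableOn_of_bound {f : ℝ → E} (hf : Continuous f) {c : ℝ}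
    (hb : ∀ x ∈ S.carrier, ‖f x‖ ≤ c / (1 + x ^ 2)) : IntegrableOn f S.carrier :=
  (S.integrableOn_bound c).mono' hf.aestronglyMeasurable
    ((ae_restrict_iff' S.measurableSet_carrier).2 (.of_forall hb))

variable [NormedSpace ℝ E]

/-- On the circle the filters at the two ends are pure, so limits there are evaluations at 0 and 2π.
This lets one argument serve both kinds of space. -/
lemma Space.tendsto_integral {f : ℝ → E} (hf : IntegrableOn f S.carrier) :
    Tendsto (fun p : ℝ × ℝ => ∫ u in p.2..p.1, f u) (S.right ×ˢ S.left)
      (𝓝 (∫ u in S.carrier, f u)) := by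
  cases S
  · simp only [Space.carrier, Measure.restrict_univ, Space.right, Space.left] at hf ⊢
    have h : Tendsto (fun p : ℝ × ℝ => ∫ u in p.2..p.1, f u)
        ((atTop : Filter ℝ) ×ˢ (atBot : Filter ℝ)) (𝓝 (∫ u, f u)) :=
      intervalIntegral_tendsto_integral (integrableOn_univ.1 hf) tendsto_snd tendsto_fst
    exact h
  · simp only [Space.right, Space.left, prod_pure_pure]
    convert! tendsto_pure_nhds _ _ using 2
    rw [Space.carrier, intervalIntegral.integral_of_le (by positivity),
      integral_Icc_eq_integral_Ioc]

lemma Space.exists_tendsto_right {f : ℝ → E} (hf : IntegrableOn f S.carrier) :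
    ∃ u, Tendsto (fun x => ∫ u in (0 : ℝ)..x, f u) S.right (𝓝 u) := by
  cases S
  · exact ⟨_, intervalIntegral_tendsto_integral_Ioi (l := atTop) 0
      (hf.mono_set (subset_univ _)) tendsto_id⟩
  · exact ⟨_, tendsto_pure_nhds _ _⟩

lemma Space.exists_tendsto_left {f : ℝ → E} (hf : IntegrableOn f S.carrier) :
    ∃ u, Tendsto (fun x => ∫ u in (0 : ℝ)..x, f u) S.left (𝓝 u) := by
  cases S
  · refine ⟨_, (intervalIntegral_tendsto_integral_Iic (l := atBot) 0
      (hf.mono_set (subset_univ _)) tendsto_id).neg.congr fun x => ?_⟩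
    rw [id, ← intervalIntegral.integral_symm]
  · exact ⟨_, tendsto_pure_nhds _ _⟩

lemma Space.norm_integral_le {f : ℝ → E} {g : ℝ → ℝ} (hg : IntegrableOn g S.carrier)
    (h : ∀ x ∈ S.carrier, ‖f x‖ ≤ g x) {x : ℝ} (hx : x ∈ S.carrier) :
    ‖∫ u in (0 : ℝ)..x, f u‖ ≤ ∫ u in S.carrier, g u := by
  have hsub : uIoc 0 x ⊆ S.carrier :=
    uIoc_subset_uIcc.trans (S.ordConnected_carrier.uIcc_subset S.zero_mem hx)
  rw [intervalIntegral.norm_intervalIntegral_eq]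
  calc _ ≤ ∫ u in uIoc 0 x, g u := norm_integral_le_of_norm_le (hg.mono_set hsub)
        ((ae_restrict_iff' measurableSet_uIoc).2 (.of_forall fun u hu => h u (hsub hu)))
    _ ≤ _ := setIntegral_mono_set hg ((ae_restrict_iff' S.measurableSet_carrier).2
        (.of_forall fun u hu => (norm_nonneg _).trans (h u hu))) hsub.eventuallyLE

end SpaceIntegral

/-! ### Parallel transport over space -/

section Monodromy

open MeasureTheory Set

variable {𝔸 : Type*} [NormedRing 𝔸] {S : Space}

/-- A continuous connection that is bounded by `c / (1 + x ^ 2)` on the space. -/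
structure Dominated (S : Space) (c : ℝ) (A : ℝ → 𝔸) : Prop where
  continuous : Continuous A
  bound : ∀ x ∈ S.carrier, ‖A x‖ ≤ c / (1 + x ^ 2)

lemma Dominated.nonneg {c : ℝ} {A : ℝ → 𝔸} (hA : Dominated S c A) : 0 ≤ c := by
  simpa using (norm_nonneg _).trans (hA.bound 0 S.zero_mem)

lemma Dominated.sub {c : ℝ} {A B : ℝ → 𝔸} (hA : Dominated S c A) (hB : Dominated S c B) :
    Dominated S (c + c) (fun x => A x - B x) :=
  ⟨hA.continuous.sub hB.continuous, fun x hx => by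
    rw [add_div]
    exact (norm_sub_le _ _).trans (add_le_add (hA.bound x hx) (hB.bound x hx))⟩

/-- Dominated convergence for the L¹ distance of connections, the quantity that controls all
differences of transports below. -/
lemma tendsto_integral_norm_sub {ι : Type*} {l : Filter ι} [l.IsCountablyGenerated] {c : ℝ}
    {A : ι → ℝ → 𝔸} {A₀ : ℝ → 𝔸} (hA : ∀ᶠ i in l, Dominated S c (A i)) (hA₀ : Dominated S c A₀)
    (h : ∀ x ∈ S.carrier, Tendsto (fun i => A i x) l (𝓝 (A₀ x))) :
    Tendsto (fun i => ∫ u in S.carrier, ‖A i u - A₀ u‖) l (𝓝 0) := by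
  have := tendsto_integral_filter_of_dominated_convergence (μ := volume.restrict S.carrier)
    (F := fun i u => ‖A i u - A₀ u‖) (f := fun _ => 0) (l := l) (fun x => (c + c) / (1 + x ^ 2))
    (hA.mono fun i hi => (hi.continuous.sub hA₀.continuous).norm.aestronglyMeasurable)
    (hA.mono fun i hi => (ae_restrict_iff' S.measurableSet_carrier).2 (.of_forall fun x hx => by
      rw [norm_norm, add_div]
      exact (norm_sub_le _ _).trans (add_le_add (hi.bound x hx) (hA₀.bound x hx))))
    (S.integrableOn_bound _)
    ((ae_restrict_iff' S.measurableSet_carrier).2 (.of_forall fun x hx => by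
      simpa using ((h x hx).sub_const (A₀ x)).norm))
  simpa using this

variable [NormedAlgebra ℝ 𝔸]

/-- Parallel transport from `0` to the right end. -/
def rightTransport (S : Space) (A : ℝ → 𝔸) : 𝔸 := limUnder S.right fun x => pexp A x 0

/-- Parallel transport from the left end to `0`. -/
def leftTransport (S : Space) (A : ℝ → 𝔸) : 𝔸 := limUnder S.left fun x => pexpInv A x 0

variable {c : ℝ} {A B : ℝ → 𝔸} (h1 : ‖(1 : 𝔸)‖ ≤ 1)
include h1

lemma Dominated.norm_pexp_le (hA : Dominated S c A) {x : ℝ} (hx : x ∈ S.carrier) :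
    ‖pexp A x 0‖ ≤ Real.exp (c * Real.pi) :=
  TwistModel.norm_pexp_le S.ordConnected_carrier hA.nonneg hA.bound h1 hx S.zero_mem

lemma Dominated.norm_pexpInv_le (hA : Dominated S c A) {x : ℝ} (hx : x ∈ S.carrier) :
    ‖pexpInv A x 0‖ ≤ Real.exp (c * Real.pi) :=
  TwistModel.norm_pexpInv_le S.ordConnected_carrier hA.nonneg hA.bound h1 hx S.zero_mem

variable [CompleteSpace 𝔸]

/-- The derivative A·U of the transport U is integrable, since A decays and U is bounded. -/
lemma Dominated.tendsto_right (hA : Dominated S c A) :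
    Tendsto (fun x => pexp A x 0) S.right (𝓝 (rightTransport S A)) := by
  have hc := hA.continuous.mul (continuous_pexp hA.continuous h1 0)
  have hi : IntegrableOn (fun u => A u * pexp A u 0) S.carrier :=
    Space.integrableOn_of_bound hc (c := c * Real.exp (c * Real.pi)) fun x hx => by
      rw [mul_div_right_comm]
      exact (norm_mul_le _ _).trans (mul_le_mul (hA.bound x hx) (hA.norm_pexp_le h1 hx)
        (norm_nonneg _) (div_nonneg hA.nonneg (by positivity)))
  obtain ⟨u, hu⟩ := Space.exists_tendsto_right hi
  refine tendsto_nhds_limUnder ⟨u + 1, (hu.add_const 1).congr fun x => ?_⟩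
  rw [intervalIntegral.integral_eq_sub_of_hasDerivAt
    (fun u _ => hasDerivAt_pexp hA.continuous h1 u 0) (hc.intervalIntegrable _ _)]
  simp [pexp_self]

lemma Dominated.tendsto_left (hA : Dominated S c A) :
    Tendsto (fun x => pexpInv A x 0) S.left (𝓝 (leftTransport S A)) := by
  have hc := ((continuous_pexpInv hA.continuous h1 0).mul hA.continuous).neg
  have hi : IntegrableOn (fun u => -(pexpInv A u 0 * A u)) S.carrier :=
    Space.integrableOn_of_bound hc (c := c * Real.exp (c * Real.pi)) fun x hx => by
      rw [mul_div_right_comm, norm_neg, mul_comm (c / _)]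
      exact (norm_mul_le _ _).trans (mul_le_mul (hA.norm_pexpInv_le h1 hx) (hA.bound x hx)
        (norm_nonneg _) (by positivity))
  obtain ⟨u, hu⟩ := Space.exists_tendsto_left hi
  refine tendsto_nhds_limUnder ⟨u + 1, (hu.add_const 1).congr fun x => ?_⟩
  rw [intervalIntegral.integral_eq_sub_of_hasDerivAt
    (fun u _ => hasDerivAt_pexpInv hA.continuous h1 u 0) (hc.intervalIntegrable _ _)]
  simp [pexpInv_self]

lemma Dominated.tendsto_transport (hA : Dominated S c A) :
    Tendsto (fun p : ℝ × ℝ => pexp A p.1 0 * pexpInv A p.2 0) (S.right ×ˢ S.left)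
      (𝓝 (rightTransport S A * leftTransport S A)) :=
  ((hA.tendsto_right h1).comp tendsto_fst).mul ((hA.tendsto_left h1).comp tendsto_snd)

lemma integrableOn_transport (hA : Dominated S c A) (hB : Dominated S c B) {δ : ℝ → 𝔸} {c' : ℝ}
    (hδ : Dominated S c' δ) :
    IntegrableOn (fun u => pexpInv A u 0 * δ u * pexp B u 0) S.carrier ∧
    ∀ x ∈ S.carrier, ‖pexpInv A x 0 * δ x * pexp B x 0‖ ≤
      (Real.exp (c * Real.pi) * Real.exp (c * Real.pi) * c') / (1 + x ^ 2) := by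
  have hb : ∀ x ∈ S.carrier, ‖pexpInv A x 0 * δ x * pexp B x 0‖ ≤
      (Real.exp (c * Real.pi) * Real.exp (c * Real.pi) * c') / (1 + x ^ 2) := fun x hx => by
    calc _ ≤ ‖pexpInv A x 0‖ * ‖δ x‖ * ‖pexp B x 0‖ :=
          (norm_mul_le _ _).trans (mul_le_mul_of_nonneg_right (norm_mul_le _ _) (norm_nonneg _))
      _ ≤ Real.exp (c * Real.pi) * (c' / (1 + x ^ 2)) * Real.exp (c * Real.pi) := by
          have := hA.norm_pexpInv_le h1 hx
          have := hB.norm_pexp_le h1 hx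
          have := hδ.bound x hx
          have := hδ.nonneg
          gcongr
      _ = _ := by ring
  exact ⟨Space.integrableOn_of_bound (((continuous_pexpInv hA.continuous h1 0).mul
    hδ.continuous).mul (continuous_pexp hB.continuous h1 0)) hb, hb⟩

variable [IsDedekindFiniteMonoid 𝔸]

/-- As a function of x, the product of the inverse transport to 0 with the transport from y has zero
derivative; its value is read off at x = y. -/
lemma pexp_eq_mul (hA : Continuous A) (x y : ℝ) : pexp A x y = pexp A x 0 * pexpInv A y 0 := by
  have h : ∀ u, HasDerivAt (fun x => pexpInv A x 0 * pexp A x y) 0 u := fun u => by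
    convert! (hasDerivAt_pexpInv hA h1 u 0).mul (hasDerivAt_pexp hA h1 u y) using 1
    noncomm_ring
  have := is_const_of_deriv_eq_zero (fun u => (h u).differentiableAt) (fun u => (h u).deriv) x y
  simp only [pexp_self, mul_one] at this
  rw [← this, ← mul_assoc, pexp_mul_pexpInv hA h1, one_mul]

/-- The difference of two monodromies. -/
lemma transport_sub (hA : Dominated S c A) (hB : Dominated S c B) :
    rightTransport S B * leftTransport S B - rightTransport S A * leftTransport S A =
      rightTransport S A * (∫ u in S.carrier, pexpInv A u 0 * (B u - A u) * pexp B u 0) *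
        leftTransport S B := by
  have hi := (integrableOn_transport h1 hA hB (hB.sub hA)).1
  have hl := (((hA.tendsto_right h1).comp (tendsto_fst (g := S.left))).mul
    (Space.tendsto_integral hi)).mul ((hB.tendsto_left h1).comp (tendsto_snd (f := S.right)))
  refine tendsto_nhds_unique
    (((hB.tendsto_transport h1).sub (hA.tendsto_transport h1)).congr fun p => ?_) hl
  simp only [Function.comp_apply]
  rw [← pexpInv_mul_pexp_sub hA.continuous hB.continuous h1, mul_sub, sub_mul, ← mul_assoc,
    pexp_mul_pexpInv hA.continuous h1, one_mul]
  congr 1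
  simp only [mul_assoc]
  rw [pexp_mul_pexpInv hB.continuous h1, mul_one]

/-- The variation of a monodromy under an infinitesimal gauge transformation. -/
lemma transport_gauge (hA : Dominated S c A) {N N' : ℝ → 𝔸} (hN : ∀ x, HasDerivAt N (N' x) x)
    {c' : ℝ} (hδ : Dominated S c' fun x => N' x + N x * A x - A x * N x) {a b : 𝔸}
    (ha : Tendsto N S.right (𝓝 a)) (hb : Tendsto N S.left (𝓝 b)) :
    rightTransport S A * (∫ u in S.carrier, pexpInv A u 0 * (N' u + N u * A u - A u * N u) *
        pexp A u 0) * leftTransport S A =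
      a * (rightTransport S A * leftTransport S A) -
        (rightTransport S A * leftTransport S A) * b := by
  obtain ⟨hi, -⟩ := integrableOn_transport h1 hA hA hδ
  have hl := (((hA.tendsto_right h1).comp (tendsto_fst (g := S.left))).mul
    (Space.tendsto_integral hi)).mul ((hA.tendsto_left h1).comp (tendsto_snd (f := S.right)))
  refine tendsto_nhds_unique hl ((((ha.comp (tendsto_fst (g := S.left))).mul
    (hA.tendsto_transport h1)).sub ((hA.tendsto_transport h1).mul
    (hb.comp (tendsto_snd (f := S.right))))).congr fun p => ?_)
  simp only [Function.comp_apply]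
  rw [intervalIntegral.integral_eq_sub_of_hasDerivAt (fun u _ => hasDerivAt_pexpInv_mul_mul
    hA.continuous hA.continuous h1 (hN u)) ((((continuous_pexpInv hA.continuous h1 0).mul
    hδ.continuous).mul (continuous_pexp hA.continuous h1 0)).intervalIntegrable _ _),
    mul_sub, sub_mul]
  simp only [← mul_assoc]
  rw [pexp_mul_pexpInv hA.continuous h1, one_mul]
  congr 1
  simp only [mul_assoc]
  rw [pexp_mul_pexpInv hA.continuous h1, mul_one]

/-- Duhamel's formula gives three factors, each bounded by exp(cπ), and the L¹ distance of the
connections. The bound does not depend on x and therefore survives the limit to the ends of space.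
-/
lemma norm_pexp_sub_le (hA : Dominated S c A) (hB : Dominated S c B) {x : ℝ}
    (hx : x ∈ S.carrier) : ‖pexp B x 0 - pexp A x 0‖ ≤
      Real.exp (c * Real.pi) ^ 3 * ∫ u in S.carrier, ‖B u - A u‖ := by
  have hd := hB.sub hA
  have hdi := (Space.integrableOn_of_bound hd.continuous hd.bound).norm
  have h : pexp B x 0 - pexp A x 0 =
      pexp A x 0 * ∫ u in (0 : ℝ)..x, pexpInv A u 0 * (B u - A u) * pexp B u 0 := by
    rw [← pexpInv_mul_pexp_sub hA.continuous hB.continuous h1, mul_sub, ← mul_assoc,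
      pexp_mul_pexpInv hA.continuous h1]
    simp [pexp_self, pexpInv_self]
  rw [h]
  refine (norm_mul_le _ _).trans ?_
  have := Space.norm_integral_le (S := S)
    (f := fun u => pexpInv A u 0 * (B u - A u) * pexp B u 0)
    (g := fun u => Real.exp (c * Real.pi) ^ 2 * ‖B u - A u‖) (hdi.const_mul _) (fun u hu => by
      calc _ ≤ ‖pexpInv A u 0‖ * ‖B u - A u‖ * ‖pexp B u 0‖ :=
            (norm_mul_le _ _).trans (mul_le_mul_of_nonneg_right (norm_mul_le _ _) (norm_nonneg _))
        _ ≤ Real.exp (c * Real.pi) * ‖B u - A u‖ * Real.exp (c * Real.pi) := by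
            have := hA.norm_pexpInv_le h1 hu
            have := hB.norm_pexp_le h1 hu
            gcongr
        _ = _ := by ring) hx
  rw [integral_const_mul] at this
  calc _ ≤ Real.exp (c * Real.pi) * (Real.exp (c * Real.pi) ^ 2 *
        ∫ u in S.carrier, ‖B u - A u‖) :=
      mul_le_mul (hA.norm_pexp_le h1 hx) this (norm_nonneg _) (by positivity)
    _ = _ := by ring

/-- Reduced to the previous estimate by V_B − V_A = −V_A (U_B − U_A) V_B. -/
lemma norm_pexpInv_sub_le (hA : Dominated S c A) (hB : Dominated S c B) {x : ℝ}
    (hx : x ∈ S.carrier) : ‖pexpInv B x 0 - pexpInv A x 0‖ ≤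
      Real.exp (c * Real.pi) ^ 5 * ∫ u in S.carrier, ‖B u - A u‖ := by
  have h : pexpInv B x 0 - pexpInv A x 0 =
      -(pexpInv A x 0 * (pexp B x 0 - pexp A x 0) * pexpInv B x 0) := by
    rw [mul_sub, sub_mul, pexpInv_mul_pexp hA.continuous h1, mul_assoc,
      pexp_mul_pexpInv hB.continuous h1]
    noncomm_ring
  rw [h, norm_neg]
  calc _ ≤ ‖pexpInv A x 0‖ * ‖pexp B x 0 - pexp A x 0‖ * ‖pexpInv B x 0‖ :=
        (norm_mul_le _ _).trans (mul_le_mul_of_nonneg_right (norm_mul_le _ _) (norm_nonneg _))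
    _ ≤ Real.exp (c * Real.pi) * (Real.exp (c * Real.pi) ^ 3 * ∫ u in S.carrier, ‖B u - A u‖) *
          Real.exp (c * Real.pi) := by
        have := hA.norm_pexpInv_le h1 hx
        have := hB.norm_pexpInv_le h1 hx
        have := norm_pexp_sub_le h1 hA hB hx
        gcongr
    _ = _ := by ring

section Parameter

variable {ι : Type*} {l : Filter ι} [l.IsCountablyGenerated] {A B : ι → ℝ → 𝔸} {A₀ : ℝ → 𝔸}

lemma tendsto_pexp (hA : ∀ᶠ i in l, Dominated S c (A i)) (hA₀ : Dominated S c A₀)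
    (h : ∀ x ∈ S.carrier, Tendsto (fun i => A i x) l (𝓝 (A₀ x))) {x : ℝ} (hx : x ∈ S.carrier) :
    Tendsto (fun i => pexp (A i) x 0) l (𝓝 (pexp A₀ x 0)) := by
  rw [tendsto_iff_norm_sub_tendsto_zero]
  refine squeeze_zero' (.of_forall fun _ => norm_nonneg _)
    (hA.mono fun i hi => norm_pexp_sub_le h1 hA₀ hi hx) ?_
  simpa using (tendsto_integral_norm_sub hA hA₀ h).const_mul (Real.exp (c * Real.pi) ^ 3)

lemma tendsto_pexpInv (hA : ∀ᶠ i in l, Dominated S c (A i)) (hA₀ : Dominated S c A₀)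
    (h : ∀ x ∈ S.carrier, Tendsto (fun i => A i x) l (𝓝 (A₀ x))) {x : ℝ} (hx : x ∈ S.carrier) :
    Tendsto (fun i => pexpInv (A i) x 0) l (𝓝 (pexpInv A₀ x 0)) := by
  rw [tendsto_iff_norm_sub_tendsto_zero]
  refine squeeze_zero' (.of_forall fun _ => norm_nonneg _)
    (hA.mono fun i hi => norm_pexpInv_sub_le h1 hA₀ hi hx) ?_
  simpa using (tendsto_integral_norm_sub hA hA₀ h).const_mul (Real.exp (c * Real.pi) ^ 5)

lemma tendsto_rightTransport (hA : ∀ᶠ i in l, Dominated S c (A i)) (hA₀ : Dominated S c A₀)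
    (h : ∀ x ∈ S.carrier, Tendsto (fun i => A i x) l (𝓝 (A₀ x))) :
    Tendsto (fun i => rightTransport S (A i)) l (𝓝 (rightTransport S A₀)) := by
  rw [tendsto_iff_norm_sub_tendsto_zero]
  refine squeeze_zero' (.of_forall fun _ => norm_nonneg _) (hA.mono fun i hi => le_of_tendsto
    ((hi.tendsto_right h1).sub (hA₀.tendsto_right h1)).norm
    (S.eventually_right_mem.mono fun x hx => norm_pexp_sub_le h1 hA₀ hi hx)) ?_
  simpa using (tendsto_integral_norm_sub hA hA₀ h).const_mul (Real.exp (c * Real.pi) ^ 3)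

lemma tendsto_leftTransport (hA : ∀ᶠ i in l, Dominated S c (A i)) (hA₀ : Dominated S c A₀)
    (h : ∀ x ∈ S.carrier, Tendsto (fun i => A i x) l (𝓝 (A₀ x))) :
    Tendsto (fun i => leftTransport S (A i)) l (𝓝 (leftTransport S A₀)) := by
  rw [tendsto_iff_norm_sub_tendsto_zero]
  refine squeeze_zero' (.of_forall fun _ => norm_nonneg _) (hA.mono fun i hi => le_of_tendsto
    ((hi.tendsto_left h1).sub (hA₀.tendsto_left h1)).norm
    (S.eventually_left_mem.mono fun x hx => norm_pexpInv_sub_le h1 hA₀ hi hx)) ?_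
  simpa using (tendsto_integral_norm_sub hA hA₀ h).const_mul (Real.exp (c * Real.pi) ^ 5)

/-- Two families of connections occur because the exact difference formula `transport_sub` contains
the transports of both connections being compared. -/
lemma tendsto_variation (hA : ∀ᶠ i in l, Dominated S c (A i))
    (hB : ∀ᶠ i in l, Dominated S c (B i)) (hA₀ : Dominated S c A₀)
    (hAl : ∀ x ∈ S.carrier, Tendsto (fun i => A i x) l (𝓝 (A₀ x)))
    (hBl : ∀ x ∈ S.carrier, Tendsto (fun i => B i x) l (𝓝 (A₀ x)))
    {δ : ι → ℝ → 𝔸} {δ₀ : ℝ → 𝔸} {c' : ℝ} (hδ : ∀ᶠ i in l, Dominated S c' (δ i))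
    (hδl : ∀ x ∈ S.carrier, Tendsto (fun i => δ i x) l (𝓝 (δ₀ x))) :
    Tendsto (fun i => rightTransport S (A i) *
        (∫ u in S.carrier, pexpInv (A i) u 0 * δ i u * pexp (B i) u 0) * leftTransport S (B i)) l
      (𝓝 (rightTransport S A₀ * (∫ u in S.carrier, pexpInv A₀ u 0 * δ₀ u * pexp A₀ u 0) *
        leftTransport S A₀)) := by
  refine ((tendsto_rightTransport h1 hA hA₀ hAl).mul ?_).mul
    (tendsto_leftTransport h1 hB hA₀ hBl)
  refine tendsto_integral_filter_of_dominated_convergence (μ := volume.restrict S.carrier)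
    (fun x => (Real.exp (c * Real.pi) * Real.exp (c * Real.pi) * c') / (1 + x ^ 2)) ?_ ?_
    (S.integrableOn_bound _) ?_
  · filter_upwards [hA, hB, hδ] with i hi hi' hd
    exact (((continuous_pexpInv hi.continuous h1 0).mul hd.continuous).mul
      (continuous_pexp hi'.continuous h1 0)).aestronglyMeasurable
  · filter_upwards [hA, hB, hδ] with i hi hi' hd
    exact (ae_restrict_iff' S.measurableSet_carrier).2
      (.of_forall (integrableOn_transport h1 hi hi' hd).2)
  · exact (ae_restrict_iff' S.measurableSet_carrier).2 (.of_forall fun x hx =>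
      ((tendsto_pexpInv h1 hA hA₀ hAl hx).mul (hδl x hx)).mul (tendsto_pexp h1 hB hA₀ hBl hx))

end Parameter

/-- By `transport_sub` the difference quotient of the monodromy is again a variation integral, with
the difference quotient of the connection inside; `hlip` dominates the latter by an integrable
function. -/
lemma hasDerivAt_transport {A : ℝ → ℝ → 𝔸} {δ : ℝ → 𝔸}
    (hA : ∀ᶠ s in 𝓝 0, Dominated S c (A s))
    (hd : ∀ x ∈ S.carrier, HasDerivAt (fun s => A s x) (δ x) 0) {c' : ℝ}
    (hlip : ∀ᶠ s in 𝓝 (0 : ℝ), ∀ x ∈ S.carrier, ‖A s x - A 0 x‖ ≤ |s| * (c' / (1 + x ^ 2))) :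
    HasDerivAt (fun s => rightTransport S (A s) * leftTransport S (A s))
      (rightTransport S (A 0) * (∫ u in S.carrier, pexpInv (A 0) u 0 * δ u * pexp (A 0) u 0) *
        leftTransport S (A 0)) 0 := by
  rw [hasDerivAt_iff_tendsto_slope_zero]
  have hA0 := hA.self_of_nhds
  have hA' := hA.filter_mono (nhdsWithin_le_nhds (s := {0}ᶜ))
  have key := tendsto_variation h1 (S := S) (c := c) (l := 𝓝[≠] (0 : ℝ)) (A := fun _ => A 0)
    (B := A) (A₀ := A 0) (.of_forall fun _ => hA0) hA' hA0
    (fun x _ => tendsto_const_nhds)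
    (fun x hx => (hd x hx).continuousAt.tendsto.mono_left nhdsWithin_le_nhds)
    (δ := fun s x => s⁻¹ • (A s x - A 0 x)) (δ₀ := δ) (c' := c') ?_ ?_
  · refine key.congr' ?_
    filter_upwards [hA'] with s hs
    rw [zero_add, transport_sub h1 hA0 hs]
    simp only [mul_smul_comm, smul_mul_assoc, integral_smul]
  · filter_upwards [hA', hlip.filter_mono nhdsWithin_le_nhds, self_mem_nhdsWithin] with s hs hl hs0
    refine ⟨(hs.continuous.sub hA0.continuous).const_smul _, fun x hx => ?_⟩
    rw [norm_smul, norm_inv, Real.norm_eq_abs, inv_mul_le_iff₀ (abs_pos.2 hs0)]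
    exact hl x hx
  · intro x hx
    simpa using hasDerivAt_iff_tendsto_slope_zero.1 (hd x hx)

end Monodromy

attribute [local instance 100] LieRing.ofAssociativeRing LieAlgebra.ofAssociativeAlgebra

/-! ### Path-ordered exponentials of matrices -/

section MatrixTransport

open MeasureTheory Set
open scoped Matrix.Norms.Operator

variable {n : Type*}

lemma tendsto_matrix {ι : Type*} {l : Filter ι} {A : ι → Matrix n n ℂ} {A₀ : Matrix n n ℂ} :
    Tendsto A l (𝓝 A₀) ↔ ∀ i j, Tendsto (fun s => A s i j) l (𝓝 (A₀ i j)) :=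
  tendsto_pi_nhds.trans (forall_congr' fun _ => tendsto_pi_nhds)

lemma continuous_matrix' {X : Type*} [TopologicalSpace X] {A : X → Matrix n n ℂ} :
    Continuous A ↔ ∀ i j, Continuous fun x => A x i j :=
  continuous_pi_iff.trans (forall_congr' fun _ => continuous_pi_iff)

variable [Fintype n]

/-- A matrix entry, as a continuous linear form. -/
def entryCLM (i j : n) : Matrix n n ℂ →L[ℂ] ℂ :=
  LinearMap.toContinuousLinearMap (Matrix.entryLinearMap ℂ ℂ i j)

variable [DecidableEq n]

/-- An inequality rather than an equality, so that an empty index type is allowed. -/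
lemma norm_one_matrix_le : ‖(1 : Matrix n n ℂ)‖ ≤ 1 := by
  cases isEmpty_or_nonempty n
  · rw [Subsingleton.elim (1 : Matrix n n ℂ) 0, norm_zero]; exact zero_le_one
  · rw [norm_one]

lemma norm_matrix_le {A : Matrix n n ℂ} {c : ℝ} (hc : 0 ≤ c) (h : ∀ i j, ‖A i j‖ ≤ c) :
    ‖A‖ ≤ Fintype.card n * c := by
  rw [← coe_nnnorm, Matrix.linfty_opNNNorm_def]
  lift c to NNReal using hc
  rw [← NNReal.coe_natCast, ← NNReal.coe_mul, NNReal.coe_le_coe]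
  refine Finset.sup_le fun i _ => ?_
  calc _ ≤ ∑ _j : n, c := Finset.sum_le_sum fun j _ => h i j
    _ = _ := by simp

lemma hasDerivAt_matrix {A : ℝ → Matrix n n ℂ} {A' : Matrix n n ℂ} {x : ℝ} :
    HasDerivAt A A' x ↔ ∀ i j, HasDerivAt (fun s => A s i j) (A' i j) x := by
  refine ⟨fun h i j => ((entryCLM i j).restrictScalars ℝ).hasFDerivAt.comp_hasDerivAt x h,
    fun h => ?_⟩
  have : HasDerivAt (fun s => ∑ i, ∑ j, A s i j • Matrix.single i j (1 : ℂ))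
      (∑ i, ∑ j, A' i j • Matrix.single i j (1 : ℂ)) x :=
    HasDerivAt.fun_sum fun i _ => HasDerivAt.fun_sum fun j _ => (h i j).smul_const _
  convert! this using 1
  · ext1 s
    simp only [Matrix.smul_single, smul_eq_mul, mul_one]
    exact Matrix.matrix_eq_sum_single _
  · simp only [Matrix.smul_single, smul_eq_mul, mul_one]
    exact Matrix.matrix_eq_sum_single _

lemma dysonTerm_eq {A : ℝ → Matrix n n ℂ} (hA : Continuous A) (y : ℝ) (k : ℕ) (x : ℝ) :
    dysonTerm A y k x = dyson A y k x := by
  induction k generalizing x with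
  | zero => rfl
  | succ k ih =>
    ext i j
    simp only [dysonTerm, dyson, ih, Matrix.of_apply]
    have h : Continuous fun z => A z * dyson A y k z := hA.mul (hasDerivAt_dyson_succ hA y k).1
    exact (entryCLM i j).intervalIntegral_comp_comm (h.intervalIntegrable y x)

lemma pathOrderedExp_eq {A : ℝ → Matrix n n ℂ} (hA : Continuous A) (x y : ℝ) :
    pathOrderedExp A x y = pexp A x y := by
  ext i j
  simp only [pathOrderedExp, Matrix.of_apply, dysonTerm_eq hA]
  exact ((entryCLM i j).map_tsum (summable_dyson hA norm_one_matrix_le x y)).symm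

lemma dominated_of_entries {S : Space} {A : ℝ → Matrix n n ℂ} {c : ℝ}
    (hA : ∀ i j, Continuous fun x => A x i j) (hc : 0 ≤ c)
    (hb : ∀ x ∈ S.carrier, ∀ i j, ‖A x i j‖ ≤ c / (1 + x ^ 2)) :
    Dominated S (Fintype.card n * c) A :=
  ⟨continuous_matrix'.2 hA, fun x hx => by
    rw [mul_div_assoc]
    exact norm_matrix_le (by positivity) (hb x hx)⟩

/-- The logarithmic derivative of the determinant of a solution of a linear differential
equation. -/
lemma hasDerivAt_det {U : ℝ → Matrix n n ℂ} {A : Matrix n n ℂ} {x : ℝ}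
    (h : HasDerivAt U (A * U x) x) : HasDerivAt (fun s => (U s).det) (A.trace * (U x).det) x := by
  let D : ContinuousMultilinearMap ℂ (fun _ : n => n → ℂ) ℂ :=
    { Matrix.detRowAlternating.toMultilinearMap with
      cont := Continuous.matrix_det (A := fun v : n → n → ℂ => Matrix.of v) continuous_id }
  have hU : HasDerivAt (fun s => (U s : n → n → ℂ)) (A * U x : Matrix n n ℂ) x :=
    hasDerivAt_pi.2 fun i => hasDerivAt_pi.2 fun j => hasDerivAt_matrix.1 h i j
  have key := ((D.hasFDerivAt (U x)).restrictScalars ℝ).comp_hasDerivAt x hU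
  convert! key using 1
  -- Row i of A·U is a linear combination of the rows of U; only the multiple `A i i` of row i
  -- itself contributes to the determinant.
  have h2 : ∀ i, D (Function.update (U x) i ((A * U x : Matrix n n ℂ) i)) = A i i * (U x).det := by
    intro i
    have := Matrix.det_updateRow_sum (U x) i (A i)
    rw [smul_eq_mul] at this
    rw [← this]
    change Matrix.det _ = _
    congr 1
    change Function.update (U x) i _ = Function.update (U x) i _
    congr 1
    ext c
    simp [Matrix.mul_apply]
  have h3 : (D.linearDeriv (U x)) (A * U x : Matrix n n ℂ) =
      ∑ i, D (Function.update (U x) i ((A * U x : Matrix n n ℂ) i)) :=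
    ContinuousMultilinearMap.linearDeriv_apply _ _ _
  refine Eq.trans ?_ h3.symm
  simp only [h2, Matrix.trace, Matrix.diag, Finset.sum_mul]

lemma det_pexp {A : ℝ → Matrix n n ℂ} (hA : Continuous A) (htr : ∀ x, (A x).trace = 0)
    (x y : ℝ) : (pexp A x y).det = 1 := by
  have h : ∀ u, HasDerivAt (fun x => (pexp A x y).det) 0 u := fun u => by
    simpa [htr] using hasDerivAt_det (hasDerivAt_pexp hA norm_one_matrix_le u y)
  rw [is_const_of_deriv_eq_zero (fun u => (h u).differentiableAt) (fun u => (h u).deriv) x y,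
    pexp_self, Matrix.det_one]

/-- A bilinear form is invariant under the flow of its Lie algebra. -/
lemma transpose_pexp_mul_mul {A : ℝ → Matrix n n ℂ} (hA : Continuous A) {J : Matrix n n ℂ}
    (hJ : ∀ x, (A x)ᵀ * J + J * A x = 0) (x y : ℝ) :
    (pexp A x y)ᵀ * J * pexp A x y = J := by
  have h : ∀ u, HasDerivAt (fun x => (pexp A x y)ᵀ * J * pexp A x y) 0 u := fun u => by
    have hU := hasDerivAt_pexp hA norm_one_matrix_le u y
    have hT : HasDerivAt (fun x => (pexp A x y)ᵀ) (A u * pexp A u y)ᵀ u :=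
      hasDerivAt_matrix.2 fun i j => hasDerivAt_matrix.1 hU j i
    convert! (hT.mul_const J).mul hU using 1
    have : (A u)ᵀ * J = -(J * A u) := eq_neg_of_add_eq_zero_left (hJ u)
    rw [Matrix.transpose_mul, Matrix.mul_assoc _ _ J, this]
    noncomm_ring
  rw [is_const_of_deriv_eq_zero (fun u => (h u).differentiableAt) (fun u => (h u).deriv) x y,
    pexp_self]
  simp

end MatrixTransport

/-! ### Central functions -/

section Central

open scoped Matrix.Norms.Operator

variable {t : ClassicalType}

/-- The equations of the group are first integrals of U' = A U: the determinant when A is traceless,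
the bilinear form when A is skew-adjoint for it. Skew-symmetric matrices are traceless, which gives
determinant one in the orthogonal case. -/
lemma pexp_mem_group {A : ℝ → t.Mat} (hA : Continuous A) (h : ∀ x, A x ∈ t.alg) (x y : ℝ) :
    pexp A x y ∈ t.group := by
  cases t with
  | A d => exact det_pexp (n := Fin d) hA (fun x => LinearMap.mem_ker.1 (h x)) x y
  | BD d =>
    have hT : ∀ x, (A x)ᵀ = -A x := fun x => (LieAlgebra.Orthogonal.mem_so (Fin d) ℂ _).1 (h x)
    refine ⟨?_, det_pexp (n := Fin d) hA (fun x => ?_) x y⟩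
    · have := transpose_pexp_mul_mul hA (J := 1) (fun x => by
        rw [mul_one, one_mul, hT, neg_add_cancel]) x y
      rwa [mul_one] at this
    · have : (A x).trace = -(A x).trace := by
        rw [← Matrix.trace_neg, ← hT, Matrix.trace_transpose]
      exact self_eq_neg.1 this
  | C d =>
    let J : (ClassicalType.C d).Mat := Matrix.J (Fin d) ℂ
    refine transpose_pexp_mul_mul (J := J) hA (fun x => ?_) x y
    have : (A x)ᵀ * J = J * -A x :=
      (mem_skewAdjointMatricesSubmodule (R := ℂ) (Matrix.J (Fin d) ℂ) (A x)).1 (h x)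
    rw [this, mul_neg, neg_add_cancel]

lemma conj_mem_group {g k l : t.Mat} (hg : g ∈ t.group) (hk : k ∈ t.group) (hkl : k * l = 1) :
    k * g * l ∈ t.group := by
  have hform : ∀ J : t.Mat, gᵀ * J * g = J → kᵀ * J * k = J →
      (k * g * l)ᵀ * J * (k * g * l) = J := fun J hg hk => by
    have h1 : lᵀ * kᵀ = 1 := by rw [← Matrix.transpose_mul, hkl, Matrix.transpose_one]
    calc _ = lᵀ * (gᵀ * (kᵀ * J * k) * g) * l := by simp only [Matrix.transpose_mul, mul_assoc]
      _ = lᵀ * (kᵀ * J * k) * l := by rw [hk, hg]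
      _ = (lᵀ * kᵀ) * J * (k * l) := by simp only [mul_assoc]
      _ = J := by rw [h1, hkl, one_mul, mul_one]
  have hdet : g.det = 1 → (k * g * l).det = 1 := fun h => by
    rw [Matrix.det_mul, Matrix.det_mul, h, mul_one, ← Matrix.det_mul, hkl, Matrix.det_one]
  cases t with
  | A d => exact hdet hg
  | BD d =>
    have := hform 1 (by rw [mul_one]; exact hg.1) (by rw [mul_one]; exact hk.1)
    rw [mul_one] at this
    exact ⟨this, hdet hg.2⟩
  | C d => exact hform _ hg hk

/-- The derivative of a central function vanishes in the directions of the conjugacy classes. -/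
lemma IsCentralFunction.fderiv_commutator {f : t.Mat → ℂ}
    (hf : ∀ g ∈ t.group, ∀ h ∈ t.group, f (g * h * g⁻¹) = f h) {g : t.Mat} (hg : g ∈ t.group)
    {F : (t.Idx → t.Idx → ℂ) → ℂ} {F' : (t.Idx → t.Idx → ℂ) →L[ℂ] ℂ}
    (hF : HasFDerivAt F F' (Matrix.of.symm g))
    (heq : ∀ᶠ h in 𝓝 g, h ∈ t.group → f h = F (Matrix.of.symm h)) {N : t.Mat} (hN : N ∈ t.alg) :
    F' (Matrix.of.symm (N * g - g * N)) = 0 := by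
  have hc : Continuous fun _ : ℝ => N := continuous_const
  -- The conjugates of g by exp(sN), the exponential being the transport of a constant connection.
  -- This curve stays in the group, f is constant on it, and its velocity at s = 0 is the
  -- commutator.
  set k : ℝ → t.Mat := fun s => pexp (fun _ => N) s 0 * g * pexpInv (fun _ => N) s 0 with hk
  have hk0 : k 0 = g := by simp [hk, pexp_self, pexpInv_self]
  have hkd : HasDerivAt k (N * g - g * N) 0 := by
    convert! ((hasDerivAt_pexp hc norm_one_matrix_le 0 0).mul_const g).mul
      (hasDerivAt_pexpInv hc norm_one_matrix_le 0 0) using 1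
    simp [pexp_self, pexpInv_self, sub_eq_add_neg]
  have hkG : ∀ s, k s ∈ t.group ∧ f (k s) = f g := fun s => by
    have h1 := pexp_mul_pexpInv hc norm_one_matrix_le s 0
    have h2 := pexp_mem_group hc (fun _ => hN) s 0
    refine ⟨conj_mem_group hg h2 h1, ?_⟩
    rw [← hf _ h2 g hg, Matrix.inv_eq_right_inv h1]
  have hkp : HasDerivAt (fun s => Matrix.of.symm (k s)) (Matrix.of.symm (N * g - g * N)) 0 :=
    hasDerivAt_pi.2 fun i => hasDerivAt_pi.2 fun j => hasDerivAt_matrix.1 hkd i j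
  have hcomp : HasDerivAt (fun s => F (Matrix.of.symm (k s)))
      (F' (Matrix.of.symm (N * g - g * N))) 0 :=
    HasFDerivAt.comp_hasDerivAt (f := fun s => Matrix.of.symm (k s)) (0 : ℝ)
      (l' := F'.restrictScalars ℝ) (by rw [hk0]; exact hF.restrictScalars ℝ) hkp
  have hconst : (fun s => F (Matrix.of.symm (k s))) =ᶠ[𝓝 0] fun _ => f g := by
    have : Tendsto k (𝓝 0) (𝓝 g) := hk0 ▸ hkd.continuousAt.tendsto
    filter_upwards [this.eventually heq] with s hs
    rw [← hs (hkG s).1, (hkG s).2]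
  exact hcomp.unique ((hasDerivAt_const (0 : ℝ) (f g)).congr_of_eventuallyEq hconst)

end Central

/-! ### Test functions -/

section TestFunctions

open MeasureTheory Set

variable {S : Space} {f : ℝ → ℂ}

lemma Space.IsTest.contDiff (hf : S.IsTest f) : ContDiff ℝ ∞ f := by
  cases S <;> exact hf.1

lemma Space.IsTest.deriv (hf : S.IsTest f) : S.IsTest (deriv f) := by
  have h : ContDiff ℝ ∞ (_root_.deriv f) := by
    have := hf.contDiff
    exact (contDiff_infty_iff_deriv.1 this).2
  cases S
  · exact ⟨h, hf.2.deriv⟩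
  · refine ⟨h, fun x => ?_⟩
    rw [← deriv_comp_add_const]
    congr 1
    exact funext hf.2

lemma Space.IsTest.hasDerivAt (hf : S.IsTest f) (x : ℝ) : HasDerivAt f (_root_.deriv f x) x :=
  ((hf.contDiff.differentiable (by simp)) x).hasDerivAt

lemma Space.IsTest.exists_bound (hf : S.IsTest f) :
    ∃ C, 0 ≤ C ∧ ∀ x ∈ S.carrier, ‖f x‖ ≤ C := by
  have hc := hf.contDiff.continuous
  cases S
  · obtain ⟨C, hC⟩ := hf.2.exists_bound_of_continuous hc
    exact ⟨max C 0, le_max_right _ _, fun x _ => (hC x).trans (le_max_left _ _)⟩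
  · obtain ⟨C, hC⟩ := (isCompact_Icc (a := 0) (b := 2 * Real.pi)).exists_bound_of_continuousOn
      hc.continuousOn
    exact ⟨max C 0, le_max_right _ _, fun x hx => (hC x hx).trans (le_max_left _ _)⟩

lemma Space.IsTest.integrableOn_mul (hf : S.IsTest f) {g : ℝ → ℂ} (hg : Continuous g) :
    IntegrableOn (fun x => f x * g x) S.carrier := by
  have hc := hf.contDiff.continuous
  cases S
  · exact ((hc.mul hg).integrable_of_hasCompactSupport hf.2.mul_right).integrableOn
  · exact (hc.mul hg).continuousOn.integrableOn_Icc

/-- Integration by parts against a test function. -/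
lemma Space.IsTest.integral_deriv_mul (hf : S.IsTest f) {N N' : ℝ → ℂ}
    (hN : ∀ x, HasDerivAt N (N' x) x) (hN' : Continuous N')
    (hper : S = .circle → Function.Periodic N (2 * Real.pi)) :
    S.integral (fun x => _root_.deriv f x * N x) = -S.integral (fun x => f x * N' x) := by
  have hc := hf.contDiff.continuous
  have hc' := hf.deriv.contDiff.continuous
  have hNc : Continuous N := continuous_iff_continuousAt.2 fun x => (hN x).continuousAt
  cases S
  · rw [Space.integral, Space.integral, integral_mul_deriv_eq_deriv_mul_of_integrable
      (fun x _ => hf.hasDerivAt x) (fun x _ => hN x), neg_neg]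
    · exact (hc.mul hN').integrable_of_hasCompactSupport hf.2.mul_right
    · exact (hc'.mul hNc).integrable_of_hasCompactSupport hf.deriv.2.mul_right
    · exact (hc.mul hNc).integrable_of_hasCompactSupport hf.2.mul_right
  · rw [Space.integral, Space.integral, intervalIntegral.integral_mul_deriv_eq_deriv_mul
      (fun x _ => hf.hasDerivAt x) (fun x _ => hN x) (hc'.intervalIntegrable _ _)
      (hN'.intervalIntegrable _ _)]
    have h1 : f (2 * Real.pi) = f 0 := by simpa using hf.2 0
    have h2 : N (2 * Real.pi) = N 0 := by simpa using hper rfl 0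
    rw [h1, h2]
    ring

/-- The fundamental lemma of the calculus of variations. -/
lemma Space.eq_zero_of_integral_test {g : ℝ → ℂ} (hg : Continuous g)
    (hper : S = .circle → Function.Periodic g (2 * Real.pi))
    (h : ∀ f, S.IsTest f → S.integral (fun x => f x * g x) = 0) (x : ℝ) : g x = 0 := by
  cases S
  · have h0 := ae_eq_zero_of_integral_contDiff_smul_eq_zero (μ := volume)
      hg.locallyIntegrable fun f hf hfc => by
        have := h (fun x => (f x : ℂ)) ⟨Complex.ofRealCLM.contDiff.comp hf,
          hfc.comp_left Complex.ofReal_zero⟩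
        simpa [Space.integral] using this
    exact congrFun ((Continuous.ae_eq_iff_eq volume hg continuous_const).1 h0) x
  · have : Fact (0 < 2 * Real.pi) := ⟨by positivity⟩
    have hp := hper rfl
    let G : C(AddCircle (2 * Real.pi), ℂ) := ⟨hp.lift, hg.quotient_lift _⟩
    have hG : ∀ y : ℝ, G (y : AddCircle (2 * Real.pi)) = g y := fun y => rfl
    -- Exponentials are admissible test functions on the circle, so all Fourier coefficients vanish.
    have hcoef : fourierCoeff G = 0 := by
      ext n
      rw [fourierCoeff_eq_intervalIntegral G n 0, zero_add]
      have hsm : ContDiff ℝ ∞ fun y : ℝ => fourier (-n) (y : AddCircle (2 * Real.pi)) := by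
        simp only [fourier_coe_apply]
        have : ContDiff ℝ ∞ fun y : ℝ => (y : ℂ) := Complex.ofRealCLM.contDiff
        fun_prop
      have := h (fun y => fourier (-n) (y : AddCircle (2 * Real.pi)))
        ⟨hsm, fun y => by simp only [AddCircle.coe_add_period]⟩
      simp only [Space.integral] at this
      simp only [hG, smul_eq_mul, this, smul_zero, Pi.zero_apply]
    have := has_pointwise_sum_fourier_series_of_summable (f := G)
      (by rw [hcoef]; exact summable_zero) (x : AddCircle (2 * Real.pi))
    rw [hcoef, hG] at this
    simpa using this.unique (by simp)

end TestFunctions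

/-! ### Invariant polynomials of a matrix -/

section TracePoly

open scoped Matrix.Norms.Operator

variable {n : Type*} [Fintype n] [DecidableEq n]

/-- The linear form `V ↦ Tr (Γ V)`. -/
def traceCLM (Γ : Matrix n n ℂ) : Matrix n n ℂ →L[ℂ] ℂ :=
  LinearMap.toContinuousLinearMap (Matrix.traceLinearMap n ℂ ℂ ∘ₗ LinearMap.mulLeft ℂ Γ)

@[simp] lemma traceCLM_apply (Γ V : Matrix n n ℂ) : traceCLM Γ V = (Γ * V).trace := rfl

/-- `G` is a smooth function of a matrix with gradient `Γ` that commutes with its argument; both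
vanish at zero. -/
structure IsInvariantFn (G : Matrix n n ℂ → ℂ) (Γ : Matrix n n ℂ → Matrix n n ℂ) : Prop where
  hasFDerivAt : ∀ X, HasFDerivAt G (traceCLM (Γ X)) X
  contDiff : ContDiff ℂ ∞ Γ
  comm : ∀ X, Γ X * X = X * Γ X
  zero : G 0 = 0
  grad_zero : Γ 0 = 0

lemma IsInvariantFn.differentiable {G : Matrix n n ℂ → ℂ} {Γ : Matrix n n ℂ → Matrix n n ℂ}
    (h : IsInvariantFn G Γ) : Differentiable ℂ G := fun X => (h.hasFDerivAt X).differentiableAt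

lemma IsInvariantFn.contDiff_entry {G : Matrix n n ℂ → ℂ} {Γ : Matrix n n ℂ → Matrix n n ℂ}
    (h : IsInvariantFn G Γ) (i j : n) : ContDiff ℂ ∞ fun X => Γ X i j :=
  (entryCLM i j).contDiff.comp h.contDiff

/-- The derivative of G depends linearly on the gradient, which is smooth. -/
lemma IsInvariantFn.contDiff_fn {G : Matrix n n ℂ → ℂ} {Γ : Matrix n n ℂ → Matrix n n ℂ}
    (h : IsInvariantFn G Γ) : ContDiff ℂ ∞ G := by
  refine contDiff_infty_iff_fderiv.2 ⟨h.differentiable, contDiff_clm_apply_iff.2 fun V => ?_⟩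
  have hf : (fun X => fderiv ℂ G X V) = fun X => ∑ i, ∑ j, Γ X i j * V j i :=
    funext fun X => by
      rw [(h.hasFDerivAt X).fderiv]
      simp [Matrix.trace, Matrix.mul_apply]
  have hs : ContDiff ℂ ∞ fun X => ∑ i, ∑ j, Γ X i j * V j i :=
    ContDiff.sum fun i _ => ContDiff.sum fun j _ => (h.contDiff_entry i j).mul contDiff_const
  have := hf.symm ▸ hs
  exact this

lemma isInvariantFn_zero : IsInvariantFn (n := n) (fun _ => 0) (fun _ => 0) where
  hasFDerivAt X := by
    refine (hasFDerivAt_const (0 : ℂ) X).congr_fderiv (ContinuousLinearMap.ext fun V => ?_)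
    exact (show (0 : ℂ) = ((0 : Matrix n n ℂ) * V).trace by rw [zero_mul, Matrix.trace_zero])
  contDiff := contDiff_const
  comm X := by simp
  zero := rfl
  grad_zero := rfl

lemma IsInvariantFn.add {G G' : Matrix n n ℂ → ℂ} {Γ Γ' : Matrix n n ℂ → Matrix n n ℂ}
    (h : IsInvariantFn G Γ) (h' : IsInvariantFn G' Γ') :
    IsInvariantFn (fun X => G X + G' X) (fun X => Γ X + Γ' X) where
  hasFDerivAt X := by
    refine ((h.hasFDerivAt X).add (h'.hasFDerivAt X)).congr_fderiv
      (ContinuousLinearMap.ext fun V => ?_)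
    exact (show (Γ X * V).trace + (Γ' X * V).trace = ((Γ X + Γ' X) * V).trace by
      rw [add_mul, Matrix.trace_add])
  contDiff := h.contDiff.add h'.contDiff
  comm X := by rw [add_mul, mul_add, h.comm, h'.comm]
  zero := by simp [h.zero, h'.zero]
  grad_zero := by simp [h.grad_zero, h'.grad_zero]

lemma IsInvariantFn.const_mul {G : Matrix n n ℂ → ℂ} {Γ : Matrix n n ℂ → Matrix n n ℂ}
    (h : IsInvariantFn G Γ) (c : ℂ) :
    IsInvariantFn (fun X => c * G X) (fun X => c • Γ X) where
  hasFDerivAt X := by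
    refine ((h.hasFDerivAt X).const_mul c).congr_fderiv (ContinuousLinearMap.ext fun V => ?_)
    exact (show c * (Γ X * V).trace = ((c • Γ X) * V).trace by
      rw [smul_mul_assoc, Matrix.trace_smul, smul_eq_mul])
  contDiff := h.contDiff.const_smul c
  comm X := by rw [smul_mul_assoc, mul_smul_comm, h.comm]
  zero := by simp [h.zero]
  grad_zero := by simp [h.grad_zero]

lemma IsInvariantFn.mul {G G' : Matrix n n ℂ → ℂ} {Γ Γ' : Matrix n n ℂ → Matrix n n ℂ}
    (h : IsInvariantFn G Γ) (h' : IsInvariantFn G' Γ') :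
    IsInvariantFn (fun X => G X * G' X) (fun X => G X • Γ' X + G' X • Γ X) where
  hasFDerivAt X := by
    refine ((h.hasFDerivAt X).mul (h'.hasFDerivAt X)).congr_fderiv
      (ContinuousLinearMap.ext fun V => ?_)
    exact (show G X * (Γ' X * V).trace + G' X * (Γ X * V).trace =
        ((G X • Γ' X + G' X • Γ X) * V).trace by
      simp only [add_mul, smul_mul_assoc, Matrix.trace_add, Matrix.trace_smul, smul_eq_mul])
  contDiff := (h.contDiff_fn.smul h'.contDiff).add (h'.contDiff_fn.smul h.contDiff)
  comm X := by
    simp only [add_mul, mul_add, smul_mul_assoc, mul_smul_comm, h.comm, h'.comm]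
  zero := by simp [h.zero, h'.zero]
  grad_zero := by simp [h.zero, h'.zero]

lemma exists_isInvariantFn_sum {ι : Type*} (s : Finset ι) {G : ι → Matrix n n ℂ → ℂ}
    (h : ∀ i ∈ s, ∃ Γ, IsInvariantFn (G i) Γ) :
    ∃ Γ, IsInvariantFn (fun X => ∑ i ∈ s, G i X) Γ := by
  classical
  induction s using Finset.induction_on with
  | empty => exact ⟨_, by simpa using isInvariantFn_zero⟩
  | insert a s ha ih =>
    obtain ⟨Γ, hΓ⟩ := h a (Finset.mem_insert_self _ _)
    obtain ⟨Γ', hΓ'⟩ := ih fun i hi => h i (Finset.mem_insert_of_mem hi)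
    simp only [Finset.sum_insert ha]
    exact ⟨_, hΓ.add hΓ'⟩

lemma isInvariantFn_trace_pow {k : ℕ} (hk : 2 ≤ k) :
    IsInvariantFn (n := n) (fun X => (X ^ k).trace) (fun X => (k : ℂ) • X ^ (k - 1)) where
  hasFDerivAt X := by
    have h := (LinearMap.toContinuousLinearMap (Matrix.traceLinearMap n ℂ ℂ)).hasFDerivAt.comp X
      ((hasFDerivAt_id (𝕜 := ℂ) X).pow' k)
    refine h.congr_fderiv (ContinuousLinearMap.ext fun V => ?_)
    -- Cyclicity of the trace makes the k terms of the noncommutative Leibniz rule equal.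
    have h2 : ∀ i ∈ Finset.range k, (X ^ (k - 1 - i) * (V * X ^ i)).trace =
        (X ^ (k - 1) * V).trace := fun i hi => by
      rw [← mul_assoc, Matrix.trace_mul_comm, ← mul_assoc, ← pow_add]
      congr 3
      have := Finset.mem_range.1 hi
      omega
    refine Eq.trans (b := ((∑ i ∈ Finset.range k, X ^ (k - 1 - i) * (V * X ^ i)) :
      Matrix n n ℂ).trace) ?_ ?_
    · change Matrix.trace ((∑ i ∈ Finset.range k, MulOpposite.op (X ^ i) • X ^ (k.pred - i) •
        ContinuousLinearMap.id ℂ (Matrix n n ℂ)) V) = _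
      rw [sum_apply]
      congr 1
      refine Finset.sum_congr rfl fun i _ => ?_
      rw [← mul_assoc]
      rfl
    · rw [Matrix.trace_sum, Finset.sum_congr rfl h2]
      change _ = (((k : ℂ) • X ^ (k - 1)) * V).trace
      simp
  contDiff := (contDiff_id.pow _).const_smul _
  comm X := by
    rw [smul_mul_assoc, mul_smul_comm, ← pow_succ, ← pow_succ']
  zero := by rw [zero_pow (by omega), Matrix.trace_zero]
  grad_zero := by rw [zero_pow (by omega), smul_zero]

/-- Exponents start at one: the zeroth power has a nonzero constant coefficient, which would violate
the vanishing at the zero matrix. -/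
lemma exists_isInvariantFn_coeff_pow (p : Matrix n n ℂ → PowerSeries ℂ)
    (hp : ∀ k, ∃ Γ, IsInvariantFn (fun X => PowerSeries.coeff k (p X)) Γ) (j k : ℕ) :
    ∃ Γ, IsInvariantFn (fun X => PowerSeries.coeff k (p X ^ (j + 1))) Γ := by
  induction j generalizing k with
  | zero => simpa using hp k
  | succ j ih =>
    simp only [pow_succ _ (j + 1), PowerSeries.coeff_mul]
    refine exists_isInvariantFn_sum _ fun a _ => ?_
    obtain ⟨Γ, hΓ⟩ := ih a.1
    obtain ⟨Γ', hΓ'⟩ := hp a.2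
    exact ⟨_, hΓ.mul hΓ'⟩

lemma exists_isInvariantFn_expCoeff (d : ℕ) {m : ℕ} (hm : 2 ≤ m) :
    ∃ Γ, IsInvariantFn (n := n) (fun X => expCoeff d m fun k => (X ^ k).trace) Γ := by
  refine exists_isInvariantFn_sum _ fun j _ => ?_
  rcases j with _ | j
  -- The zeroth power is the constant series 1, which has no coefficient in degree m ≥ 2.
  · have : PowerSeries.coeff m (1 : PowerSeries ℂ) = 0 := by
      rw [PowerSeries.coeff_one, if_neg (by omega)]
    simp only [pow_zero, this, mul_zero]
    exact ⟨_, isInvariantFn_zero⟩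
  · obtain ⟨Γ, hΓ⟩ := exists_isInvariantFn_coeff_pow (n := n)
      (fun X => PowerSeries.mk fun k => if 2 ≤ k then
        -(((m : ℂ) - 1) / d) * ((X ^ k).trace / k) else 0) (fun k => by
          simp only [PowerSeries.coeff_mk]
          split_ifs with hk
          · have := (isInvariantFn_trace_pow (n := n) hk).const_mul
              (-(((m : ℂ) - 1) / d) * (k : ℂ)⁻¹)
            have h2 : (fun X : Matrix n n ℂ => -(((m : ℂ) - 1) / d) * ((X ^ k).trace / k)) =
                fun X => -(((m : ℂ) - 1) / d) * (k : ℂ)⁻¹ * (X ^ k).trace := by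
              ext X
              ring
            exact ⟨_, h2 ▸ this⟩
          · exact ⟨_, isInvariantFn_zero⟩) j m
    exact ⟨_, hΓ.const_mul _⟩

end TracePoly

/-! ### The densities as invariant functions of the rescaled Lax matrix -/

namespace Model

variable {t : ClassicalType} {S : Space} {M : Type*} [DiffeologicalSpace M]
  {P : PoissonStructure M}

/-- This form of the density is all that the bracket computation uses, so the classical types and
the cyclotomic exceptions need no separate treatment afterwards. -/
lemma exists_W_eq (𝓜 : Model t S P) (z₀ : ℂ) {n : ℕ} (hn : 2 ≤ n) :
    ∃ G Γ, IsInvariantFn G Γ ∧ ∀ z x m, 𝓜.W z₀ n z x m = G (𝓜.scaledLax z x m) := by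
  have htr : ∃ G Γ, IsInvariantFn G Γ ∧ ∀ z x m, 𝓜.tracePow n z x m = G (𝓜.scaledLax z x m) :=
    ⟨_, _, isInvariantFn_trace_pow hn, fun _ _ _ => rfl⟩
  cases t with
  | A d =>
    by_cases h : 𝓜.IsCyclotomic z₀ ∧ 𝓜.IsInner
    · simpa [W, h] using htr
    · obtain ⟨Γ, hΓ⟩ := exists_isInvariantFn_expCoeff (n := ClassicalType.Idx (.A d)) d hn
      refine ⟨_, _, hΓ, fun z x m => ?_⟩
      simp only [W, h, if_false]
      rfl
  | BD d => exact htr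
  | C d => exact htr

end Model

/-! ### Differentiability of matrix-valued functions -/

section MatrixCalculus

open scoped Matrix.Norms.Operator

variable {n : Type*} [Fintype n] [DecidableEq n]

lemma eq_sum_smul_single {E : Type*} (A : E → Matrix n n ℂ) :
    A = fun x => ∑ i, ∑ j, A x i j • Matrix.single i j (1 : ℂ) := by
  ext1 x
  simp only [Matrix.smul_single, smul_eq_mul, mul_one]
  exact Matrix.matrix_eq_sum_single _

variable {𝕜 : Type*} [NontriviallyNormedField 𝕜]
  [NormedAlgebra 𝕜 ℂ] {E : Type*} [NormedAddCommGroup E] [NormedSpace 𝕜 E]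

lemma differentiableAt_matrix {A : E → Matrix n n ℂ} {x : E}
    (h : ∀ i j, DifferentiableAt 𝕜 (fun x => A x i j) x) : DifferentiableAt 𝕜 A x := by
  rw [eq_sum_smul_single A]
  exact DifferentiableAt.fun_sum fun i _ => DifferentiableAt.fun_sum fun j _ =>
    (h i j).smul_const _

end MatrixCalculus

/-! ### The twist function near a zero -/

namespace TwistData

variable {t : ClassicalType} (τ : TwistData t)

/-- The order of the Taylor coefficient that defines the current of degree `n`. -/
def order (z₀ : ℂ) (n : ℕ) : ℕ :=
  open Classical in if τ.IsCyclotomic z₀ then τ.rem n else 0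

lemma φval_eq (z : ℂ) : τ.φval z = τ.φ.num.eval z / τ.φ.denom.eval z := by
  simp [φval, RatFunc.eval, Polynomial.eval₂_id]

lemma φval_ne_zero {z : ℂ} (hz : τ.IsGeneric z) : τ.φval z ≠ 0 := by
  rw [φval_eq]
  exact div_ne_zero hz.1 hz.2

lemma denom_ne_zero {z₀ : ℂ} (h0 : τ.φ.num.eval z₀ = 0) : τ.φ.denom.eval z₀ ≠ 0 := fun h => by
  obtain ⟨a, b, hab⟩ := τ.φ.isCoprime_num_denom
  have := congrArg (Polynomial.eval z₀) hab
  simp [h0, h] at this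

lemma rem_lt (n : ℕ) : τ.rem n < τ.T := by
  have hT := τ.T_pos
  have key : ∀ a : ℤ, (a % (τ.T : ℤ)).toNat < τ.T := fun a => by
    have h1 := Int.emod_lt_of_pos a (b := (τ.T : ℤ)) (by omega)
    have h2 := Int.emod_nonneg a (b := (τ.T : ℤ)) (by omega)
    omega
  unfold rem
  split_ifs
  · exact key _
  · exact key _

/-- Factorization of the twist function at a zero. -/
lemma exists_factor {z₀ : ℂ} (h0 : τ.φ.num.eval z₀ = 0) :
    ∃ (a : ℕ) (q : Polynomial ℂ), 1 ≤ a ∧ q.eval z₀ ≠ 0 ∧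
      (∀ w, τ.φ.num.eval w = (w - z₀) ^ a * q.eval w) ∧ (τ.IsCyclotomic z₀ → τ.T ≤ a + 1) := by
  have hnum : τ.φ.num ≠ 0 := RatFunc.num_ne_zero τ.φ_ne
  obtain ⟨q, hq, hq0⟩ := Polynomial.exists_eq_pow_rootMultiplicity_mul_and_not_dvd _ hnum z₀
  set a := τ.φ.num.rootMultiplicity z₀ with ha
  have hqe : q.eval z₀ ≠ 0 := fun h => hq0 (Polynomial.dvd_iff_isRoot.2 h)
  have hfac : ∀ w, τ.φ.num.eval w = (w - z₀) ^ a * q.eval w := fun w => by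
    conv_lhs => rw [hq]
    simp
  refine ⟨a, q, (Polynomial.rootMultiplicity_pos hnum).2 h0, hqe, hfac, ?_⟩
  rintro ⟨rfl, hT⟩
  have hd0 := τ.denom_ne_zero h0
  have hω : τ.root ≠ 0 := τ.root_prim.ne_zero (by omega)
  let u : ℂ → ℂ := fun w => q.eval w / τ.φ.denom.eval w
  have hu : ContinuousAt u 0 := q.continuousAt.div τ.φ.denom.continuousAt hd0
  have hu' : ContinuousAt (fun w => u (τ.root * w)) 0 := by
    refine ContinuousAt.comp (f := fun w => τ.root * w) (g := u) ?_ (by fun_prop)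
    simpa using hu
  have hφ : ∀ w, τ.φval w = w ^ a * u w := fun w => by
    rw [φval_eq, hfac, sub_zero, mul_div_assoc]
  -- Equivariance of φ with the factor w^a cancelled. As w tends to 0, where u does not vanish, it
  -- yields ω^(a+1) = 1, hence T divides a + 1.
  have heq : ∀ w ≠ 0, τ.root ^ a * u (τ.root * w) = τ.root⁻¹ * u w := fun w hw => by
    have h1 : τ.φval (τ.root * w) = τ.root⁻¹ * τ.φval w := τ.φ_equivariant w
    rw [hφ, hφ, mul_pow] at h1
    have : w ^ a ≠ 0 := pow_ne_zero _ hw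
    apply mul_left_cancel₀ this
    linear_combination h1
  have hlim : τ.root ^ a * u (τ.root * 0) = τ.root⁻¹ * u 0 :=
    tendsto_nhds_unique (f := fun w => τ.root ^ a * u (τ.root * w)) (l := 𝓝[≠] (0 : ℂ))
      ((hu'.const_mul _).tendsto.mono_left nhdsWithin_le_nhds)
      (((hu.const_mul _).tendsto.mono_left nhdsWithin_le_nhds).congr'
        (eventually_mem_nhdsWithin.mono fun w hw => (heq w hw).symm))
  rw [mul_zero] at hlim
  have h1 : τ.root ^ a = τ.root⁻¹ := mul_right_cancel₀ (div_ne_zero hqe hd0) hlim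
  have h2 : τ.root ^ (a + 1) = 1 := by rw [pow_succ, h1, inv_mul_cancel₀ hω]
  exact Nat.le_of_dvd (by omega) ((τ.root_prim.pow_eq_one_iff_dvd _).1 h2)

end TwistData

/-! ### Contour formula for the currents near a regular zero -/

namespace Model

open Metric

variable {t : ClassicalType} {S : Space} {M : Type*} [DiffeologicalSpace M]
  {P : PoissonStructure M} (𝓜 : Model t S P)

/-- A disc around a zero of order `> r` of the twist function on which the model is regular. -/
structure IsDisc (z₀ : ℂ) (r : ℕ) (R : ℝ) (ψ : ℂ → ℂ) : Prop where
  pos : 0 < R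
  mem : ∀ w ∈ ball z₀ R, w ≠ z₀ → w ∈ 𝓜.D
  generic : ∀ w ∈ ball z₀ R, w ≠ z₀ → 𝓜.IsGeneric w
  denom : ∀ w ∈ ball z₀ R, 𝓜.φ.denom.eval w ≠ 0
  differentiableOn : DifferentiableOn ℂ ψ (ball z₀ R)
  factor : ∀ w ∈ ball z₀ R, 𝓜.φval w = (w - z₀) ^ (r + 1) * ψ w

variable {𝓜} {z₀ : ℂ}

/-- The order a of the zero exceeds r. In the cyclotomic case r ≤ T − 2 by the condition on n, while
T ≤ a + 1; otherwise r = 0 and a ≥ 1. The predicate `p` will express that the disc avoids the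
singularities of the R-matrix. -/
lemma exists_isDisc (h : 𝓜.IsRegularZero z₀) {n : ℕ}
    (hn : 𝓜.IsCyclotomic z₀ → 𝓜.rem n ≠ 𝓜.T - 1) {p : ℂ → Prop} (hp : ∀ᶠ w in 𝓝 z₀, p w) :
    ∃ R ψ, 𝓜.IsDisc z₀ (𝓜.order z₀ n) R ψ ∧ ∀ w ∈ ball z₀ R, p w := by
  obtain ⟨a, q, ha, hq, hfac, hcyc⟩ := 𝓜.exists_factor h.1
  have hr : 𝓜.order z₀ n + 1 ≤ a := by
    unfold TwistData.order
    split_ifs with hc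
    · have := hcyc hc
      have := hn hc
      have := 𝓜.rem_lt n
      omega
    · omega
  have hd := 𝓜.denom_ne_zero h.1
  have e1 : ∀ᶠ w in 𝓝 z₀, 𝓜.φ.denom.eval w ≠ 0 := 𝓜.φ.denom.continuousAt.eventually_ne hd
  have e2 : ∀ᶠ w in 𝓝 z₀, q.eval w ≠ 0 := q.continuousAt.eventually_ne hq
  have e3 : ∀ᶠ w in 𝓝 z₀, w ≠ z₀ → w ∈ 𝓜.D := eventually_nhdsWithin_iff.1 h.2.1
  obtain ⟨R, hR, hball⟩ := eventually_nhds_iff_ball.1 (e1.and (e2.and (e3.and hp)))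
  -- ψ is φ with r + 1 of its a factors w − z₀ removed.
  refine ⟨R, fun w => (w - z₀) ^ (a - (𝓜.order z₀ n + 1)) * q.eval w / 𝓜.φ.denom.eval w,
    ⟨hR, fun w hw => (hball w hw).2.2.1, fun w hw hne => ⟨?_, (hball w hw).1⟩,
      fun w hw => (hball w hw).1, fun w hw => ?_, fun w hw => ?_⟩, fun w hw => (hball w hw).2.2.2⟩
  · rw [hfac]
    exact mul_ne_zero (pow_ne_zero _ (sub_ne_zero.2 hne)) (hball w hw).2.1
  · exact ((((differentiableAt_id.sub_const z₀).pow _).mul q.differentiableAt).div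
      𝓜.φ.denom.differentiableAt (hball w hw).1).differentiableWithinAt
  · rw [TwistData.φval_eq, hfac, mul_div_assoc', ← mul_assoc, ← pow_add, Nat.add_sub_cancel' hr]

lemma differentiableAt_lax {z : ℂ} (hz : z ∈ 𝓜.D) (x : ℝ) (m : M) (i j : t.Idx) :
    DifferentiableAt ℂ (fun z => (𝓜.lax z x m : t.Mat) i j) z :=
  (𝓜.lax_holomorphic x m i j).differentiableAt (𝓜.D_open.mem_nhds hz)

lemma differentiableAt_φval {z : ℂ} (hz : 𝓜.φ.denom.eval z ≠ 0) :
    DifferentiableAt ℂ 𝓜.φval z := by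
  have : 𝓜.φval = fun z => 𝓜.φ.num.eval z / 𝓜.φ.denom.eval z := funext 𝓜.φval_eq
  rw [this]
  exact 𝓜.φ.num.differentiableAt.div 𝓜.φ.denom.differentiableAt hz

lemma scaledLax_eq {z : ℂ} (hz : z ∈ 𝓜.D) (hd : 𝓜.φ.denom.eval z ≠ 0) (x : ℝ) (m : M) :
    𝓜.scaledLax z x m = 𝓜.φval z • (𝓜.lax z x m : t.Mat) := by
  ext i j
  have h := ((differentiableAt_φval hd).mul (differentiableAt_lax hz x m i j)).continuousAt
  exact (h.tendsto.mono_left nhdsWithin_le_nhds).limUnder_eq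

lemma IsDisc.scaledLax_eq {r : ℕ} {R : ℝ} {ψ : ℂ → ℂ} (hD : 𝓜.IsDisc z₀ r R ψ) {w : ℂ}
    (hw : w ∈ ball z₀ R) (hne : w ≠ z₀) (x : ℝ) (m : M) :
    𝓜.scaledLax w x m = 𝓜.φval w • (𝓜.lax w x m : t.Mat) :=
  Model.scaledLax_eq (hD.mem w hw hne) (hD.denom w hw) x m

/-- At the centre, the punctured limit coincides with the analytic extension that regularity of the
zero provides; elsewhere it is the value of the product. -/
lemma IsDisc.differentiableAt_scaledLax {r : ℕ} {R : ℝ} {ψ : ℂ → ℂ} (hD : 𝓜.IsDisc z₀ r R ψ)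
    (h : 𝓜.IsRegularZero z₀) {w : ℂ} (hw : w ∈ ball z₀ R) (x : ℝ) (m : M) (i j : t.Idx) :
    DifferentiableAt ℂ (fun w => 𝓜.scaledLax w x m i j) w := by
  by_cases hne : w = z₀
  · subst hne
    obtain ⟨s, hs, heq⟩ := h.2.2 x m i j
    have hlim : Tendsto (fun z => 𝓜.φval z * (𝓜.lax z x m : t.Mat) i j) (𝓝[≠] w) (𝓝 (s w)) :=
      (hs.continuousAt.tendsto.mono_left nhdsWithin_le_nhds).congr' heq
    have h0 : 𝓜.scaledLax w x m i j = s w := hlim.limUnder_eq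
    refine hs.differentiableAt.congr_of_eventuallyEq ?_
    have e1 : ∀ᶠ z in 𝓝 w, z ∈ ball w R := isOpen_ball.mem_nhds hw
    filter_upwards [e1, eventually_nhdsWithin_iff.1 heq] with z hz hzs
    by_cases hzw : z = w
    · rw [hzw, h0]
    · rw [hzs hzw, hD.scaledLax_eq hz hzw]
      rfl
  · refine ((differentiableAt_φval (hD.denom w hw)).mul
      (differentiableAt_lax (hD.mem w hw hne) x m i j)).congr_of_eventuallyEq ?_
    filter_upwards [isOpen_ball.mem_nhds hw, isOpen_ne.mem_nhds hne] with z hz hz'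
    rw [hD.scaledLax_eq hz hz']
    rfl

/-- The integration kernel that extracts the Taylor coefficient of order `r` from the values on a
circle of radius `ρ`. -/
def kernel (r : ℕ) (ρ θ : ℝ) : ℂ :=
  (2 * Real.pi * Complex.I)⁻¹ * (circleMap 0 ρ θ * Complex.I * ((circleMap 0 ρ θ) ^ (r + 1))⁻¹)

lemma continuous_kernel (r : ℕ) {ρ : ℝ} (hρ : 0 < ρ) : Continuous (kernel r ρ) := by
  have h := continuous_circleMap 0 ρ
  have h2 : ∀ θ, (circleMap 0 ρ θ) ^ (r + 1) ≠ 0 :=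
    fun θ => pow_ne_zero _ (circleMap_ne_center hρ.ne')
  unfold kernel
  fun_prop (disch := assumption)

/-- Cauchy integrals are written over a real interval in order to differentiate them with respect to
real parameters. -/
lemma integral_kernel_mul {r : ℕ} {ρ : ℝ} (h : ℂ → ℂ) :
    ∫ θ in (0 : ℝ)..2 * Real.pi, kernel r ρ θ * h (circleMap z₀ ρ θ) =
      (2 * Real.pi * Complex.I)⁻¹ * ∮ w in C(z₀, ρ), (1 / (w - z₀) ^ (r + 1)) • h w := by
  rw [circleIntegral, ← intervalIntegral.integral_const_mul]
  congr 1
  ext θ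
  simp only [kernel, deriv_circleMap, circleMap_sub_center, smul_eq_mul, one_div]
  ring

lemma IsDisc.circleMap_mem {r : ℕ} {R : ℝ} {ψ : ℂ → ℂ} (hD : 𝓜.IsDisc z₀ r R ψ) (θ : ℝ) :
    circleMap z₀ (R / 2) θ ∈ ball z₀ R ∧ circleMap z₀ (R / 2) θ ≠ z₀ := by
  have := hD.pos
  refine ⟨?_, circleMap_ne_center (by positivity)⟩
  rw [mem_ball, dist_eq_norm, circleMap_sub_center, norm_circleMap_zero, abs_of_pos (by positivity)]
  linarith

/-- Contour integrals of `φ` times a holomorphic function against the kernel vanish. -/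
lemma IsDisc.integral_kernel_φval {r : ℕ} {R : ℝ} {ψ : ℂ → ℂ} (hD : 𝓜.IsDisc z₀ r R ψ)
    {h : ℂ → ℂ} (hh : DifferentiableOn ℂ h (ball z₀ R)) :
    ∫ θ in (0 : ℝ)..2 * Real.pi, kernel r (R / 2) θ *
      (𝓜.φval (circleMap z₀ (R / 2) θ) * h (circleMap z₀ (R / 2) θ)) = 0 := by
  have hR := hD.pos
  rw [integral_kernel_mul (fun w => 𝓜.φval w * h w)]
  have hsub : closedBall z₀ (R / 2) ⊆ ball z₀ R := closedBall_subset_ball (by linarith)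
  -- The zero of φ cancels the pole of the kernel, leaving a holomorphic integrand.
  have h2 : ∮ w in C(z₀, R / 2), (1 / (w - z₀) ^ (r + 1)) • (𝓜.φval w * h w) =
      ∮ w in C(z₀, R / 2), ψ w * h w := by
    refine circleIntegral.integral_congr (by positivity) fun w hw => ?_
    have hne : w - z₀ ≠ 0 := sub_ne_zero.2 (ne_of_mem_sphere hw (by positivity))
    simp only [smul_eq_mul]
    rw [hD.factor w (hsub (sphere_subset_closedBall hw))]
    field_simp
  rw [h2, Complex.circleIntegral_eq_zero_of_differentiable_on_off_countable (by positivity)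
    Set.countable_empty, mul_zero]
  · exact ((hD.differentiableOn.mul hh).continuousOn).mono hsub
  · exact fun w hw => (hD.differentiableOn.mul hh).differentiableAt
      (isOpen_ball.mem_nhds (hsub (ball_subset_closedBall hw.1)))

open scoped Matrix.Norms.Operator in
/-- The current as a contour integral. -/
lemma IsDisc.current_eq {n : ℕ} {R : ℝ} {ψ : ℂ → ℂ} (hD : 𝓜.IsDisc z₀ (𝓜.order z₀ n) R ψ)
    (h : 𝓜.IsRegularZero z₀) {G : t.Mat → ℂ} {Γ : t.Mat → t.Mat} (hG : IsInvariantFn G Γ)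
    (hW : ∀ z x m, 𝓜.W z₀ n z x m = G (𝓜.scaledLax z x m)) (x : ℝ) (m : M) :
    𝓜.current z₀ n x m = ∫ θ in (0 : ℝ)..2 * Real.pi, kernel (𝓜.order z₀ n) (R / 2) θ *
      G (𝓜.φval (circleMap z₀ (R / 2) θ) • (𝓜.lax (circleMap z₀ (R / 2) θ) x m : t.Mat)) := by
  have hR := hD.pos
  have hdiff : DifferentiableOn ℂ (fun w => G (𝓜.scaledLax w x m)) (closedBall z₀ (R / 2)) :=
    fun w hw => ((hG.differentiable _).comp w (differentiableAt_matrix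
      (hD.differentiableAt_scaledLax h (closedBall_subset_ball (by linarith) hw) x m)
      )).differentiableWithinAt
  have h1 : ∀ θ, G (𝓜.φval (circleMap z₀ (R / 2) θ) •
      (𝓜.lax (circleMap z₀ (R / 2) θ) x m : t.Mat)) =
      (fun w => G (𝓜.scaledLax w x m)) (circleMap z₀ (R / 2) θ) := fun θ => by
    obtain ⟨h1, h2⟩ := hD.circleMap_mem θ
    simp only
    rw [hD.scaledLax_eq h1 h2]
  simp only [h1]
  rw [integral_kernel_mul (fun w => G (𝓜.scaledLax w x m)),
    hdiff.circleIntegral_one_div_sub_center_pow_smul (by positivity), smul_eq_mul]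
  have hpi : (2 * Real.pi * Complex.I : ℂ) ≠ 0 := Complex.two_pi_I_ne_zero
  have h3 : 𝓜.current z₀ n x m =
      iteratedDeriv (𝓜.order z₀ n) (fun w => G (𝓜.scaledLax w x m)) z₀ /
        ((𝓜.order z₀ n).factorial : ℂ) := by
    unfold current TwistData.order
    split_ifs with hc
    · simp only [hW]
      rw [hc.1]
    · simp [hW]
  rw [h3]
  field_simp

end Model

/-! ### Integrals over a circle in the spectral plane -/

section Contour

open MeasureTheory Set

variable {E : Type*} [NormedAddCommGroup E]

lemma hasDerivAt_intervalIntegral_param {F F' : ℝ → ℝ → ℂ} (a b : ℝ)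
    (hF : ∀ s, Continuous fun θ => F θ s) (hF' : Continuous fun p : ℝ × ℝ => F' p.1 p.2)
    (hd : ∀ θ s, HasDerivAt (F θ) (F' θ s) s) (s₀ : ℝ) :
    HasDerivAt (fun s => ∫ θ in a..b, F θ s) (∫ θ in a..b, F' θ s₀) s₀ := by
  obtain ⟨C, hC⟩ := (isCompact_uIcc (a := a) (b := b)).prod
    (isCompact_Icc (a := s₀ - 1) (b := s₀ + 1)) |>.exists_bound_of_continuousOn hF'.continuousOn
  refine (intervalIntegral.hasDerivAt_integral_of_dominated_loc_of_deriv_le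
    (F := fun s θ => F θ s) (F' := fun s θ => F' θ s) (bound := fun _ => C)
    (Icc_mem_nhds (by linarith) (by linarith) : Icc (s₀ - 1) (s₀ + 1) ∈ 𝓝 s₀)
    (.of_forall fun s => (hF s).aestronglyMeasurable) ((hF s₀).intervalIntegrable _ _)
    (Continuous.aestronglyMeasurable (by fun_prop)) ?_ (by simp) ?_).2
  · exact .of_forall fun θ hθ s hs => hC (θ, s) ⟨uIoc_subset_uIcc hθ, hs⟩
  · exact .of_forall fun θ _ s _ => hd θ s

variable {H : E → ℂ} {κ : ℝ → ℂ}

lemma continuous_contour {X : Type*} [TopologicalSpace X] (hH : Continuous H) (hκ : Continuous κ)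
    {ℓ : ℝ → X → E} (hℓ : Continuous fun p : ℝ × X => ℓ p.1 p.2) (a b : ℝ) :
    Continuous fun x => ∫ θ in a..b, κ θ * H (ℓ θ x) :=
  intervalIntegral.continuous_parametric_intervalIntegral_of_continuous'
    (f := fun x θ => κ θ * H (ℓ θ x))
    ((hκ.comp continuous_snd).mul (hH.comp (hℓ.comp continuous_swap))) a b

variable [NormedSpace ℂ E]

/-- Because H vanishes at 0, a bound on its derivative gives a linear bound on H; decay at infinity
thus passes from the fields to functions of them. -/
lemma exists_bound_fderiv [FiniteDimensional ℂ E] (hH : ContDiff ℂ ∞ H) (hH0 : H 0 = 0) (R : ℝ) :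
    ∃ C, 0 ≤ C ∧ ∀ X, ‖X‖ ≤ R → ‖fderiv ℂ H X‖ ≤ C ∧ ‖H X‖ ≤ C * ‖X‖ := by
  have := FiniteDimensional.proper ℂ E
  obtain ⟨C, hC⟩ := (isCompact_closedBall (0 : E) R).exists_bound_of_continuousOn
    (hH.continuous_fderiv (by simp)).continuousOn
  refine ⟨max C 0, le_max_right _ _, fun X hX => ?_⟩
  have hX' : X ∈ Metric.closedBall (0 : E) R := by simpa using hX
  refine ⟨(hC X hX').trans (le_max_left _ _), ?_⟩
  have := (convex_closedBall (0 : E) R).norm_image_sub_le_of_norm_fderiv_le (𝕜 := ℂ) (f := H)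
    (fun x _ => hH.differentiable (by simp) x) (fun x hx => (hC x hx).trans (le_max_left C 0))
    (Metric.mem_closedBall_self ((norm_nonneg X).trans hX)) hX'
  simpa [hH0] using this

lemma hasDerivAt_contour (hH : ContDiff ℂ ∞ H) (hκ : Continuous κ) {ℓ ℓ' : ℝ → ℝ → E}
    (hℓ : Continuous fun p : ℝ × ℝ => ℓ p.1 p.2) (hℓ' : Continuous fun p : ℝ × ℝ => ℓ' p.1 p.2)
    (hd : ∀ θ s, HasDerivAt (ℓ θ) (ℓ' θ s) s) (a b s : ℝ) :
    HasDerivAt (fun s => ∫ θ in a..b, κ θ * H (ℓ θ s))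
      (∫ θ in a..b, κ θ * fderiv ℂ H (ℓ θ s) (ℓ' θ s)) s := by
  have hHc := hH.continuous
  have hHc' := hH.continuous_fderiv (by simp)
  refine hasDerivAt_intervalIntegral_param (F := fun θ s => κ θ * H (ℓ θ s))
    (F' := fun θ s => κ θ * fderiv ℂ H (ℓ θ s) (ℓ' θ s)) a b (fun s => ?_) ?_ (fun θ s => ?_) s
  · have : Continuous fun θ => ℓ θ s := hℓ.comp (continuous_id.prodMk continuous_const)
    fun_prop
  · exact (hκ.comp continuous_fst).mul ((hHc'.comp hℓ).clm_apply hℓ')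
  · exact (((hH.differentiable (by simp) _).hasFDerivAt.restrictScalars ℝ).comp_hasDerivAt s
      (hd θ s)).const_mul (κ θ)

lemma continuous_contour_fderiv {X : Type*} [TopologicalSpace X] (hH : ContDiff ℂ ∞ H)
    (hκ : Continuous κ) {ℓ ℓ' : ℝ → X → E} (hℓ : Continuous fun p : ℝ × X => ℓ p.1 p.2)
    (hℓ' : Continuous fun p : ℝ × X => ℓ' p.1 p.2) (a b : ℝ) :
    Continuous fun x => ∫ θ in a..b, κ θ * fderiv ℂ H (ℓ θ x) (ℓ' θ x) :=
  intervalIntegral.continuous_parametric_intervalIntegral_of_continuous'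
    (f := fun x θ => κ θ * fderiv ℂ H (ℓ θ x) (ℓ' θ x))
    ((hκ.comp continuous_snd).mul ((((hH.continuous_fderiv (by simp)).comp hℓ).clm_apply hℓ').comp
      continuous_swap)) a b

variable [FiniteDimensional ℂ E]

/-- Decay of contour integrals of decreasing fields. -/
lemma exists_bound_contour (hH : ContDiff ℂ ∞ H) (hH0 : H 0 = 0) (hκ : Continuous κ) {c : ℝ}
    (hc : 0 ≤ c) {a b : ℝ} (hab : a ≤ b) :
    ∃ C, 0 ≤ C ∧ ∀ (x : ℝ) (ℓ ℓ' : ℝ → E), (∀ θ ∈ Icc a b, ‖ℓ θ‖ ≤ c / (1 + x ^ 2)) →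
      (∀ θ ∈ Icc a b, ‖ℓ' θ‖ ≤ c / (1 + x ^ 2)) →
      ‖∫ θ in a..b, κ θ * H (ℓ θ)‖ ≤ C / (1 + x ^ 2) ∧
      ‖∫ θ in a..b, κ θ * fderiv ℂ H (ℓ θ) (ℓ' θ)‖ ≤ C / (1 + x ^ 2) := by
  obtain ⟨A, hA⟩ := (isCompact_Icc (a := a) (b := b)).exists_bound_of_continuousOn hκ.continuousOn
  have hA0 : 0 ≤ A := (norm_nonneg _).trans (hA a ⟨le_rfl, hab⟩)
  obtain ⟨C, hC0, hC⟩ := exists_bound_fderiv hH hH0 c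
  have hab' : 0 ≤ b - a := sub_nonneg.2 hab
  refine ⟨A * (C * c) * (b - a), by positivity, fun x ℓ ℓ' h h' => ?_⟩
  have hx : c / (1 + x ^ 2) ≤ c := div_le_self hc (by nlinarith [sq_nonneg x])
  have key : A * (C * c) * (b - a) / (1 + x ^ 2) = A * (C * (c / (1 + x ^ 2))) * |b - a| := by
    rw [abs_of_nonneg hab']; ring
  rw [key]
  constructor
  · refine intervalIntegral.norm_integral_le_of_norm_le_const fun θ hθ => ?_
    rw [uIoc_of_le hab] at hθ
    have hθ' := Ioc_subset_Icc_self hθ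
    rw [norm_mul]
    exact mul_le_mul (hA θ hθ') ((hC _ ((h θ hθ').trans hx)).2.trans
      (mul_le_mul_of_nonneg_left (h θ hθ') hC0)) (norm_nonneg _) hA0
  · refine intervalIntegral.norm_integral_le_of_norm_le_const fun θ hθ => ?_
    rw [uIoc_of_le hab] at hθ
    have hθ' := Ioc_subset_Icc_self hθ
    rw [norm_mul]
    exact mul_le_mul (hA θ hθ') ((ContinuousLinearMap.le_opNorm _ _).trans
      (mul_le_mul (hC _ ((h θ hθ').trans hx)).1 (h' θ hθ') (norm_nonneg _) hC0))
      (norm_nonneg _) hA0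

/-- Differentiation under the integral sign in space. -/
lemma Space.hasDerivAt_integral {S : Space} {F F' : ℝ → ℝ → ℂ} (hF : ∀ s, Continuous fun x => F x s)
    (hF' : Continuous fun x => F' x 0) {c : ℝ}
    (hb : ∀ x ∈ S.carrier, ‖F x 0‖ ≤ c / (1 + x ^ 2))
    (hb' : ∀ x ∈ S.carrier, ∀ s ∈ Icc (-1 : ℝ) 1, ‖F' x s‖ ≤ c / (1 + x ^ 2))
    (hd : ∀ x s, HasDerivAt (F x) (F' x s) s) :
    HasDerivAt (fun s => S.integral fun x => F x s) (S.integral fun x => F' x 0) 0 := by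
  simp only [S.integral_eq]
  refine (hasDerivAt_integral_of_dominated_loc_of_deriv_le (μ := volume.restrict S.carrier)
    (F := fun s x => F x s) (F' := fun s x => F' x s) (bound := fun x => c / (1 + x ^ 2))
    (Icc_mem_nhds (by norm_num) (by norm_num) : Icc (-1 : ℝ) 1 ∈ 𝓝 0)
    (.of_forall fun s => (hF s).aestronglyMeasurable) (Space.integrableOn_of_bound (hF 0) hb)
    hF'.aestronglyMeasurable ?_ (S.integrableOn_bound c) ?_).2
  · exact (ae_restrict_iff' S.measurableSet_carrier).2 (.of_forall fun x hx s hs => hb' x hx s hs)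
  · exact .of_forall fun x s _ => hd x s

/-- The analytic form of the variation of a charge: θ parametrizes the contour, x is the position in
space and s the parameter of a curve in phase space. -/
lemma hasDerivAt_integral_contour {S : Space} (hH : ContDiff ℂ ∞ H) (hH0 : H 0 = 0)
    (hκ : Continuous κ) {ℓ ℓ' : ℝ → ℝ → ℝ → E}
    (hℓ : Continuous fun p : ℝ × ℝ × ℝ => ℓ p.1 p.2.1 p.2.2)
    (hℓ' : Continuous fun p : ℝ × ℝ × ℝ => ℓ' p.1 p.2.1 p.2.2)
    (hd : ∀ θ x s, HasDerivAt (ℓ θ x) (ℓ' θ x s) s) {c a b : ℝ} (hc : 0 ≤ c) (hab : a ≤ b)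
    (hb : ∀ θ ∈ Icc a b, ∀ x ∈ S.carrier, ∀ s ∈ Icc (-1 : ℝ) 1,
      ‖ℓ θ x s‖ ≤ c / (1 + x ^ 2) ∧ ‖ℓ' θ x s‖ ≤ c / (1 + x ^ 2)) :
    IntegrableOn (fun x => ∫ θ in a..b, κ θ * fderiv ℂ H (ℓ θ x 0) (ℓ' θ x 0)) S.carrier ∧
    HasDerivAt (fun s => S.integral fun x => ∫ θ in a..b, κ θ * H (ℓ θ x s))
      (S.integral fun x => ∫ θ in a..b, κ θ * fderiv ℂ H (ℓ θ x 0) (ℓ' θ x 0)) 0 := by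
  obtain ⟨C, hC0, hC⟩ := exists_bound_contour hH hH0 hκ hc hab
  have h0 : (0 : ℝ) ∈ Icc (-1 : ℝ) 1 := by constructor <;> norm_num
  have hcont : Continuous fun x => ∫ θ in a..b, κ θ * fderiv ℂ H (ℓ θ x 0) (ℓ' θ x 0) :=
    continuous_contour_fderiv hH hκ (ℓ := fun θ x => ℓ θ x 0) (ℓ' := fun θ x => ℓ' θ x 0)
      (hℓ.comp (continuous_fst.prodMk (continuous_snd.prodMk continuous_const)))
      (hℓ'.comp (continuous_fst.prodMk (continuous_snd.prodMk continuous_const))) a b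
  refine ⟨Space.integrableOn_of_bound hcont fun x hx =>
    (hC x (fun θ => ℓ θ x 0) (fun θ => ℓ' θ x 0) (fun θ hθ => (hb θ hθ x hx 0 h0).1)
      (fun θ hθ => (hb θ hθ x hx 0 h0).2)).2, ?_⟩
  refine Space.hasDerivAt_integral (F := fun x s => ∫ θ in a..b, κ θ * H (ℓ θ x s))
    (F' := fun x s => ∫ θ in a..b, κ θ * fderiv ℂ H (ℓ θ x s) (ℓ' θ x s)) (c := C) (fun s => ?_) ?_
    (fun x hx => ?_) (fun x hx s hs => ?_) fun x s => ?_
  · exact continuous_contour hH.continuous hκ (ℓ := fun θ x => ℓ θ x s)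
      (hℓ.comp (continuous_fst.prodMk (continuous_snd.prodMk continuous_const))) a b
  · exact hcont
  · exact (hC x (fun θ => ℓ θ x 0) (fun θ => ℓ' θ x 0) (fun θ hθ => (hb θ hθ x hx 0 h0).1)
      (fun θ hθ => (hb θ hθ x hx 0 h0).2)).1
  · exact (hC x (fun θ => ℓ θ x s) (fun θ => ℓ' θ x s) (fun θ hθ => (hb θ hθ x hx s hs).1)
      (fun θ hθ => (hb θ hθ x hx s hs).2)).2
  · exact hasDerivAt_contour hH hκ (ℓ := fun θ s => ℓ θ x s) (ℓ' := fun θ s => ℓ' θ x s)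
      (hℓ.comp (continuous_fst.prodMk (continuous_const.prodMk continuous_snd)))
      (hℓ'.comp (continuous_fst.prodMk (continuous_const.prodMk continuous_snd)))
      (fun θ s => hd θ x s) a b s

end Contour

/-! ### Regularity of the Lax matrix -/

namespace Model

open MeasureTheory Set

variable {t : ClassicalType} {S : Space} {M : Type*} [DiffeologicalSpace M]
  {P : PoissonStructure M} (𝓜 : Model t S P)

/-- The derivative of the Lax matrix along a curve in phase space. -/
def laxDeriv (γ : ℝ → M) (z : ℂ) (x s : ℝ) : t.Mat :=
  Matrix.of fun i j => deriv (fun u => (𝓜.lax z x (γ u) : t.Mat) i j) s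

/-- The spatial derivative of the Lax matrix. -/
def laxX (m : M) (z : ℂ) (x : ℝ) : t.Mat :=
  Matrix.of fun i j => deriv (fun y => (𝓜.lax z y m : t.Mat) i j) x

variable {𝓜} {γ : ℝ → M}

lemma isOpen_domain : IsOpen (𝓜.D ×ˢ (univ : Set (ℝ × ℝ))) := 𝓜.D_open.prod isOpen_univ

lemma hasFDerivAt_lax (hγ : DSmooth γ) {p : ℂ × ℝ × ℝ} (hp : p.1 ∈ 𝓜.D) (i j : t.Idx) :
    HasFDerivAt (fun p : ℂ × ℝ × ℝ => (𝓜.lax p.1 p.2.1 (γ p.2.2) : t.Mat) i j)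
      (fderiv ℝ (fun p : ℂ × ℝ × ℝ => (𝓜.lax p.1 p.2.1 (γ p.2.2) : t.Mat) i j) p) p :=
  (((𝓜.lax_smooth γ hγ i j).contDiffAt (isOpen_domain.mem_nhds ⟨hp, trivial⟩)).differentiableAt
    (by simp)).hasFDerivAt

/-- The second part, a partial derivative of the jointly smooth Lax matrix, is the source of the
joint continuity of `laxDeriv`. -/
lemma hasDerivAt_lax (hγ : DSmooth γ) {z : ℂ} (hz : z ∈ 𝓜.D) (x s : ℝ) (i j : t.Idx) :
    HasDerivAt (fun u => (𝓜.lax z x (γ u) : t.Mat) i j) (𝓜.laxDeriv γ z x s i j) s ∧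
    𝓜.laxDeriv γ z x s i j = fderiv ℝ (fun p : ℂ × ℝ × ℝ =>
      (𝓜.lax p.1 p.2.1 (γ p.2.2) : t.Mat) i j) (z, x, s) (0, 0, 1) := by
  have h := (hasFDerivAt_lax hγ (p := (z, x, s)) hz i j).comp_hasDerivAt s
    ((hasDerivAt_const s z).prodMk ((hasDerivAt_const s x).prodMk (hasDerivAt_id s)))
  have h2 := h.deriv
  refine ⟨?_, h2⟩
  rw [show 𝓜.laxDeriv γ z x s i j = _ from h2]
  exact h

lemma hasDerivAt_laxX {z : ℂ} (hz : z ∈ 𝓜.D) (x : ℝ) (m : M) (i j : t.Idx) :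
    HasDerivAt (fun y => (𝓜.lax z y m : t.Mat) i j) (𝓜.laxX m z x i j) x ∧
    𝓜.laxX m z x i j = fderiv ℝ (fun p : ℂ × ℝ × ℝ =>
      (𝓜.lax p.1 p.2.1 m : t.Mat) i j) (z, x, 0) (0, 1, 0) := by
  have h := (hasFDerivAt_lax (γ := fun _ => m) dSmooth_const (p := (z, x, 0)) hz i j).comp_hasDerivAt
    x ((hasDerivAt_const x z).prodMk ((hasDerivAt_id x).prodMk (hasDerivAt_const x (0 : ℝ))))
  have h2 := h.deriv
  refine ⟨?_, h2⟩
  rw [show 𝓜.laxX m z x i j = _ from h2]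
  exact h

section Continuity

variable {X : Type*} [TopologicalSpace X] {w : X → ℂ} {y s : X → ℝ}

lemma continuous_lax (hγ : DSmooth γ) (hw : Continuous w) (hwD : ∀ a, w a ∈ 𝓜.D)
    (hy : Continuous y) (hs : Continuous s) (i j : t.Idx) :
    Continuous fun a => (𝓜.lax (w a) (y a) (γ (s a)) : t.Mat) i j :=
  (𝓜.lax_smooth γ hγ i j).continuousOn.comp_continuous (hw.prodMk (hy.prodMk hs))
    fun a => ⟨hwD a, trivial⟩

lemma continuous_lax' (m : M) (hw : Continuous w) (hwD : ∀ a, w a ∈ 𝓜.D)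
    (hy : Continuous y) (i j : t.Idx) :
    Continuous fun a => (𝓜.lax (w a) (y a) m : t.Mat) i j :=
  continuous_lax (γ := fun _ => m) (s := fun _ => 0) dSmooth_const hw hwD hy continuous_const i j

lemma continuousOn_laxDeriv (hγ : DSmooth γ) (i j : t.Idx) :
    ContinuousOn (fun p : ℂ × ℝ × ℝ => 𝓜.laxDeriv γ p.1 p.2.1 p.2.2 i j)
      (𝓜.D ×ˢ (univ : Set (ℝ × ℝ))) :=
  (((𝓜.lax_smooth γ hγ i j).continuousOn_fderiv_of_isOpen isOpen_domain
    (by simp)).clm_apply continuousOn_const).congr fun p hp => (hasDerivAt_lax hγ hp.1 _ _ i j).2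

lemma continuous_laxDeriv (hγ : DSmooth γ) (hw : Continuous w) (hwD : ∀ a, w a ∈ 𝓜.D)
    (hy : Continuous y) (hs : Continuous s) (i j : t.Idx) :
    Continuous fun a => 𝓜.laxDeriv γ (w a) (y a) (s a) i j :=
  (continuousOn_laxDeriv hγ i j).comp_continuous (hw.prodMk (hy.prodMk hs))
    fun a => ⟨hwD a, trivial⟩

lemma continuous_laxX (m : M) (hw : Continuous w) (hwD : ∀ a, w a ∈ 𝓜.D)
    (hy : Continuous y) (i j : t.Idx) : Continuous fun a => 𝓜.laxX m (w a) (y a) i j := by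
  have h := ((𝓜.lax_smooth (fun _ => m) dSmooth_const i j).continuousOn_fderiv_of_isOpen
    isOpen_domain (by simp)).clm_apply (continuousOn_const (c := ((0 : ℂ), (1 : ℝ), (0 : ℝ))))
  refine (h.comp_continuous (hw.prodMk (hy.prodMk (continuous_const (y := (0 : ℝ)))))
    fun a => ⟨hwD a, trivial⟩).congr fun a => ?_
  exact (hasDerivAt_laxX (hwD a) (y a) m i j).2.symm

end Continuity

/-- The Lax matrix and its variations decrease, uniformly in the spectral parameter. -/
lemma exists_bound_lax (hγ : DSmooth γ) {K : Set ℂ} (hKD : K ⊆ 𝓜.D) (hK : IsCompact K) (b : ℝ) :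
    ∃ c, 0 ≤ c ∧ ∀ z ∈ K, ∀ s ∈ Icc (-b) b, ∀ x ∈ S.carrier, ∀ i j,
      ‖(𝓜.lax z x (γ s) : t.Mat) i j‖ ≤ c / (1 + x ^ 2) ∧
      ‖𝓜.laxDeriv γ z x s i j‖ ≤ c / (1 + x ^ 2) := by
  rcases (show S = .line ∨ S = .circle by cases S <;> simp) with hS | hS
  · obtain ⟨c, hc⟩ := 𝓜.lax_decay hS γ hγ K hKD hK b
    refine ⟨max c 0, le_max_right _ _, fun z hz s hs x _ i j => ?_⟩
    have h := hc z hz s hs x i j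
    have h2 : c / (1 + x ^ 2) ≤ max c 0 / (1 + x ^ 2) := by
      have := le_max_left c 0
      gcongr
    exact ⟨h.1.trans h2, h.2.trans h2⟩
  -- On the circle compactness takes the place of decay: the weight 1 + x² is bounded there.
  · have hsub : K ×ˢ Icc (0 : ℝ) (2 * Real.pi) ×ˢ Icc (-b) b ⊆ 𝓜.D ×ˢ (univ : Set (ℝ × ℝ)) :=
      prod_mono hKD (subset_univ _)
    have h1 : ∀ i j, ContinuousOn (fun p : ℂ × ℝ × ℝ => (1 + p.2.1 ^ 2) *
        (‖(𝓜.lax p.1 p.2.1 (γ p.2.2) : t.Mat) i j‖ + ‖𝓜.laxDeriv γ p.1 p.2.1 p.2.2 i j‖))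
        (K ×ˢ Icc (0 : ℝ) (2 * Real.pi) ×ˢ Icc (-b) b) := fun i j =>
      (Continuous.continuousOn (by fun_prop)).mul
        (((𝓜.lax_smooth γ hγ i j).continuousOn.mono hsub).norm.add
          ((continuousOn_laxDeriv hγ i j).mono hsub).norm)
    have h2 : ∀ i j, ∃ C, ∀ p ∈ K ×ˢ Icc (0 : ℝ) (2 * Real.pi) ×ˢ Icc (-b) b,
        ‖(1 + p.2.1 ^ 2) * (‖(𝓜.lax p.1 p.2.1 (γ p.2.2) : t.Mat) i j‖ +
          ‖𝓜.laxDeriv γ p.1 p.2.1 p.2.2 i j‖)‖ ≤ C := fun i j =>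
      (hK.prod (isCompact_Icc.prod isCompact_Icc)).exists_bound_of_continuousOn (h1 i j)
    choose C hC using h2
    refine ⟨∑ i, ∑ j, |C i j|, by positivity, fun z hz s hs x hx i j => ?_⟩
    rw [hS] at hx
    have h3 := hC i j (z, x, s) ⟨hz, hx, hs⟩
    have h4 : C i j ≤ ∑ i, ∑ j, |C i j| :=
      (le_abs_self _).trans ((Finset.single_le_sum (f := fun j => |C i j|)
        (fun _ _ => abs_nonneg _) (Finset.mem_univ j)).trans
        (Finset.single_le_sum (f := fun i => ∑ j, |C i j|)
          (fun _ _ => Finset.sum_nonneg fun _ _ => abs_nonneg _) (Finset.mem_univ i)))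
    have h5 : (0 : ℝ) < 1 + x ^ 2 := by positivity
    rw [Real.norm_of_nonneg (by positivity)] at h3
    have h6 := norm_nonneg ((𝓜.lax z x (γ s) : t.Mat) i j)
    have h7 := norm_nonneg (𝓜.laxDeriv γ z x s i j)
    rw [le_div_iff₀ h5, le_div_iff₀ h5]
    constructor <;> nlinarith

lemma laxDeriv_periodic (hS : S = .circle) {z : ℂ} (hz : z ∈ 𝓜.D) (x s : ℝ) :
    𝓜.laxDeriv γ z (x + 2 * Real.pi) s = 𝓜.laxDeriv γ z x s := by
  ext i j
  simp only [laxDeriv, 𝓜.lax_periodic hS z hz]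

/-! ### Complexified variations -/

variable (𝓜)

/-- The variation of the Lax matrix along a complexified tangent vector. -/
def varLax {m : M} (X : CTangent m) (z : ℂ) (x : ℝ) : t.Mat :=
  𝓜.laxDeriv X.re z x 0 + Complex.I • 𝓜.laxDeriv X.im z x 0

variable {𝓜} {m : M} (X : CTangent m)

lemma continuous_varLax {Y : Type*} [TopologicalSpace Y] {w : Y → ℂ} {y : Y → ℝ}
    (hw : Continuous w) (hwD : ∀ a, w a ∈ 𝓜.D) (hy : Continuous y) (i j : t.Idx) :
    Continuous fun a => 𝓜.varLax X (w a) (y a) i j :=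
  (continuous_laxDeriv X.re_smooth hw hwD hy continuous_const i j).add
    ((continuous_laxDeriv X.im_smooth hw hwD hy continuous_const i j).const_mul _)

lemma varLax_periodic (hS : S = .circle) {z : ℂ} (hz : z ∈ 𝓜.D) (x : ℝ) :
    𝓜.varLax X z (x + 2 * Real.pi) = 𝓜.varLax X z x := by
  simp only [varLax, laxDeriv_periodic hS hz]

lemma hasDerivAt_smeared (hγ : DSmooth γ) {z : ℂ} (hz : z ∈ 𝓜.D) {f : ℝ → ℂ} (hf : S.IsTest f)
    (i j : t.Idx) :
    HasDerivAt (fun s => S.integral fun x => f x * (𝓜.lax z x (γ s) : t.Mat) i j)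
      (S.integral fun x => f x * 𝓜.laxDeriv γ z x 0 i j) 0 := by
  obtain ⟨c, hc0, hc⟩ := exists_bound_lax (𝓜 := 𝓜) hγ (singleton_subset_iff.2 hz)
    isCompact_singleton 1
  obtain ⟨B, hB0, hB⟩ := hf.exists_bound
  have hfc := hf.contDiff.continuous
  have h0 : (0 : ℝ) ∈ Icc (-1 : ℝ) 1 := by constructor <;> norm_num
  refine Space.hasDerivAt_integral (F := fun x s => f x * (𝓜.lax z x (γ s) : t.Mat) i j)
    (F' := fun x s => f x * 𝓜.laxDeriv γ z x s i j) (c := B * c) (fun s => ?_) ?_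
    (fun x hx => ?_) (fun x hx s hs => ?_) fun x s => ?_
  · exact hfc.mul (continuous_lax hγ continuous_const (fun _ => hz) continuous_id continuous_const
      i j)
  · exact hfc.mul (continuous_laxDeriv hγ continuous_const (fun _ => hz) continuous_id
      continuous_const i j)
  · rw [norm_mul, mul_div_assoc]
    exact mul_le_mul (hB x hx) (hc z rfl 0 h0 x hx i j).1 (norm_nonneg _) hB0
  · rw [norm_mul, mul_div_assoc]
    exact mul_le_mul (hB x hx) (hc z rfl s hs x hx i j).2 (norm_nonneg _) hB0
  · exact (hasDerivAt_lax hγ hz x s i j).1.const_mul (f x)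

lemma _root_.TwistModel.CTangent.HasDeriv.unique {X : CTangent m} {G : M → ℂ} {z z' : ℂ}
    (h : X.HasDeriv G z) (h' : X.HasDeriv G z') : z = z' := by
  obtain ⟨u, v, hu, hv, rfl⟩ := h
  obtain ⟨u', v', hu', hv', rfl⟩ := h'
  rw [hu.unique hu', hv.unique hv']

lemma _root_.TwistModel.Space.integral_add {f g : ℝ → ℂ} (hf : IntegrableOn f S.carrier)
    (hg : IntegrableOn g S.carrier) :
    S.integral (fun x => f x + g x) = S.integral f + S.integral g := by
  simp only [S.integral_eq]
  exact MeasureTheory.integral_add hf hg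

lemma _root_.TwistModel.Space.integral_const_mul (c : ℂ) (f : ℝ → ℂ) :
    S.integral (fun x => c * f x) = c * S.integral f := by
  simp only [S.integral_eq]
  exact MeasureTheory.integral_const_mul _ _

/-- Brackets are known for smeared entries only; this expresses them through the pointwise
variation, which the fundamental lemma of the calculus of variations then determines. -/
lemma hasDeriv_smeared {z : ℂ} (hz : z ∈ 𝓜.D) {f : ℝ → ℂ} (hf : S.IsTest f) (i j : t.Idx) :
    X.HasDeriv (fun m => S.integral fun x => f x * (𝓜.lax z x m : t.Mat) i j)
      (S.integral fun x => f x * 𝓜.varLax X z x i j) := by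
  refine ⟨_, _, hasDerivAt_smeared X.re_smooth hz hf i j, hasDerivAt_smeared X.im_smooth hz hf i j,
    ?_⟩
  have h1 : ∀ {γ : ℝ → M}, DSmooth γ →
      IntegrableOn (fun x => f x * 𝓜.laxDeriv γ z x 0 i j) S.carrier := fun hγ =>
    hf.integrableOn_mul (continuous_laxDeriv hγ continuous_const (fun _ => hz) continuous_id'
      continuous_const i j)
  rw [← Space.integral_const_mul, ← Space.integral_add (h1 X.re_smooth)
    ((h1 X.im_smooth).const_mul _)]
  congr 1
  ext x
  change f x * (𝓜.laxDeriv X.re z x 0 i j + Complex.I * 𝓜.laxDeriv X.im z x 0 i j) = _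
  ring

end Model

/-! ### Partial traces -/

section PartialTrace

variable {n : Type*} [Fintype n]

/-- The partial trace `Tr₂ (R₁₂ Γ₂)`. -/
def ptrace (R : Matrix (n × n) (n × n) ℂ) (Γ : Matrix n n ℂ) : Matrix n n ℂ :=
  Matrix.of fun i j => ∑ k, ∑ l, R (i, k) (j, l) * Γ l k

/-- Brackets come entry by entry, with the indices of the first factor fixed. Tracing against Γ in
the second factor turns them into entries of one matrix. -/
lemma trace_mul_slice (R : Matrix (n × n) (n × n) ℂ) (Γ : Matrix n n ℂ) (i j : n) :
    (Γ * Matrix.of fun k l => R (i, k) (j, l)).trace = ptrace R Γ i j := by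
  simp only [Matrix.trace, Matrix.diag, Matrix.mul_apply, Matrix.of_apply, ptrace]
  rw [Finset.sum_comm]
  simp only [mul_comm]

lemma ptrace_add (R R' : Matrix (n × n) (n × n) ℂ) (Γ : Matrix n n ℂ) :
    ptrace (R + R') Γ = ptrace R Γ + ptrace R' Γ := by
  ext i j
  simp [ptrace, add_mul, Finset.sum_add_distrib]

lemma ptrace_sub (R R' : Matrix (n × n) (n × n) ℂ) (Γ : Matrix n n ℂ) :
    ptrace (R - R') Γ = ptrace R Γ - ptrace R' Γ := by
  ext i j
  simp [ptrace, sub_mul, Finset.sum_sub_distrib]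

lemma ptrace_smul (c : ℂ) (R : Matrix (n × n) (n × n) ℂ) (Γ : Matrix n n ℂ) :
    ptrace (c • R) Γ = c • ptrace R Γ := by
  ext i j
  simp [ptrace, Finset.mul_sum, mul_assoc]

lemma ptrace_sum {ι : Type*} (s : Finset ι) (R : ι → Matrix (n × n) (n × n) ℂ)
    (Γ : Matrix n n ℂ) : ptrace (∑ a ∈ s, R a) Γ = ∑ a ∈ s, ptrace (R a) Γ := by
  classical
  induction s using Finset.induction_on with
  | empty => ext i j; simp [ptrace]
  | insert a s ha ih => rw [Finset.sum_insert ha, Finset.sum_insert ha, ptrace_add, ih]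

lemma ptrace_kronecker (A B Γ : Matrix n n ℂ) : ptrace (A ⊗ₖ B) Γ = (B * Γ).trace • A := by
  ext i j
  simp only [ptrace, Matrix.of_apply, Matrix.kroneckerMap_apply, Matrix.trace, Matrix.diag,
    Matrix.mul_apply, Matrix.smul_apply, smul_eq_mul, Finset.sum_mul]
  exact Finset.sum_congr rfl fun k _ => Finset.sum_congr rfl fun l _ => by ring

variable [DecidableEq n]

lemma mul_kronecker_one_apply (R : Matrix (n × n) (n × n) ℂ) (L : Matrix n n ℂ) (i j k l : n) :
    (R * (L ⊗ₖ (1 : Matrix n n ℂ))) (i, k) (j, l) = ∑ p, R (i, k) (p, l) * L p j := by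
  simp [Matrix.mul_apply, Fintype.sum_prod_type, Matrix.one_apply]

lemma kronecker_one_mul_apply (R : Matrix (n × n) (n × n) ℂ) (L : Matrix n n ℂ) (i j k l : n) :
    ((L ⊗ₖ (1 : Matrix n n ℂ)) * R) (i, k) (j, l) = ∑ p, L i p * R (p, k) (j, l) := by
  simp [Matrix.mul_apply, Fintype.sum_prod_type, Matrix.one_apply]

lemma mul_one_kronecker_apply (R : Matrix (n × n) (n × n) ℂ) (L : Matrix n n ℂ) (i j k l : n) :
    (R * ((1 : Matrix n n ℂ) ⊗ₖ L)) (i, k) (j, l) = ∑ q, R (i, k) (j, q) * L q l := by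
  simp [Matrix.mul_apply, Fintype.sum_prod_type, Matrix.one_apply]

lemma one_kronecker_mul_apply (R : Matrix (n × n) (n × n) ℂ) (L : Matrix n n ℂ) (i j k l : n) :
    (((1 : Matrix n n ℂ) ⊗ₖ L) * R) (i, k) (j, l) = ∑ q, L k q * R (i, q) (j, l) := by
  simp [Matrix.mul_apply, Fintype.sum_prod_type, Matrix.one_apply]

lemma ptrace_mul_kronecker_one (R : Matrix (n × n) (n × n) ℂ) (L Γ : Matrix n n ℂ) :
    ptrace (R * (L ⊗ₖ (1 : Matrix n n ℂ))) Γ = ptrace R Γ * L := by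
  ext i j
  simp only [ptrace, Matrix.of_apply, mul_kronecker_one_apply]
  simp only [Matrix.mul_apply, Matrix.of_apply, Finset.sum_mul]
  rw [Finset.sum_comm_cycle]
  exact Finset.sum_congr rfl fun _ _ => Finset.sum_congr rfl fun _ _ =>
    Finset.sum_congr rfl fun _ _ => by ring

lemma ptrace_kronecker_one_mul (R : Matrix (n × n) (n × n) ℂ) (L Γ : Matrix n n ℂ) :
    ptrace ((L ⊗ₖ (1 : Matrix n n ℂ)) * R) Γ = L * ptrace R Γ := by
  ext i j
  simp only [ptrace, Matrix.of_apply, kronecker_one_mul_apply]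
  simp only [Matrix.mul_apply, Matrix.of_apply, Finset.sum_mul, Finset.mul_sum]
  rw [Finset.sum_comm_cycle]
  exact Finset.sum_congr rfl fun _ _ => Finset.sum_congr rfl fun _ _ =>
    Finset.sum_congr rfl fun _ _ => by ring

/-- Together with `ptrace_one_kronecker_mul` this removes the commutator with L₂ whenever Γ commutes
with L. -/
lemma ptrace_mul_one_kronecker (R : Matrix (n × n) (n × n) ℂ) (L Γ : Matrix n n ℂ) :
    ptrace (R * ((1 : Matrix n n ℂ) ⊗ₖ L)) Γ = ptrace R (L * Γ) := by
  ext i j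
  simp only [ptrace, Matrix.of_apply, mul_one_kronecker_apply]
  simp only [Matrix.mul_apply, Finset.sum_mul, Finset.mul_sum]
  refine Finset.sum_congr rfl fun _ _ => ?_
  rw [Finset.sum_comm]
  exact Finset.sum_congr rfl fun _ _ => Finset.sum_congr rfl fun _ _ => by ring

lemma ptrace_one_kronecker_mul (R : Matrix (n × n) (n × n) ℂ) (L Γ : Matrix n n ℂ) :
    ptrace (((1 : Matrix n n ℂ) ⊗ₖ L) * R) Γ = ptrace R (Γ * L) := by
  ext i j
  simp only [ptrace, Matrix.of_apply, one_kronecker_mul_apply]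
  simp only [Matrix.mul_apply, Finset.sum_mul, Finset.mul_sum]
  rw [Finset.sum_comm_cycle]
  exact Finset.sum_congr rfl fun _ _ => by
    rw [Finset.sum_comm]
    exact Finset.sum_congr rfl fun _ _ => Finset.sum_congr rfl fun _ _ => by ring

end PartialTrace

/-! ### Partial traces of the R-matrix -/

namespace TwistData

variable {t : ClassicalType} (τ : TwistData t)

/-- The expansion is over the elements σᵏ(Tᵃ) of 𝔤. Hence the gauge parameter lies in 𝔤, and only
scalar coefficients have to be integrated. -/
lemma ptrace_R0 (z w : ℂ) (Γ : t.Mat) :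
    ptrace (τ.R0 z w) Γ = ∑ k ∈ Finset.range τ.T, ∑ a,
      ((τ.T : ℂ)⁻¹ * (w - (τ.root ^ k)⁻¹ * z)⁻¹ * ((τ.dn a : t.Mat) * Γ).trace) •
        ((τ.σ^[k] (τ.up a) : t.alg) : t.Mat) := by
  rw [R0, ptrace_smul, ptrace_sum, Finset.smul_sum]
  refine Finset.sum_congr rfl fun k _ => ?_
  rw [ptrace_smul, ptrace_sum, Finset.smul_sum, Finset.smul_sum]
  refine Finset.sum_congr rfl fun a _ => ?_
  rw [ptrace_kronecker, smul_smul, smul_smul, mul_assoc]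

/-- In this form the dependence on w is visibly holomorphic away from wᵀ = zᵀ (T-th powers),
provided Γ is holomorphic in w. -/
lemma ptrace_R0_swap (z w : ℂ) (Γ : t.Mat) :
    ptrace ((τ.R0 w z).submatrix Prod.swap Prod.swap) Γ = ∑ k ∈ Finset.range τ.T, ∑ a,
      ((τ.T : ℂ)⁻¹ * (z - (τ.root ^ k)⁻¹ * w)⁻¹ *
        (((τ.σ^[k] (τ.up a) : t.alg) : t.Mat) * Γ).trace) • (τ.dn a : t.Mat) := by
  have h : (τ.R0 w z).submatrix Prod.swap Prod.swap = (τ.T : ℂ)⁻¹ • ∑ k ∈ Finset.range τ.T,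
      (z - (τ.root ^ k)⁻¹ * w)⁻¹ • ∑ a, ((τ.dn a : t.alg) : t.Mat) ⊗ₖ
        ((τ.σ^[k] (τ.up a) : t.alg) : t.Mat) := by
    ext ⟨i, k⟩ ⟨j, l⟩
    simp only [R0, Matrix.submatrix_apply, Matrix.smul_apply, Matrix.sum_apply, Prod.swap,
      Matrix.kroneckerMap_apply, mul_comm]
  rw [h, ptrace_smul, ptrace_sum, Finset.smul_sum]
  refine Finset.sum_congr rfl fun k _ => ?_
  rw [ptrace_smul, ptrace_sum, Finset.smul_sum, Finset.smul_sum]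
  refine Finset.sum_congr rfl fun a _ => ?_
  rw [ptrace_kronecker, smul_smul, smul_smul, mul_assoc]

lemma R21_eq (z w : ℂ) :
    τ.R21 w z = (τ.φval z)⁻¹ • (τ.R0 w z).submatrix Prod.swap Prod.swap := rfl

/-- A vanishing denominator means that w is z times a T-th root of unity. -/
lemma sub_root_ne_zero {z w : ℂ} (h : z ^ τ.T ≠ w ^ τ.T) (k : ℕ) :
    w - (τ.root ^ k)⁻¹ * z ≠ 0 := fun h0 => h (by
  rw [sub_eq_zero.1 h0, mul_pow, inv_pow, ← pow_mul, mul_comm k, pow_mul, τ.root_prim.pow_eq_one,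
    one_pow, inv_one, one_mul])

end TwistData

/-! ### Response of the Lax matrix to a smeared Lax matrix -/

namespace Model

open MeasureTheory Set

variable {t : ClassicalType} {S : Space} {M : Type*} [DiffeologicalSpace M]
  {P : PoissonStructure M} (𝓜 : Model t S P)

/-- The matrix of the ultralocal part of the bracket of the Lax matrices. -/
def mailletMatrix (z w : ℂ) (x : ℝ) (m : M) : Matrix (t.Idx × t.Idx) (t.Idx × t.Idx) ℂ :=
  (𝓜.R12 z w * ((𝓜.lax z x m : t.Mat) ⊗ₖ (1 : t.Mat))
      - ((𝓜.lax z x m : t.Mat) ⊗ₖ (1 : t.Mat)) * 𝓜.R12 z w)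
    - (𝓜.R21 w z * ((1 : t.Mat) ⊗ₖ (𝓜.lax w x m : t.Mat))
      - ((1 : t.Mat) ⊗ₖ (𝓜.lax w x m : t.Mat)) * 𝓜.R21 w z)

variable {𝓜} {m : M}

lemma continuous_mailletMatrix {z w : ℂ} (hz : z ∈ 𝓜.D) (hw : w ∈ 𝓜.D) (i j k l : t.Idx) :
    Continuous fun x => 𝓜.mailletMatrix z w x m (i, k) (j, l) := by
  have h1 : ∀ i j, Continuous fun x => (𝓜.lax z x m : t.Mat) i j := fun i j =>
    continuous_lax' m continuous_const (fun _ => hz) continuous_id' i j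
  have h2 : ∀ i j, Continuous fun x => (𝓜.lax w x m : t.Mat) i j := fun i j =>
    continuous_lax' m continuous_const (fun _ => hw) continuous_id' i j
  simp only [mailletMatrix, Matrix.sub_apply, mul_kronecker_one_apply, kronecker_one_mul_apply,
    mul_one_kronecker_apply, one_kronecker_mul_apply]
  fun_prop

/-- The variation of the Lax matrix along the Hamiltonian vector of a smeared Lax matrix. -/
lemma varLax_eq_of_isHamiltonian_smeared {z w : ℂ} (hz : z ∈ 𝓜.D) (hw : w ∈ 𝓜.D)
    (hgz : 𝓜.IsGeneric z) (hgw : 𝓜.IsGeneric w) (hzw : z ^ 𝓜.T ≠ w ^ 𝓜.T) {f : ℝ → ℂ}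
    (hf : S.IsTest f) {i j : t.Idx} {Y : CTangent m}
    (hY : P.IsHamiltonian ⟨_, 𝓜.smeared_mem z hz f hf i j⟩ Y) (k l : t.Idx) (x : ℝ) :
    𝓜.varLax Y w x k l = f x * 𝓜.mailletMatrix z w x m (i, k) (j, l) +
      deriv f x * (𝓜.R12 z w + 𝓜.R21 w z) (i, k) (j, l) := by
  have hA := continuous_mailletMatrix (m := m) hz hw i j k l
  have hfc := hf.contDiff.continuous
  have hfc' := hf.deriv.contDiff.continuous
  have hV : Continuous fun x => 𝓜.varLax Y w x k l :=
    continuous_varLax Y continuous_const (fun _ => hw) continuous_id' k l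
  have hfA : Continuous fun x => f x * 𝓜.mailletMatrix z w x m (i, k) (j, l) := hfc.mul hA
  have hR : Continuous fun x => f x * 𝓜.mailletMatrix z w x m (i, k) (j, l) +
      deriv f x * (𝓜.R12 z w + 𝓜.R21 w z) (i, k) (j, l) :=
    hfA.add (hfc'.mul continuous_const)
  rw [← sub_eq_zero]
  refine Space.eq_zero_of_integral_test (S := S) (g := fun x => 𝓜.varLax Y w x k l -
      (f x * 𝓜.mailletMatrix z w x m (i, k) (j, l) +
        deriv f x * (𝓜.R12 z w + 𝓜.R21 w z) (i, k) (j, l))) (hV.sub hR) ?_ ?_ x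
  · intro hS x
    have hfp : f (x + 2 * Real.pi) = f x := by subst hS; exact hf.2 x
    have hfp' : deriv f (x + 2 * Real.pi) = deriv f x := by subst hS; exact hf.deriv.2 x
    simp only [varLax_periodic Y hS hw, hfp, hfp', mailletMatrix, 𝓜.lax_periodic hS z hz,
      𝓜.lax_periodic hS w hw]
  · intro h hh
    -- The derivative along Y and the bracket formula are two expressions for the same number, for
    -- every test function h.
    have h1 := (hasDeriv_smeared Y hw hh k l).unique (hY ⟨_, 𝓜.smeared_mem w hw h hh k l⟩)
    rw [𝓜.maillet z hz w hw hgz hgw hzw f hf h hh i j k l m] at h1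
    have e1 : S.integral (fun x => h x * (𝓜.varLax Y w x k l -
        (f x * 𝓜.mailletMatrix z w x m (i, k) (j, l) +
          deriv f x * (𝓜.R12 z w + 𝓜.R21 w z) (i, k) (j, l)))) =
        S.integral (fun x => h x * 𝓜.varLax Y w x k l) +
          (S.integral (fun x => (-1) * (h x * (f x * 𝓜.mailletMatrix z w x m (i, k) (j, l)))) +
          S.integral (fun x => (-(𝓜.R12 z w + 𝓜.R21 w z) (i, k) (j, l)) *
            (h x * deriv f x))) := by
      rw [← Space.integral_add ((hh.integrableOn_mul hfA).const_mul _)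
        ((hh.integrableOn_mul hfc').const_mul _), ← Space.integral_add (hh.integrableOn_mul hV)]
      · congr 1
        ext x
        ring
      · exact ((hh.integrableOn_mul hfA).const_mul _).add
          ((hh.integrableOn_mul hfc').const_mul _)
    rw [e1, h1, Space.integral_const_mul, Space.integral_const_mul]
    have e2 : (fun x => h x * (f x * 𝓜.mailletMatrix z w x m (i, k) (j, l))) =
        fun x => f x * h x * 𝓜.mailletMatrix z w x m (i, k) (j, l) := by
      ext x; ring
    have e3 : (fun x => h x * deriv f x) = fun x => deriv f x * h x := by
      ext x; ring
    rw [e2, e3]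
    simp only [mailletMatrix]
    ring

/-- The trace of the gradient of an invariant function against the bracket. -/
lemma trace_mul_variation {z w : ℂ} (hgw : 𝓜.IsGeneric w) {Γ : t.Mat} {x : ℝ}
    (hΓ : Γ * (𝓜.φval w • (𝓜.lax w x m : t.Mat)) = (𝓜.φval w • (𝓜.lax w x m : t.Mat)) * Γ)
    (u v : ℂ) (i j : t.Idx) :
    𝓜.φval w * (Γ * Matrix.of fun k l => u * 𝓜.mailletMatrix z w x m (i, k) (j, l) +
      v * (𝓜.R12 z w + 𝓜.R21 w z) (i, k) (j, l)).trace =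
    u * (ptrace (𝓜.R0 z w) Γ * (𝓜.lax z x m : t.Mat) -
        (𝓜.lax z x m : t.Mat) * ptrace (𝓜.R0 z w) Γ) i j +
      v * (ptrace (𝓜.R0 z w) Γ i j + (𝓜.φval z)⁻¹ * (𝓜.φval w *
        ptrace ((𝓜.R0 w z).submatrix Prod.swap Prod.swap) Γ i j)) := by
  have hφ := 𝓜.φval_ne_zero hgw
  have hcomm : Γ * (𝓜.lax w x m : t.Mat) = (𝓜.lax w x m : t.Mat) * Γ := by
    rw [mul_smul_comm, smul_mul_assoc] at hΓ
    exact smul_right_injective _ hφ hΓ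
  have h1 : (Matrix.of fun k l => u * 𝓜.mailletMatrix z w x m (i, k) (j, l) +
      v * (𝓜.R12 z w + 𝓜.R21 w z) (i, k) (j, l)) = Matrix.of fun k l =>
      (u • 𝓜.mailletMatrix z w x m + v • (𝓜.R12 z w + 𝓜.R21 w z)) (i, k) (j, l) := rfl
  -- The commutator of R₂₁ with L₂ cancels by `hcomm`. The prefactor φ(w) cancels 1/φ(w) in R₁₂, but
  -- survives in front of R₂₁, which carries 1/φ(z).
  rw [h1, trace_mul_slice, ptrace_add, ptrace_smul, ptrace_smul, ptrace_add, mailletMatrix,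
    ptrace_sub, ptrace_sub, ptrace_sub, ptrace_mul_kronecker_one, ptrace_kronecker_one_mul,
    ptrace_mul_one_kronecker, ptrace_one_kronecker_mul, hcomm, sub_self, sub_zero,
    TwistData.R21_eq, TwistData.R12, ptrace_smul, ptrace_smul]
  simp only [Matrix.add_apply, Matrix.smul_apply, Matrix.sub_apply, smul_eq_mul,
    smul_mul_assoc, mul_smul_comm]
  field_simp

end Model

/-- Passing the derivative as an explicit function `g` lets the integrals appear directly as traces
against the gradient. -/
lemma hasDerivAt_integral_contour_of_fderiv_eq {E : Type*} [NormedAddCommGroup E]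
    [NormedSpace ℂ E] [FiniteDimensional ℂ E] {H : E → ℂ} {κ : ℝ → ℂ} {S : Space}
    (hH : ContDiff ℂ ∞ H) (hH0 : H 0 = 0) {g : E → E → ℂ} (hg : ∀ X V, fderiv ℂ H X V = g X V)
    (hκ : Continuous κ) {ℓ ℓ' : ℝ → ℝ → ℝ → E}
    (hℓ : Continuous fun p : ℝ × ℝ × ℝ => ℓ p.1 p.2.1 p.2.2)
    (hℓ' : Continuous fun p : ℝ × ℝ × ℝ => ℓ' p.1 p.2.1 p.2.2)
    (hd : ∀ θ x s, HasDerivAt (ℓ θ x) (ℓ' θ x s) s) {c a b : ℝ} (hc : 0 ≤ c) (hab : a ≤ b)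
    (hb : ∀ θ ∈ Set.Icc a b, ∀ x ∈ S.carrier, ∀ s ∈ Set.Icc (-1 : ℝ) 1,
      ‖ℓ θ x s‖ ≤ c / (1 + x ^ 2) ∧ ‖ℓ' θ x s‖ ≤ c / (1 + x ^ 2)) :
    MeasureTheory.IntegrableOn (fun x => ∫ θ in a..b, κ θ * g (ℓ θ x 0) (ℓ' θ x 0)) S.carrier ∧
    HasDerivAt (fun s => S.integral fun x => ∫ θ in a..b, κ θ * H (ℓ θ x s))
      (S.integral fun x => ∫ θ in a..b, κ θ * g (ℓ θ x 0) (ℓ' θ x 0)) 0 := by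
  simp only [← hg]
  exact hasDerivAt_integral_contour hH hH0 hκ hℓ hℓ' hd hc hab hb

namespace Model

open MeasureTheory Set
open scoped Matrix.Norms.Operator

variable {t : ClassicalType} {S : Space} {M : Type*} [DiffeologicalSpace M]
  {P : PoissonStructure M} {𝓜 : Model t S P} {m : M}

/-! ### Variations of the local charges -/

section Disc

variable {z₀ : ℂ} {r : ℕ} {R : ℝ} {ψ : ℂ → ℂ} (hD : 𝓜.IsDisc z₀ r R ψ)

include hD

lemma IsDisc.circleMap_mem_domain (θ : ℝ) : circleMap z₀ (R / 2) θ ∈ 𝓜.D :=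
  hD.mem _ (hD.circleMap_mem θ).1 (hD.circleMap_mem θ).2

lemma IsDisc.continuous_φval : Continuous fun θ => 𝓜.φval (circleMap z₀ (R / 2) θ) :=
  continuous_iff_continuousAt.2 fun θ =>
    (differentiableAt_φval (hD.denom _ (hD.circleMap_mem θ).1)).continuousAt.comp
      (continuous_circleMap z₀ (R / 2)).continuousAt

/-- Decay of the rescaled Lax matrix on a circle around a regular zero. -/
lemma IsDisc.exists_bound {γ : ℝ → M} (hγ : DSmooth γ) (b : ℝ) :
    ∃ c, 0 ≤ c ∧ ∀ θ ∈ Icc 0 (2 * Real.pi), ∀ x ∈ S.carrier, ∀ s ∈ Icc (-b) b,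
      ‖𝓜.φval (circleMap z₀ (R / 2) θ) • (𝓜.lax (circleMap z₀ (R / 2) θ) x (γ s) : t.Mat)‖ ≤
        c / (1 + x ^ 2) ∧
      ‖𝓜.φval (circleMap z₀ (R / 2) θ) • 𝓜.laxDeriv γ (circleMap z₀ (R / 2) θ) x s‖ ≤
        c / (1 + x ^ 2) := by
  have hKc : IsCompact (circleMap z₀ (R / 2) '' Icc 0 (2 * Real.pi)) :=
    isCompact_Icc.image (continuous_circleMap _ _)
  have hKD : circleMap z₀ (R / 2) '' Icc 0 (2 * Real.pi) ⊆ 𝓜.D := by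
    rintro _ ⟨θ, -, rfl⟩
    exact hD.circleMap_mem_domain θ
  obtain ⟨c, hc0, hc⟩ := exists_bound_lax (𝓜 := 𝓜) hγ hKD hKc b
  obtain ⟨B, hB⟩ := (isCompact_Icc (a := 0) (b := 2 * Real.pi)).exists_bound_of_continuousOn
    hD.continuous_φval.continuousOn
  have hB0 : 0 ≤ B := (norm_nonneg _).trans (hB 0 ⟨le_rfl, by positivity⟩)
  refine ⟨B * (Fintype.card t.Idx * c), by positivity, fun θ hθ x hx s hs => ?_⟩
  have hx0 : 0 ≤ c / (1 + x ^ 2) := by positivity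
  have key := hc _ (mem_image_of_mem _ hθ) s hs x hx
  rw [mul_div_assoc, mul_div_assoc]
  exact ⟨(norm_smul_le _ _).trans (mul_le_mul (hB θ hθ)
      (norm_matrix_le hx0 fun i j => (key i j).1) (norm_nonneg _) hB0),
    (norm_smul_le _ _).trans (mul_le_mul (hB θ hθ)
      (norm_matrix_le hx0 fun i j => (key i j).2) (norm_nonneg _) hB0)⟩

lemma IsDisc.continuous_smul_lax {X : Type*} [TopologicalSpace X] {γ : ℝ → M} (hγ : DSmooth γ)
    {θ y s : X → ℝ} (hθ : Continuous θ) (hy : Continuous y) (hs : Continuous s) :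
    Continuous fun p => 𝓜.φval (circleMap z₀ (R / 2) (θ p)) •
      (𝓜.lax (circleMap z₀ (R / 2) (θ p)) (y p) (γ (s p)) : t.Mat) :=
  continuous_matrix'.2 fun i j => (hD.continuous_φval.comp hθ).mul
    (continuous_lax hγ ((continuous_circleMap _ _).comp hθ)
      (fun _ => hD.circleMap_mem_domain _) hy hs i j)

lemma IsDisc.continuous_smul_laxDeriv {X : Type*} [TopologicalSpace X] {γ : ℝ → M}
    (hγ : DSmooth γ) {θ y s : X → ℝ} (hθ : Continuous θ) (hy : Continuous y)
    (hs : Continuous s) :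
    Continuous fun p => 𝓜.φval (circleMap z₀ (R / 2) (θ p)) •
      𝓜.laxDeriv γ (circleMap z₀ (R / 2) (θ p)) (y p) (s p) :=
  continuous_matrix'.2 fun i j => (hD.continuous_φval.comp hθ).mul
    (continuous_laxDeriv hγ ((continuous_circleMap _ _).comp hθ)
      (fun _ => hD.circleMap_mem_domain _) hy hs i j)

end Disc

section Charge

variable {z₀ : ℂ} {n : ℕ} {R : ℝ} {ψ : ℂ → ℂ} (hD : 𝓜.IsDisc z₀ (𝓜.order z₀ n) R ψ)
  (hreg : 𝓜.IsRegularZero z₀) {G : t.Mat → ℂ} {Γ : t.Mat → t.Mat} (hG : IsInvariantFn G Γ)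
  (hW : ∀ z x m, 𝓜.W z₀ n z x m = G (𝓜.scaledLax z x m))

include hD hreg hG hW

/-- The contour formula of the current is differentiated under both integrals; the gradient Γ turns
the derivative of G into a trace. -/
lemma hasDerivAt_charge {γ : ℝ → M} (hγ : DSmooth γ) :
    IntegrableOn (fun x => ∫ θ in (0 : ℝ)..2 * Real.pi, kernel (𝓜.order z₀ n) (R / 2) θ *
      (𝓜.φval (circleMap z₀ (R / 2) θ) *
        (Γ (𝓜.φval (circleMap z₀ (R / 2) θ) • (𝓜.lax (circleMap z₀ (R / 2) θ) x (γ 0) : t.Mat)) *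
          𝓜.laxDeriv γ (circleMap z₀ (R / 2) θ) x 0).trace)) S.carrier ∧
    HasDerivAt (fun s => 𝓜.charge z₀ n (γ s))
      (S.integral fun x => ∫ θ in (0 : ℝ)..2 * Real.pi, kernel (𝓜.order z₀ n) (R / 2) θ *
        (𝓜.φval (circleMap z₀ (R / 2) θ) *
          (Γ (𝓜.φval (circleMap z₀ (R / 2) θ) •
            (𝓜.lax (circleMap z₀ (R / 2) θ) x (γ 0) : t.Mat)) *
              𝓜.laxDeriv γ (circleMap z₀ (R / 2) θ) x 0).trace)) 0 := by
  obtain ⟨c, hc0, hc⟩ := hD.exists_bound hγ 1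
  have key := hasDerivAt_integral_contour_of_fderiv_eq (S := S) hG.contDiff_fn hG.zero
    (g := fun X V => (Γ X * V).trace) (fun X V => DFunLike.congr_fun (hG.hasFDerivAt X).fderiv V)
    (continuous_kernel (𝓜.order z₀ n) (half_pos hD.pos))
    (ℓ := fun θ x s => 𝓜.φval (circleMap z₀ (R / 2) θ) •
      (𝓜.lax (circleMap z₀ (R / 2) θ) x (γ s) : t.Mat))
    (ℓ' := fun θ x s => 𝓜.φval (circleMap z₀ (R / 2) θ) •
      𝓜.laxDeriv γ (circleMap z₀ (R / 2) θ) x s)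
    (hD.continuous_smul_lax hγ continuous_fst continuous_snd.fst continuous_snd.snd)
    (hD.continuous_smul_laxDeriv hγ continuous_fst continuous_snd.fst continuous_snd.snd)
    (fun θ x s => hasDerivAt_matrix.2 fun i j =>
      (hasDerivAt_lax hγ (hD.circleMap_mem_domain θ) x s i j).1.const_mul _)
    hc0 (by positivity : (0 : ℝ) ≤ 2 * Real.pi) hc
  simp only [mul_smul_comm, Matrix.trace_smul, smul_eq_mul] at key
  refine ⟨key.1, ?_⟩
  have h2 := key.2
  simp only [← hD.current_eq hreg hG hW] at h2
  exact h2

lemma hasDeriv_charge (Y : CTangent m) :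
    Y.HasDeriv (𝓜.charge z₀ n)
      (S.integral fun x => ∫ θ in (0 : ℝ)..2 * Real.pi, kernel (𝓜.order z₀ n) (R / 2) θ *
        (𝓜.φval (circleMap z₀ (R / 2) θ) *
          (Γ (𝓜.φval (circleMap z₀ (R / 2) θ) •
            (𝓜.lax (circleMap z₀ (R / 2) θ) x m : t.Mat)) *
              𝓜.varLax Y (circleMap z₀ (R / 2) θ) x).trace)) := by
  have h1 := hasDerivAt_charge hD hreg hG hW Y.re_smooth
  have h2 := hasDerivAt_charge hD hreg hG hW Y.im_smooth
  rw [Y.re_zero] at h1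
  rw [Y.im_zero] at h2
  refine ⟨_, _, h1.2, h2.2, ?_⟩
  rw [← Space.integral_const_mul, ← Space.integral_add h1.1 (h2.1.const_mul _)]
  congr 1
  ext x
  have hc : ∀ {γ : ℝ → M}, DSmooth γ → Continuous fun θ => kernel (𝓜.order z₀ n) (R / 2) θ *
      (𝓜.φval (circleMap z₀ (R / 2) θ) *
        (Γ (𝓜.φval (circleMap z₀ (R / 2) θ) • (𝓜.lax (circleMap z₀ (R / 2) θ) x m : t.Mat)) *
          𝓜.laxDeriv γ (circleMap z₀ (R / 2) θ) x 0).trace) := fun {γ} hγ => by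
    have e1 : Continuous fun θ => Γ (𝓜.φval (circleMap z₀ (R / 2) θ) •
        (𝓜.lax (circleMap z₀ (R / 2) θ) x m : t.Mat)) :=
      hG.contDiff.continuous.comp (hD.continuous_smul_lax (γ := fun _ => m) (y := fun _ => x)
        (s := fun _ => 0) dSmooth_const continuous_id continuous_const continuous_const)
    have e2 : Continuous fun θ => 𝓜.laxDeriv γ (circleMap z₀ (R / 2) θ) x 0 :=
      continuous_matrix'.2 fun i j => continuous_laxDeriv hγ (continuous_circleMap _ _)
        (fun _ => hD.circleMap_mem_domain _) continuous_const continuous_const i j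
    exact (continuous_kernel _ (half_pos hD.pos)).mul (hD.continuous_φval.mul
      (e1.matrix_mul e2).matrix_trace)
  rw [← intervalIntegral.integral_const_mul, ← intervalIntegral.integral_add
    ((hc Y.re_smooth).intervalIntegrable _ _)
    (((hc Y.im_smooth).const_mul _).intervalIntegrable _ _)]
  congr 1
  ext θ
  simp only [varLax, mul_add, mul_smul_comm, Matrix.trace_add, Matrix.trace_smul, smul_eq_mul]
  ring

end Charge

end Model

/-! ### Profiles -/

/-- `c` is a continuously differentiable function on space, with derivative `c'`, that tends to
zero at the infinity of the line. -/
structure Space.IsProfile (S : Space) (c c' : ℝ → ℂ) : Prop where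
  hasDerivAt : ∀ x, HasDerivAt c (c' x) x
  continuous_deriv : Continuous c'
  periodic : S = .circle → Function.Periodic c (2 * Real.pi)
  tendsto : S = .line → Tendsto c atTop (𝓝 0) ∧ Tendsto c atBot (𝓝 0)

namespace Space.IsProfile

variable {S : Space} {c c' d d' : ℝ → ℂ}

lemma continuous (h : S.IsProfile c c') : Continuous c :=
  continuous_iff_continuousAt.2 fun x => (h.hasDerivAt x).continuousAt

lemma zero : S.IsProfile (fun _ => 0) (fun _ => 0) where
  hasDerivAt x := hasDerivAt_const x 0
  continuous_deriv := continuous_const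
  periodic _ _ := rfl
  tendsto _ := ⟨tendsto_const_nhds, tendsto_const_nhds⟩

lemma add (h : S.IsProfile c c') (k : S.IsProfile d d') :
    S.IsProfile (fun x => c x + d x) (fun x => c' x + d' x) where
  hasDerivAt x := (h.hasDerivAt x).add (k.hasDerivAt x)
  continuous_deriv := h.continuous_deriv.add k.continuous_deriv
  periodic hS x := by simp only [h.periodic hS x, k.periodic hS x]
  tendsto hS := by
    simpa using And.intro ((h.tendsto hS).1.add (k.tendsto hS).1)
      ((h.tendsto hS).2.add (k.tendsto hS).2)

lemma const_mul (h : S.IsProfile c c') (a : ℂ) :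
    S.IsProfile (fun x => a * c x) (fun x => a * c' x) where
  hasDerivAt x := (h.hasDerivAt x).const_mul a
  continuous_deriv := h.continuous_deriv.const_mul a
  periodic hS x := by simp only [h.periodic hS x]
  tendsto hS := by
    simpa using And.intro ((h.tendsto hS).1.const_mul a) ((h.tendsto hS).2.const_mul a)

lemma sum {ι : Type*} (s : Finset ι) {c c' : ι → ℝ → ℂ} (h : ∀ i ∈ s, S.IsProfile (c i) (c' i)) :
    S.IsProfile (fun x => ∑ i ∈ s, c i x) (fun x => ∑ i ∈ s, c' i x) := by
  classical
  induction s using Finset.induction_on with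
  | empty => simpa using zero
  | insert a s ha ih =>
    simp only [Finset.sum_insert ha]
    exact (h a (Finset.mem_insert_self a s)).add
      (ih fun i hi => h i (Finset.mem_insert_of_mem hi))

end Space.IsProfile

lemma tendsto_zero_of_bound {c : ℝ → ℂ} {C : ℝ} (h : ∀ x, ‖c x‖ ≤ C / (1 + x ^ 2)) :
    Tendsto c atTop (𝓝 0) ∧ Tendsto c atBot (𝓝 0) := by
  have h1 : Tendsto (fun x : ℝ => C / (1 + x ^ 2)) atTop (𝓝 0) :=
    tendsto_const_nhds.div_atTop (tendsto_atTop_add_const_left _ _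
      (tendsto_pow_atTop two_ne_zero))
  have h2 : Tendsto (fun x : ℝ => C / (1 + x ^ 2)) atBot (𝓝 0) := by
    exact (h1.comp tendsto_neg_atBot_atTop).congr fun x => by simp
  exact ⟨squeeze_zero_norm h h1, squeeze_zero_norm h h2⟩

namespace Model

open MeasureTheory Set
open scoped Matrix.Norms.Operator

variable {t : ClassicalType} {S : Space} {M : Type*} [DiffeologicalSpace M]
  {P : PoissonStructure M} {𝓜 : Model t S P} {m : M}

lemma isProfile_lax {z : ℂ} (hz : z ∈ 𝓜.D) (m : M) (i j : t.Idx) :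
    S.IsProfile (fun x => (𝓜.lax z x m : t.Mat) i j) (fun x => 𝓜.laxX m z x i j) where
  hasDerivAt x := (hasDerivAt_laxX hz x m i j).1
  continuous_deriv := continuous_laxX m continuous_const (fun _ => hz) continuous_id' i j
  periodic hS x := by simp only [𝓜.lax_periodic hS z hz]
  tendsto hS := by
    obtain ⟨c, -, hc⟩ := exists_bound_lax (𝓜 := 𝓜) (γ := fun _ => m) dSmooth_const
      (singleton_subset_iff.2 hz) isCompact_singleton 0
    subst hS
    exact tendsto_zero_of_bound fun x => (hc z rfl 0 (by simp) x trivial i j).1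

/-- Contour integrals of functions of the Lax matrix are profiles. -/
lemma IsDisc.isProfile {z₀ : ℂ} {r : ℕ} {R : ℝ} {ψ : ℂ → ℂ} (hD : 𝓜.IsDisc z₀ r R ψ)
    {H : t.Mat → ℂ} (hH : ContDiff ℂ ∞ H) (hH0 : H 0 = 0) {κ : ℝ → ℂ} (hκ : Continuous κ) (m : M) :
    ∃ c', S.IsProfile (fun x => ∫ θ in (0 : ℝ)..2 * Real.pi, κ θ *
      H (𝓜.φval (circleMap z₀ (R / 2) θ) • (𝓜.lax (circleMap z₀ (R / 2) θ) x m : t.Mat))) c' := by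
  have hℓ : Continuous fun p : ℝ × ℝ => 𝓜.φval (circleMap z₀ (R / 2) p.1) •
      (𝓜.lax (circleMap z₀ (R / 2) p.1) p.2 m : t.Mat) :=
    hD.continuous_smul_lax (γ := fun _ => m) (s := fun _ => 0) dSmooth_const continuous_fst
      continuous_snd continuous_const
  have hℓ' : Continuous fun p : ℝ × ℝ => 𝓜.φval (circleMap z₀ (R / 2) p.1) •
      𝓜.laxX m (circleMap z₀ (R / 2) p.1) p.2 :=
    continuous_matrix'.2 fun i j => (hD.continuous_φval.comp continuous_fst).mul
      (continuous_laxX m ((continuous_circleMap _ _).comp continuous_fst)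
        (fun _ => hD.circleMap_mem_domain _) continuous_snd i j)
  refine ⟨_, fun x => hasDerivAt_contour hH hκ hℓ hℓ' (fun θ x => hasDerivAt_matrix.2 fun i j =>
      (hasDerivAt_laxX (hD.circleMap_mem_domain θ) x m i j).1.const_mul _) 0 (2 * Real.pi) x,
    continuous_contour_fderiv hH hκ hℓ hℓ' 0 (2 * Real.pi), fun hS x => ?_, fun hS => ?_⟩
  · simp only [𝓜.lax_periodic hS _ (hD.circleMap_mem_domain _)]
  · obtain ⟨c, hc0, hc⟩ := hD.exists_bound (γ := fun _ => m) dSmooth_const 0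
    obtain ⟨C, -, hC⟩ := exists_bound_contour hH hH0 hκ hc0
      (by positivity : (0 : ℝ) ≤ 2 * Real.pi)
    refine tendsto_zero_of_bound fun x => (hC x _ (fun _ => 0)
      (fun θ hθ => (hc θ hθ x (by subst hS; trivial) 0 (by simp)).1) fun θ _ => ?_).1
    rw [norm_zero]
    positivity

/-! ### Gauge transformations -/

/-- The Hamiltonian vector field of `H` acts on `L(z, x)` at the point `m` by an infinitesimal gauge
transformation with parameter `N`. -/
structure IsGauge (𝓜 : Model t S P) (H : P.obs) (z : ℂ) (m : M) (N N' : ℝ → t.Mat) : Prop where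
  mem : ∀ x, N x ∈ t.alg
  isProfile : ∀ i j, S.IsProfile (fun x => N x i j) (fun x => N' x i j)
  bracket : ∀ (hz : z ∈ 𝓜.D) (f : ℝ → ℂ) (hf : S.IsTest f) (i j : t.Idx),
    (P.bracket H ⟨_, 𝓜.smeared_mem z hz f hf i j⟩ : M → ℂ) m = S.integral fun x => f x *
      (N' x - (N x * (𝓜.lax z x m : t.Mat) - (𝓜.lax z x m : t.Mat) * N x)) i j

variable {H K : P.obs} {z : ℂ} {N N' Q Q' : ℝ → t.Mat}

lemma IsGauge.continuous (h : 𝓜.IsGauge H z m N N') (hz : z ∈ 𝓜.D) (i j : t.Idx) :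
    Continuous fun x =>
      (N' x - (N x * (𝓜.lax z x m : t.Mat) - (𝓜.lax z x m : t.Mat) * N x)) i j := by
  have h1 : Continuous N := continuous_matrix'.2 fun i j => (h.isProfile i j).continuous
  have h2 : Continuous N' := continuous_matrix'.2 fun i j => (h.isProfile i j).continuous_deriv
  have h3 : Continuous fun x => (𝓜.lax z x m : t.Mat) :=
    continuous_matrix'.2 fun i j => (isProfile_lax hz m i j).continuous
  exact continuous_matrix'.1 (h2.sub ((h1.matrix_mul h3).sub (h3.matrix_mul h1))) i j

lemma isGauge_zero (𝓜 : Model t S P) (z : ℂ) (m : M) :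
    𝓜.IsGauge 0 z m (fun _ => 0) (fun _ => 0) where
  mem _ := t.alg.zero_mem
  isProfile _ _ := Space.IsProfile.zero
  bracket hz f hf i j := by
    have h : ∀ F : P.obs, P.bracket F 0 = 0 := fun F => by
      simpa using P.bracket_smul 0 F 0
    rw [P.bracket_skew, h]
    simp [S.integral_eq]

lemma IsGauge.add_smul (h : 𝓜.IsGauge H z m N N') (k : 𝓜.IsGauge K z m Q Q') (a : ℂ) :
    𝓜.IsGauge (H + a • K) z m (fun x => N x + a • Q x) (fun x => N' x + a • Q' x) where
  mem x := t.alg.add_mem (h.mem x) (t.alg.smul_mem a (k.mem x))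
  isProfile i j := (h.isProfile i j).add ((k.isProfile i j).const_mul a)
  bracket hz f hf i j := by
    have e : ∀ F, P.bracket (H + a • K) F = P.bracket H F + a • P.bracket K F := fun F => by
      rw [P.bracket_skew, P.bracket_add, P.bracket_smul, P.bracket_skew H, P.bracket_skew K,
        neg_add, smul_neg]
    rw [e]
    change (P.bracket H _ : M → ℂ) m + a * (P.bracket K _ : M → ℂ) m = _
    rw [h.bracket hz f hf, k.bracket hz f hf, ← Space.integral_const_mul,
      ← Space.integral_add (hf.integrableOn_mul (h.continuous hz i j))
        ((hf.integrableOn_mul (k.continuous hz i j)).const_mul a)]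
    congr 1
    ext x
    simp only [add_mul, mul_add, smul_mul_assoc, mul_smul_comm, Matrix.sub_apply,
      Matrix.add_apply, Matrix.smul_apply, smul_eq_mul]
    ring

/-- With N = L the commutator vanishes, so a translation is a gauge transformation. -/
lemma IsMomentum.isGauge {p : P.obs} (hp : 𝓜.IsMomentum p) (hz : z ∈ 𝓜.D) (m : M) :
    𝓜.IsGauge p z m (fun x => 𝓜.lax z x m) (𝓜.laxX m z) where
  mem x := (𝓜.lax z x m).2
  isProfile := isProfile_lax hz m
  bracket _ f hf i j := by
    rw [hp z hz f hf i j m, hf.integral_deriv_mul (isProfile_lax hz m i j).hasDerivAt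
      (isProfile_lax hz m i j).continuous_deriv (isProfile_lax hz m i j).periodic, neg_neg]
    simp

section Charge

variable {z₀ : ℂ} {n : ℕ} {R : ℝ} {ψ : ℂ → ℂ} {G : t.Mat → ℂ} {Γ : t.Mat → t.Mat}

lemma continuous_root_inv {ρ : ℝ} (h : ∀ θ, z ^ 𝓜.T ≠ circleMap z₀ ρ θ ^ 𝓜.T) (k : ℕ) :
    Continuous fun θ => (circleMap z₀ ρ θ - (𝓜.root ^ k)⁻¹ * z)⁻¹ :=
  ((continuous_circleMap z₀ ρ).sub continuous_const).inv₀ fun θ =>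
    𝓜.sub_root_ne_zero (h θ) k

lemma integral_mul_commutator {κ : ℝ → ℂ} (hκ : Continuous κ) {p : ℝ → t.Mat}
    (hp : ∀ i j, Continuous fun θ => p θ i j) {A : t.Mat} {a b : ℝ}
    (hA : ∀ i j, A i j = ∫ θ in a..b, κ θ * p θ i j) (L : t.Mat) (i j : t.Idx) :
    ∫ θ in a..b, κ θ * (p θ * L - L * p θ) i j = (A * L - L * A) i j := by
  have e : ∀ θ, κ θ * (p θ * L - L * p θ) i j =
      (∑ k, κ θ * p θ i k * L k j) - ∑ k, L i k * (κ θ * p θ k j) := fun θ => by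
    simp only [Matrix.sub_apply, Matrix.mul_apply, mul_sub, Finset.mul_sum]
    congr 1
    · exact Finset.sum_congr rfl fun _ _ => by ring
    · exact Finset.sum_congr rfl fun _ _ => by ring
  have h1 : ∀ i j, Continuous fun θ => κ θ * p θ i j := fun i j => hκ.mul (hp i j)
  simp only [e]
  rw [intervalIntegral.integral_sub, intervalIntegral.integral_finsetSum,
    intervalIntegral.integral_finsetSum, Matrix.sub_apply, Matrix.mul_apply, Matrix.mul_apply]
  · simp only [intervalIntegral.integral_const_mul, intervalIntegral.integral_mul_const, ← hA]
  · exact fun k _ => ((h1 k j).const_mul _).intervalIntegrable _ _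
  · exact fun k _ => ((h1 i k).mul_const _).intervalIntegrable _ _
  · exact (continuous_finsetSum _ fun k _ => (h1 i k).mul_const _).intervalIntegrable _ _
  · exact (continuous_finsetSum _ fun k _ => (h1 k j).const_mul _).intervalIntegrable _ _

/-- Fitted to the output of `trace_mul_variation`: p is Tr₂(R⁰₁₂Γ₂), A its contour integral, and q
is φ(w) times the partial trace with R⁰₂₁, which integrates to zero. -/
lemma integral_mul_variation {κ : ℝ → ℂ} (hκ : Continuous κ) {p : ℝ → t.Mat}
    (hp : ∀ i j, Continuous fun θ => p θ i j) {A : t.Mat} {a b : ℝ}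
    (hA : ∀ i j, A i j = ∫ θ in a..b, κ θ * p θ i j) {q : ℝ → ℂ} (hq : Continuous q)
    (hq0 : ∫ θ in a..b, κ θ * q θ = 0) (u v c : ℂ) (L : t.Mat) (i j : t.Idx) :
    ∫ θ in a..b, κ θ * (u * (p θ * L - L * p θ) i j + v * (p θ i j + c * q θ)) =
      u * (A * L - L * A) i j + v * A i j := by
  have hp' : Continuous p := continuous_matrix'.2 hp
  have hpL : Continuous fun θ => (p θ * L - L * p θ) i j :=
    continuous_matrix'.1 ((hp'.matrix_mul continuous_const).sub
      (continuous_const.matrix_mul hp')) i j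
  have h1 : Continuous fun θ => u * (κ θ * (p θ * L - L * p θ) i j) := (hκ.mul hpL).const_mul u
  have h2 : Continuous fun θ => v * (κ θ * p θ i j) := (hκ.mul (hp i j)).const_mul v
  have h3 : Continuous fun θ => v * c * (κ θ * q θ) := (hκ.mul hq).const_mul _
  have e : ∀ θ, κ θ * (u * (p θ * L - L * p θ) i j + v * (p θ i j + c * q θ)) =
      u * (κ θ * (p θ * L - L * p θ) i j) + v * (κ θ * p θ i j) + v * c * (κ θ * q θ) :=
    fun θ => by ring
  simp only [e]
  have h12 : Continuous fun θ => u * (κ θ * (p θ * L - L * p θ) i j) + v * (κ θ * p θ i j) :=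
    h1.add h2
  rw [intervalIntegral.integral_add (h12.intervalIntegrable _ _)
    (h3.intervalIntegrable _ _), intervalIntegral.integral_add (h1.intervalIntegrable _ _)
    (h2.intervalIntegrable _ _), intervalIntegral.integral_const_mul,
    intervalIntegral.integral_const_mul, intervalIntegral.integral_const_mul, hq0,
    integral_mul_commutator hκ hp hA, ← hA, mul_zero, add_zero]

/-- The local charges act on the Lax matrix by gauge transformations. -/
lemma exists_isGauge_charge (hQ : 𝓜.charge z₀ n ∈ P.obs)
    (hD : 𝓜.IsDisc z₀ (𝓜.order z₀ n) R ψ) (hreg : 𝓜.IsRegularZero z₀)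
    (hG : IsInvariantFn G Γ) (hW : ∀ z x m, 𝓜.W z₀ n z x m = G (𝓜.scaledLax z x m))
    (hgz : 𝓜.IsGeneric z) (hzR : ∀ w ∈ Metric.ball z₀ R, z ^ 𝓜.T ≠ w ^ 𝓜.T) (m : M) :
    ∃ N N', 𝓜.IsGauge ⟨𝓜.charge z₀ n, hQ⟩ z m N N' := by
  set w : ℝ → ℂ := circleMap z₀ (R / 2) with hw
  set κ : ℝ → ℂ := kernel (𝓜.order z₀ n) (R / 2) with hκdef
  have hκ : Continuous κ := continuous_kernel _ (half_pos hD.pos)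
  have hzw : ∀ θ, z ^ 𝓜.T ≠ w θ ^ 𝓜.T := fun θ => hzR _ (hD.circleMap_mem θ).1
  -- The coefficients of the gauge parameter along σᵏ(Tᵃ). They tend to zero at the infinities of
  -- the line because L does and Γ vanishes at 0.
  have hprof : ∀ (k : ℕ) a, ∃ c', S.IsProfile (fun x => ∫ θ in (0 : ℝ)..2 * Real.pi,
      (κ θ * ((𝓜.T : ℂ)⁻¹ * (w θ - (𝓜.root ^ k)⁻¹ * z)⁻¹)) *
        ((𝓜.dn a : t.Mat) * Γ (𝓜.φval (w θ) • (𝓜.lax (w θ) x m : t.Mat))).trace) c' :=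
    fun k a => hD.isProfile (H := fun X => ((𝓜.dn a : t.Mat) * Γ X).trace)
      ((traceCLM (𝓜.dn a : t.Mat)).contDiff.comp hG.contDiff)
      (by simp only [hG.grad_zero, mul_zero, Matrix.trace_zero])
      (hκ.mul (continuous_const.mul (continuous_root_inv hzw k))) m
  choose c' hc' using hprof
  set B : ℕ → Fin 𝓜.r → t.alg := fun k a => 𝓜.σ^[k] (𝓜.up a) with hB
  set c : ℕ → Fin 𝓜.r → ℝ → ℂ := fun k a x => ∫ θ in (0 : ℝ)..2 * Real.pi,
      (κ θ * ((𝓜.T : ℂ)⁻¹ * (w θ - (𝓜.root ^ k)⁻¹ * z)⁻¹)) *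
        ((𝓜.dn a : t.Mat) * Γ (𝓜.φval (w θ) • (𝓜.lax (w θ) x m : t.Mat))).trace with hcdef
  have hΓc : ∀ x, Continuous fun θ => Γ (𝓜.φval (w θ) • (𝓜.lax (w θ) x m : t.Mat)) := fun x =>
    hG.contDiff.continuous.comp (hD.continuous_smul_lax (γ := fun _ => m) (y := fun _ => x)
      (s := fun _ => 0) dSmooth_const continuous_id continuous_const continuous_const)
  have htr : ∀ (A : t.Mat) x, Continuous fun θ =>
      (A * Γ (𝓜.φval (w θ) • (𝓜.lax (w θ) x m : t.Mat))).trace := fun A x =>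
    (continuous_const.matrix_mul (hΓc x)).matrix_trace
  have hpt : ∀ x i j, Continuous fun θ =>
      ptrace (𝓜.R0 z (w θ)) (Γ (𝓜.φval (w θ) • (𝓜.lax (w θ) x m : t.Mat))) i j := by
    have e := 𝓜.ptrace_R0 z
    simp only [e, Matrix.sum_apply, Matrix.smul_apply, smul_eq_mul]
    exact fun x i j => continuous_finsetSum _ fun k _ => continuous_finsetSum _ fun a _ =>
      ((continuous_const.mul (continuous_root_inv hzw k)).mul
        (htr (𝓜.dn a : t.Mat) x)).mul continuous_const
  have hpt' : ∀ x i j, Continuous fun θ => 𝓜.φval (w θ) *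
      ptrace ((𝓜.R0 (w θ) z).submatrix Prod.swap Prod.swap)
        (Γ (𝓜.φval (w θ) • (𝓜.lax (w θ) x m : t.Mat))) i j := by
    have e := 𝓜.ptrace_R0_swap z
    simp only [e, Matrix.sum_apply, Matrix.smul_apply, smul_eq_mul]
    exact fun x i j => hD.continuous_φval.mul (continuous_finsetSum _ fun k _ =>
      continuous_finsetSum _ fun a _ => ((continuous_const.mul ((continuous_const.sub
        (continuous_const.mul (continuous_circleMap z₀ (R / 2)))).inv₀ fun θ =>
          𝓜.sub_root_ne_zero (hzw θ).symm k)).mul (htr (B k a : t.Mat) x)).mul continuous_const)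
  -- The combination of these coefficients is the contour integral of Tr₂(R⁰₁₂Γ₂).
  have hN : ∀ x i j, (∑ k ∈ Finset.range 𝓜.T, ∑ a, c k a x • (B k a : t.Mat)) i j =
      ∫ θ in (0 : ℝ)..2 * Real.pi, κ θ *
        ptrace (𝓜.R0 z (w θ)) (Γ (𝓜.φval (w θ) • (𝓜.lax (w θ) x m : t.Mat))) i j := by
    intro x i j
    have e : ∀ θ, κ θ *
        ptrace (𝓜.R0 z (w θ)) (Γ (𝓜.φval (w θ) • (𝓜.lax (w θ) x m : t.Mat))) i j =
        ∑ k ∈ Finset.range 𝓜.T, ∑ a, (κ θ * ((𝓜.T : ℂ)⁻¹ * (w θ - (𝓜.root ^ k)⁻¹ * z)⁻¹)) *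
          ((𝓜.dn a : t.Mat) * Γ (𝓜.φval (w θ) • (𝓜.lax (w θ) x m : t.Mat))).trace *
            (B k a : t.Mat) i j := fun θ => by
      simp only [TwistData.ptrace_R0, Matrix.sum_apply, Matrix.smul_apply, smul_eq_mul,
        Finset.mul_sum, hB]
      exact Finset.sum_congr rfl fun k _ => Finset.sum_congr rfl fun a _ => by ring
    have hc : ∀ k a, Continuous fun θ =>
        (κ θ * ((𝓜.T : ℂ)⁻¹ * (w θ - (𝓜.root ^ k)⁻¹ * z)⁻¹)) *
          ((𝓜.dn a : t.Mat) * Γ (𝓜.φval (w θ) • (𝓜.lax (w θ) x m : t.Mat))).trace *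
            (B k a : t.Mat) i j := fun k a =>
      ((hκ.mul (continuous_const.mul (continuous_root_inv hzw k))).mul
        (htr (𝓜.dn a : t.Mat) x)).mul continuous_const
    simp only [e]
    rw [intervalIntegral.integral_finsetSum fun k _ => (continuous_finsetSum _ fun a _ =>
      hc k a).intervalIntegrable _ _]
    simp only [Matrix.sum_apply, Matrix.smul_apply, smul_eq_mul]
    refine Finset.sum_congr rfl fun k _ => ?_
    rw [intervalIntegral.integral_finsetSum fun a _ => (hc k a).intervalIntegrable _ _]
    simp only [intervalIntegral.integral_mul_const, hcdef]
  -- Apart from φ the integrand is holomorphic in the whole disc: the rescaled Lax matrix extends to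
  -- z₀, and `hzR` keeps the poles of R⁰₂₁ outside.
  have hvanish : ∀ x i j, ∫ θ in (0 : ℝ)..2 * Real.pi, κ θ * (𝓜.φval (w θ) *
      ptrace ((𝓜.R0 (w θ) z).submatrix Prod.swap Prod.swap)
        (Γ (𝓜.φval (w θ) • (𝓜.lax (w θ) x m : t.Mat))) i j) = 0 := by
    intro x i j
    have hd : DifferentiableOn ℂ (fun v => ptrace ((𝓜.R0 v z).submatrix Prod.swap Prod.swap)
        (Γ (𝓜.scaledLax v x m)) i j) (Metric.ball z₀ R) := fun v hv => by
      have h1 : DifferentiableAt ℂ (fun v => Γ (𝓜.scaledLax v x m)) v :=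
        ((hG.contDiff.differentiable (by simp)) _).comp v (differentiableAt_matrix
          (hD.differentiableAt_scaledLax hreg hv x m))
      have h2 : ∀ A : t.Mat, DifferentiableAt ℂ (fun v => (A * Γ (𝓜.scaledLax v x m)).trace) v :=
        fun A => (traceCLM A).differentiableAt.comp v h1
      simp only [TwistData.ptrace_R0_swap, Matrix.sum_apply, Matrix.smul_apply, smul_eq_mul]
      refine (DifferentiableAt.fun_sum fun k _ => DifferentiableAt.fun_sum fun a _ =>
        (((DifferentiableAt.inv ((differentiableAt_id.const_mul _).const_sub z)
          (𝓜.sub_root_ne_zero (hzR v hv).symm k)).const_mul _).mul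
            (h2 _)).mul_const _).differentiableWithinAt
    have h := hD.integral_kernel_φval hd
    simp only [fun θ => hD.scaledLax_eq (hD.circleMap_mem θ).1 (hD.circleMap_mem θ).2 x m] at h
    exact h
  have hP : ∀ i j, S.IsProfile
      (fun x => (∑ k ∈ Finset.range 𝓜.T, ∑ a, c k a x • (B k a : t.Mat)) i j)
      (fun x => (∑ k ∈ Finset.range 𝓜.T, ∑ a, c' k a x • (B k a : t.Mat)) i j) := fun i j => by
    simp only [Matrix.sum_apply, Matrix.smul_apply, smul_eq_mul, mul_comm _ ((B _ _ : t.Mat) i j)]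
    exact Space.IsProfile.sum _ fun k _ => Space.IsProfile.sum _ fun a _ => (hc' k a).const_mul _
  refine ⟨fun x => ∑ k ∈ Finset.range 𝓜.T, ∑ a, c k a x • (B k a : t.Mat),
    fun x => ∑ k ∈ Finset.range 𝓜.T, ∑ a, c' k a x • (B k a : t.Mat), fun x => ?_, hP, ?_⟩
  · exact t.alg.toSubmodule.sum_mem fun k _ => t.alg.toSubmodule.sum_mem fun a _ =>
      t.alg.smul_mem _ (B k a).2
  intro hz f hf i j
  set N : ℝ → t.Mat := fun x => ∑ k ∈ Finset.range 𝓜.T, ∑ a, c k a x • (B k a : t.Mat)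
  set N' : ℝ → t.Mat := fun x => ∑ k ∈ Finset.range 𝓜.T, ∑ a, c' k a x • (B k a : t.Mat)
  -- The bracket is computed in the opposite order, as a derivative of the charge along the
  -- Hamiltonian vector of the smeared L(z): the response of L(w) to this vector is known at every
  -- point of the contour.
  obtain ⟨Y, hY⟩ := P.exists_hamiltonian ⟨_, 𝓜.smeared_mem z hz f hf i j⟩ m
  have e1 := (hasDeriv_charge hD hreg hG hW Y).unique (hY ⟨𝓜.charge z₀ n, hQ⟩)
  have hvar : ∀ x θ, 𝓜.φval (w θ) * (Γ (𝓜.φval (w θ) • (𝓜.lax (w θ) x m : t.Mat)) *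
      𝓜.varLax Y (w θ) x).trace =
      f x * (ptrace (𝓜.R0 z (w θ)) (Γ (𝓜.φval (w θ) • (𝓜.lax (w θ) x m : t.Mat))) *
          (𝓜.lax z x m : t.Mat) - (𝓜.lax z x m : t.Mat) *
            ptrace (𝓜.R0 z (w θ)) (Γ (𝓜.φval (w θ) • (𝓜.lax (w θ) x m : t.Mat)))) i j +
        deriv f x * (ptrace (𝓜.R0 z (w θ)) (Γ (𝓜.φval (w θ) • (𝓜.lax (w θ) x m : t.Mat))) i j +
          (𝓜.φval z)⁻¹ * (𝓜.φval (w θ) * ptrace ((𝓜.R0 (w θ) z).submatrix Prod.swap Prod.swap)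
            (Γ (𝓜.φval (w θ) • (𝓜.lax (w θ) x m : t.Mat))) i j)) := fun x θ => by
    have hgw := hD.generic _ (hD.circleMap_mem θ).1 (hD.circleMap_mem θ).2
    have hv : 𝓜.varLax Y (w θ) x = Matrix.of fun k l => f x *
        𝓜.mailletMatrix z (w θ) x m (i, k) (j, l) + deriv f x *
          (𝓜.R12 z (w θ) + 𝓜.R21 (w θ) z) (i, k) (j, l) := by
      ext k l
      exact varLax_eq_of_isHamiltonian_smeared hz (hD.circleMap_mem_domain θ) hgz hgw (hzw θ)
        hf hY k l x
    rw [hv]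
    exact trace_mul_variation hgw (hG.comm _) (f x) (deriv f x) i j
  have e2 : ∀ x, ∫ θ in (0 : ℝ)..2 * Real.pi, κ θ * (𝓜.φval (w θ) *
      (Γ (𝓜.φval (w θ) • (𝓜.lax (w θ) x m : t.Mat)) * 𝓜.varLax Y (w θ) x).trace) =
      f x * (N x * (𝓜.lax z x m : t.Mat) - (𝓜.lax z x m : t.Mat) * N x) i j +
        deriv f x * N x i j := fun x => by
    simp only [hvar]
    exact integral_mul_variation hκ (hpt x) (hN x) (hpt' x i j) (hvanish x i j) _ _ _ _ i j
  have hNc : Continuous N := continuous_matrix'.2 fun i j => (hP i j).continuous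
  have hLc : Continuous fun x => (𝓜.lax z x m : t.Mat) :=
    continuous_matrix'.2 fun i j => (isProfile_lax hz m i j).continuous
  have hC : Continuous fun x =>
      (N x * (𝓜.lax z x m : t.Mat) - (𝓜.lax z x m : t.Mat) * N x) i j :=
    continuous_matrix'.1 ((hNc.matrix_mul hLc).sub (hLc.matrix_mul hNc)) i j
  rw [P.bracket_skew]
  change -(P.bracket _ _ : M → ℂ) m = _
  -- Integration by parts moves the derivative from f to N, and skew-symmetry gives the overall
  -- sign.
  rw [← e1, congrArg S.integral (funext e2),
    Space.integral_add (hf.integrableOn_mul hC) (hf.deriv.integrableOn_mul (hP i j).continuous),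
    hf.integral_deriv_mul (hP i j).hasDerivAt (hP i j).continuous_deriv (hP i j).periodic,
    neg_add, neg_neg, neg_eq_neg_one_mul, ← Space.integral_const_mul,
    ← Space.integral_add ((hf.integrableOn_mul hC).const_mul _)
      (hf.integrableOn_mul (hP i j).continuous_deriv)]
  congr 1
  ext x
  change _ = f x * (N' x i j -
    (N x * (𝓜.lax z x m : t.Mat) - (𝓜.lax z x m : t.Mat) * N x) i j)
  ring

end Charge

end Model

lemma setIntegral_add_smul {E : Type*} [NormedAddCommGroup E] [NormedSpace ℂ E] {f g : ℝ → E}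
    {s : Set ℝ} (hf : MeasureTheory.IntegrableOn f s) (hg : MeasureTheory.IntegrableOn g s)
    (c : ℂ) : ∫ x in s, (f x + c • g x) = (∫ x in s, f x) + c • ∫ x in s, g x := by
  have h : MeasureTheory.IntegrableOn (fun x => c • g x) s := hg.smul c
  rw [MeasureTheory.integral_add hf h, MeasureTheory.integral_smul]

namespace Model

open MeasureTheory Set
open scoped Matrix.Norms.Operator

variable {t : ClassicalType} {S : Space} {M : Type*} [DiffeologicalSpace M]
  {P : PoissonStructure M} {𝓜 : Model t S P} {m : M}

/-! ### The monodromy and its variations -/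

/-- The connection whose parallel transport is the monodromy. -/
def connection (𝓜 : Model t S P) (m : M) (z : ℂ) (x : ℝ) : t.Mat := -(𝓜.lax z x m : t.Mat)

lemma continuous_connection {z : ℂ} (hz : z ∈ 𝓜.D) : Continuous (𝓜.connection m z) :=
  continuous_matrix'.2 fun i j => (isProfile_lax hz m i j).continuous.neg

/-- The change of the parallel transport under a change `δ` of the connection. -/
def transportVariation (S : Space) (A δ : ℝ → t.Mat) : t.Mat :=
  rightTransport S A * (∫ u in S.carrier, pexpInv A u 0 * δ u * pexp A u 0) * leftTransport S A

lemma exists_dominated {γ : ℝ → M} (hγ : DSmooth γ) {K : Set ℂ} (hKD : K ⊆ 𝓜.D)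
    (hK : IsCompact K) (b : ℝ) :
    ∃ c, ∀ z ∈ K, ∀ s ∈ Icc (-b) b, Dominated S c (𝓜.connection (γ s) z) ∧
      Dominated S c fun x => 𝓜.laxDeriv γ z x s := by
  obtain ⟨c, hc0, hc⟩ := exists_bound_lax (𝓜 := 𝓜) hγ hKD hK b
  refine ⟨_, fun z hz s hs => ⟨dominated_of_entries (fun i j =>
    (isProfile_lax (hKD hz) (γ s) i j).continuous.neg) hc0 fun x hx i j => ?_,
    dominated_of_entries (fun i j => continuous_laxDeriv hγ continuous_const (fun _ => hKD hz)
      continuous_id' continuous_const i j) hc0 fun x hx i j => (hc z hz s hs x hx i j).2⟩⟩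
  rw [connection, Matrix.neg_apply, norm_neg]
  exact (hc z hz s hs x hx i j).1

lemma exists_dominated_connection {z : ℂ} (hz : z ∈ 𝓜.D) (m : M) :
    ∃ c, Dominated S c (𝓜.connection m z) := by
  obtain ⟨c, hc⟩ := exists_dominated (𝓜 := 𝓜) (γ := fun _ => m) dSmooth_const
    (singleton_subset_iff.2 hz) isCompact_singleton 0
  exact ⟨c, (hc z rfl 0 (by simp)).1⟩

lemma exists_dominated_varLax (X : CTangent m) {K : Set ℂ} (hKD : K ⊆ 𝓜.D)
    (hK : IsCompact K) :
    ∃ c, ∀ z ∈ K, Dominated S c (𝓜.varLax X z) := by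
  obtain ⟨c, hc⟩ := exists_dominated (𝓜 := 𝓜) X.re_smooth hKD hK 0
  obtain ⟨c', hc'⟩ := exists_dominated (𝓜 := 𝓜) X.im_smooth hKD hK 0
  refine ⟨c + c', fun z hz => ?_⟩
  have h1 := (hc z hz 0 (by simp)).2
  have h2 := (hc' z hz 0 (by simp)).2
  refine ⟨h1.continuous.add (h2.continuous.const_smul Complex.I), fun x hx => ?_⟩
  rw [add_div]
  refine (norm_add_le _ _).trans (add_le_add (h1.bound x hx) ?_)
  rw [norm_smul, Complex.norm_I, one_mul]
  exact h2.bound x hx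

/-- Splitting the transport at the origin separates the two ends, so on the line the joint limit is
a product of two independent ones. -/
lemma monodromy_eq {z : ℂ} (hz : z ∈ 𝓜.D) (m : M) :
    𝓜.monodromy z m = rightTransport S (𝓜.connection m z) * leftTransport S (𝓜.connection m z) := by
  obtain ⟨c, hc⟩ := exists_dominated_connection hz m
  have hT := hc.tendsto_transport norm_one_matrix_le
  have hp : ∀ x y, 𝓜.transfer z x y m =
      pexp (𝓜.connection m z) x 0 * pexpInv (𝓜.connection m z) y 0 := fun x y => by
    rw [transfer, ← pexp_eq_mul norm_one_matrix_le hc.continuous]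
    exact pathOrderedExp_eq hc.continuous x y
  cases S with
  | line =>
    ext i j
    simp only [monodromy, Matrix.of_apply, hp]
    exact (tendsto_matrix.1 hT i j).limUnder_eq
  | circle =>
    simp only [monodromy, hp]
    have h := tendsto_nhds_unique hT (tendsto_pure_nhds
      (fun p : ℝ × ℝ => pexp (𝓜.connection m z) p.1 0 * pexpInv (𝓜.connection m z) p.2 0)
      (2 * Real.pi, 0) |>.mono_left (by simp [Space.right, Space.left]))
    exact h.symm

lemma monodromy_mem_group {𝓜 : Model t .circle P} {z : ℂ} (hz : z ∈ 𝓜.D) (m : M) :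
    𝓜.monodromy z m ∈ t.group := by
  have : 𝓜.monodromy z m = pexp (𝓜.connection m z) (2 * Real.pi) 0 :=
    pathOrderedExp_eq (continuous_connection hz) _ _
  rw [this]
  exact pexp_mem_group (continuous_connection hz) (fun x => t.alg.neg_mem (𝓜.lax z x m).2) _ _

/-- The locally uniform decay of the first variations gives, by the mean value inequality, the
integrable Lipschitz bound that `hasDerivAt_transport` asks for. -/
lemma hasDerivAt_monodromy {γ : ℝ → M} (hγ : DSmooth γ) {z : ℂ} (hz : z ∈ 𝓜.D) :
    HasDerivAt (fun s => 𝓜.monodromy z (γ s))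
      (transportVariation S (𝓜.connection (γ 0) z) fun x => -𝓜.laxDeriv γ z x 0) 0 := by
  obtain ⟨c, hc⟩ := exists_dominated (𝓜 := 𝓜) hγ (singleton_subset_iff.2 hz)
    isCompact_singleton 1
  have hd : ∀ x s, HasDerivAt (fun s => 𝓜.connection (γ s) z x) (-𝓜.laxDeriv γ z x s) s :=
    fun x s => hasDerivAt_matrix.2 fun i j => (hasDerivAt_lax hγ hz x s i j).1.neg
  have hn : Icc (-1 : ℝ) 1 ∈ 𝓝 (0 : ℝ) := Icc_mem_nhds (by norm_num) (by norm_num)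
  simp only [monodromy_eq hz]
  refine hasDerivAt_transport norm_one_matrix_le (S := S) (c := c) (c' := c)
    (A := fun s => 𝓜.connection (γ s) z) ?_ (fun x _ => hd x 0) ?_
  · filter_upwards [hn] with s hs using (hc z rfl s hs).1
  · filter_upwards [hn] with s hs x hx
    have := (convex_Icc (-1 : ℝ) 1).norm_image_sub_le_of_norm_hasDerivWithin_le
      (f := fun s => 𝓜.connection (γ s) z x) (C := c / (1 + x ^ 2))
      (fun s _ => (hd x s).hasDerivWithinAt)
      (fun s hs => by rw [norm_neg]; exact (hc z rfl s hs).2.bound x hx)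
      (⟨by norm_num, by norm_num⟩ : (0 : ℝ) ∈ Icc (-1 : ℝ) 1) hs
    rw [sub_zero, Real.norm_eq_abs, mul_comm] at this
    exact this

/-- The velocities along the two real curves are kept apart, since central functions must be
differentiated along each curve. The minus sign comes from the connection −L. -/
lemma exists_hasDerivAt_monodromy (X : CTangent m) {z : ℂ} (hz : z ∈ 𝓜.D) :
    ∃ u v : t.Mat, HasDerivAt (fun s => 𝓜.monodromy z (X.re s)) u 0 ∧
      HasDerivAt (fun s => 𝓜.monodromy z (X.im s)) v 0 ∧
      u + Complex.I • v = -transportVariation S (𝓜.connection m z) (𝓜.varLax X z) := by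
  have h1 := hasDerivAt_monodromy (𝓜 := 𝓜) X.re_smooth hz
  have h2 := hasDerivAt_monodromy (𝓜 := 𝓜) X.im_smooth hz
  refine ⟨_, _, h1, h2, ?_⟩
  rw [X.re_zero, X.im_zero]
  obtain ⟨c, hc⟩ := exists_dominated (𝓜 := 𝓜) X.re_smooth (singleton_subset_iff.2 hz)
    isCompact_singleton 0
  obtain ⟨c', hc'⟩ := exists_dominated (𝓜 := 𝓜) X.im_smooth (singleton_subset_iff.2 hz)
    isCompact_singleton 0
  obtain ⟨b, hb⟩ := exists_dominated_connection hz m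
  have i1 := (integrableOn_transport norm_one_matrix_le hb hb (hc z rfl 0 (by simp)).2).1
  have i2 := (integrableOn_transport norm_one_matrix_le hb hb (hc' z rfl 0 (by simp)).2).1
  have e : ∫ u in S.carrier, pexpInv (𝓜.connection m z) u 0 * 𝓜.varLax X z u *
      pexp (𝓜.connection m z) u 0 =
      (∫ u in S.carrier, pexpInv (𝓜.connection m z) u 0 * 𝓜.laxDeriv X.re z u 0 *
        pexp (𝓜.connection m z) u 0) + Complex.I •
      (∫ u in S.carrier, pexpInv (𝓜.connection m z) u 0 * 𝓜.laxDeriv X.im z u 0 *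
        pexp (𝓜.connection m z) u 0) := by
    refine Eq.trans ?_ (setIntegral_add_smul i1 i2 Complex.I)
    congr 1
    ext1 u
    simp only [varLax, mul_add, add_mul, mul_smul_comm, smul_mul_assoc]
  simp only [transportVariation]
  rw [e]
  simp only [mul_neg, neg_mul, integral_neg, mul_add, add_mul, mul_smul_comm, smul_mul_assoc,
    smul_neg, neg_add]

end Model

namespace Model

open MeasureTheory Set
open scoped Matrix.Norms.Operator

variable {t : ClassicalType} {S : Space} {M : Type*} [DiffeologicalSpace M]
  {P : PoissonStructure M} {𝓜 : Model t S P} {m : M}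

/-! ### Gauge transformations and the monodromy -/

section Gauge

variable {H : P.obs} {z : ℂ} {N N' : ℝ → t.Mat} {X : CTangent m}

/-- A Hamiltonian vector is constrained only by its action on observables. The smeared Lax entries
are enough of them: the fundamental lemma recovers the pointwise variation, whichever representative
is chosen. -/
lemma IsGauge.varLax_eq (h : 𝓜.IsGauge H z m N N') (hz : z ∈ 𝓜.D) (hX : P.IsHamiltonian H X)
    (x : ℝ) :
    𝓜.varLax X z x = N' x - (N x * (𝓜.lax z x m : t.Mat) - (𝓜.lax z x m : t.Mat) * N x) := by
  ext i j
  have hv : Continuous fun x => 𝓜.varLax X z x i j :=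
    continuous_varLax X continuous_const (fun _ => hz) continuous_id' i j
  have hg := h.continuous hz i j
  rw [← sub_eq_zero]
  refine Space.eq_zero_of_integral_test (S := S) (g := fun x => 𝓜.varLax X z x i j -
    (N' x - (N x * (𝓜.lax z x m : t.Mat) - (𝓜.lax z x m : t.Mat) * N x)) i j) (hv.sub hg) ?_ ?_ x
  · intro hS x
    have hN : ∀ x, N (x + 2 * Real.pi) = N x := fun x => by
      ext i j
      exact (h.isProfile i j).periodic hS x
    have hN' : ∀ x, N' (x + 2 * Real.pi) = N' x := fun x => by
      ext i j
      have h1 := ((h.isProfile i j).hasDerivAt (x + 2 * Real.pi)).comp_add_const x (2 * Real.pi)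
      simp only [hN] at h1
      exact h1.unique ((h.isProfile i j).hasDerivAt x)
    simp only [varLax_periodic X hS hz, hN, hN', 𝓜.lax_periodic hS z hz]
  · intro f hf
    have h1 := (hasDeriv_smeared X hz hf i j).unique (hX ⟨_, 𝓜.smeared_mem z hz f hf i j⟩)
    rw [h.bracket hz f hf] at h1
    have e : ∀ x, f x * (𝓜.varLax X z x i j -
        (N' x - (N x * (𝓜.lax z x m : t.Mat) - (𝓜.lax z x m : t.Mat) * N x)) i j) =
        f x * 𝓜.varLax X z x i j + (-1) * (f x *
          (N' x - (N x * (𝓜.lax z x m : t.Mat) - (𝓜.lax z x m : t.Mat) * N x)) i j) :=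
      fun x => by ring
    rw [congrArg S.integral (funext e), Space.integral_add (hf.integrableOn_mul hv)
      ((hf.integrableOn_mul hg).const_mul _), Space.integral_const_mul, h1]
    ring

/-- Under a gauge transformation the monodromy varies by a commutator. -/
lemma IsGauge.exists_transportVariation_eq (h : 𝓜.IsGauge H z m N N') (hz : z ∈ 𝓜.D)
    (hX : P.IsHamiltonian H X) :
    ∃ a ∈ t.alg, (S = .line → a = 0) ∧
      transportVariation S (𝓜.connection m z) (𝓜.varLax X z) =
        a * 𝓜.monodromy z m - 𝓜.monodromy z m * a := by
  -- Both ends of space give the same boundary value: zero on the line, N(0) = N(2π) on the circle.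
  have hlim : ∃ a ∈ t.alg, (S = .line → a = 0) ∧ Tendsto N S.right (𝓝 a) ∧
      Tendsto N S.left (𝓝 a) := by
    cases S with
    | line => exact ⟨0, t.alg.zero_mem, fun _ => rfl,
        tendsto_matrix.2 fun i j => ((h.isProfile i j).tendsto rfl).1,
        tendsto_matrix.2 fun i j => ((h.isProfile i j).tendsto rfl).2⟩
    | circle =>
      have hp : N (2 * Real.pi) = N 0 := by
        ext i j
        simpa using (h.isProfile i j).periodic rfl 0
      refine ⟨N 0, h.mem 0, fun h => by simp at h, ?_, tendsto_pure_nhds _ _⟩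
      rw [← hp]
      exact tendsto_pure_nhds _ _
  obtain ⟨a, ha, ha0, har, hal⟩ := hlim
  refine ⟨a, ha, ha0, ?_⟩
  -- In terms of the connection A = −L, the variation of L is N' + [N, A], as `transport_gauge`
  -- requires.
  have e : (fun x => N' x + N x * 𝓜.connection m z x - 𝓜.connection m z x * N x) =
      𝓜.varLax X z := funext fun x => by
    rw [h.varLax_eq hz hX, connection]
    noncomm_ring
  obtain ⟨c, hc⟩ := exists_dominated_connection hz m
  obtain ⟨c', hc'⟩ := exists_dominated_varLax (𝓜 := 𝓜) X (singleton_subset_iff.2 hz)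
    isCompact_singleton
  have key := transport_gauge norm_one_matrix_le hc (N := N) (N' := N') (c' := c')
    (fun x => hasDerivAt_matrix.2 fun i j => (h.isProfile i j).hasDerivAt x)
    (by rw [e]; exact hc' z rfl) har hal
  rw [← monodromy_eq hz] at key
  rw [← key, transportVariation, ← e]

end Gauge

/-! ### Continuity in the spectral parameter -/

section Limit

variable {z₁ : ℂ} (hz : z₁ ∈ 𝓜.D)

include hz

lemma exists_compact_nhds : ∃ K ⊆ 𝓜.D, IsCompact K ∧ ∀ᶠ z in 𝓝[≠] z₁, z ∈ K := by
  obtain ⟨K, hK, hKD, hKc⟩ := local_compact_nhds (𝓜.D_open.mem_nhds hz)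
  exact ⟨K, hKD, hKc, nhdsWithin_le_nhds hK⟩

lemma tendsto_connection (m : M) (x : ℝ) :
    Tendsto (fun z => 𝓜.connection m z x) (𝓝[≠] z₁) (𝓝 (𝓜.connection m z₁ x)) :=
  tendsto_matrix.2 fun i j => ((differentiableAt_lax hz x m i j).continuousAt.tendsto.mono_left
    nhdsWithin_le_nhds).neg

lemma tendsto_monodromy (m : M) :
    Tendsto (fun z => 𝓜.monodromy z m) (𝓝[≠] z₁) (𝓝 (𝓜.monodromy z₁ m)) := by
  obtain ⟨K, hKD, hK, hKe⟩ := exists_compact_nhds hz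
  obtain ⟨c, hc⟩ := exists_dominated (𝓜 := 𝓜) (γ := fun _ => m) dSmooth_const
    (insert_subset hz hKD) (hK.insert z₁) 0
  have h1 : ∀ᶠ z in 𝓝[≠] z₁, Dominated S c (𝓜.connection m z) :=
    hKe.mono fun z hz => (hc z (mem_insert_of_mem _ hz) 0 (by simp)).1
  have h2 := (hc z₁ (mem_insert _ _) 0 (by simp)).1
  have h3 := fun x (_ : x ∈ S.carrier) => tendsto_connection hz m x
  rw [monodromy_eq hz]
  exact ((tendsto_rightTransport norm_one_matrix_le h1 h2 h3).mul
    (tendsto_leftTransport norm_one_matrix_le h1 h2 h3)).congr'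
      (hKe.mono fun z hz => (monodromy_eq (hKD hz) m).symm)

lemma tendsto_transportVariation (X : CTangent m) :
    Tendsto (fun z => transportVariation S (𝓜.connection m z) (𝓜.varLax X z)) (𝓝[≠] z₁)
      (𝓝 (transportVariation S (𝓜.connection m z₁) (𝓜.varLax X z₁))) := by
  obtain ⟨K, hKD, hK, hKe⟩ := exists_compact_nhds hz
  obtain ⟨c, hc⟩ := exists_dominated (𝓜 := 𝓜) (γ := fun _ => m) dSmooth_const
    (insert_subset hz hKD) (hK.insert z₁) 0
  obtain ⟨c', hc'⟩ := exists_dominated_varLax (𝓜 := 𝓜) X hKD hK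
  have h1 : ∀ᶠ z in 𝓝[≠] z₁, Dominated S c (𝓜.connection m z) :=
    hKe.mono fun z hz => (hc z (mem_insert_of_mem _ hz) 0 (by simp)).1
  have h2 := (hc z₁ (mem_insert _ _) 0 (by simp)).1
  have h3 := fun x (_ : x ∈ S.carrier) => tendsto_connection hz m x
  have hd : ∀ {γ : ℝ → M}, DSmooth γ → ∀ x i j,
      Tendsto (fun z => 𝓜.laxDeriv γ z x 0 i j) (𝓝[≠] z₁) (𝓝 (𝓜.laxDeriv γ z₁ x 0 i j)) :=
    fun {γ} hγ x i j => by
      have hc : ContinuousAt (fun p : ℂ × ℝ × ℝ => 𝓜.laxDeriv γ p.1 p.2.1 p.2.2 i j)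
          (z₁, x, 0) :=
        (continuousOn_laxDeriv hγ i j).continuousAt (isOpen_domain.mem_nhds ⟨hz, trivial⟩)
      have hp : ContinuousAt (fun z : ℂ => (z, x, (0 : ℝ))) z₁ := by fun_prop
      exact (ContinuousAt.comp (f := fun z : ℂ => (z, x, (0 : ℝ))) hc hp).tendsto.mono_left
        nhdsWithin_le_nhds
  exact tendsto_variation norm_one_matrix_le h1 h1 h2 h3 h3
    (hKe.mono fun z hz => hc' z hz) fun x _ => tendsto_matrix.2 fun i j =>
      (hd X.re_smooth x i j).add ((hd X.im_smooth x i j).const_mul _)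

end Limit

/-! ### Involution of the charges -/

/-- Observables that act on the Lax matrix by gauge transformations are in involution with the
non-local charges. -/
theorem inInvolution_of_isGauge {H : P.obs}
    (hH : ∀ m, ∀ z₁ ∈ 𝓜.D, ∀ᶠ z in 𝓝[≠] z₁, ∃ N N', 𝓜.IsGauge H z m N N')
    {G : M → ℂ} (hG : G ∈ 𝓜.nonLocalCharges) : P.InInvolution H G := by
  intro m X hX
  have hcomm : ∀ z₁ ∈ 𝓜.D, ∀ᶠ z in 𝓝[≠] z₁, z ∈ 𝓜.D ∧ ∃ a ∈ t.alg, (S = .line → a = 0) ∧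
      transportVariation S (𝓜.connection m z) (𝓜.varLax X z) =
        a * 𝓜.monodromy z m - 𝓜.monodromy z m * a := fun z₁ hz => by
    filter_upwards [hH m z₁ hz, nhdsWithin_le_nhds (𝓜.D_open.mem_nhds hz)] with z ⟨N, N', h⟩ hz
    exact ⟨hz, h.exists_transportVariation_eq hz hX⟩
  cases S with
  | line =>
    obtain ⟨z₁, hz, i, j, rfl⟩ := hG
    obtain ⟨u, v, hu, hv, huv⟩ := exists_hasDerivAt_monodromy X hz
    -- Exceptional z₁ are reached by continuity: the variation vanishes at all z near z₁ other than
    -- z₁.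
    have h0 : transportVariation .line (𝓜.connection m z₁) (𝓜.varLax X z₁) = 0 :=
      tendsto_nhds_unique (tendsto_transportVariation hz X) (tendsto_const_nhds.congr'
        ((hcomm z₁ hz).mono fun z ⟨_, a, _, ha0, h⟩ => by
          change _ = transportVariation _ _ _
          rw [h, ha0 rfl, zero_mul, mul_zero, sub_zero]))
    refine ⟨_, _, hasDerivAt_matrix.1 hu i j, hasDerivAt_matrix.1 hv i j, ?_⟩
    rw [h0, neg_zero] at huv
    exact (congrFun (congrFun huv i) j).symm
  | circle =>
    obtain ⟨z₁, hz, f, ⟨hf, hfF⟩, rfl⟩ := hG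
    obtain ⟨u, v, hu, hv, huv⟩ := exists_hasDerivAt_monodromy X hz
    obtain ⟨F, hF, hfF⟩ := hfF _ (monodromy_mem_group hz m)
    -- The elements a may diverge as z tends to z₁, so the limit is taken after the derivative of F
    -- has been applied. The same F represents f near the monodromies at neighbouring z, where that
    -- derivative kills the commutator.
    have h0 : fderiv ℂ F (Matrix.of.symm (𝓜.monodromy z₁ m)) (Matrix.of.symm
        (transportVariation .circle (𝓜.connection m z₁) (𝓜.varLax X z₁))) = 0 := by
      have hT : Tendsto (fun z => Matrix.of.symm (𝓜.monodromy z m)) (𝓝[≠] z₁)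
          (𝓝 (Matrix.of.symm (𝓜.monodromy z₁ m))) := tendsto_monodromy hz m
      have hV : Tendsto (fun z => Matrix.of.symm
          (transportVariation .circle (𝓜.connection m z) (𝓜.varLax X z))) (𝓝[≠] z₁)
          (𝓝 (Matrix.of.symm
            (transportVariation .circle (𝓜.connection m z₁) (𝓜.varLax X z₁)))) :=
        tendsto_transportVariation hz X
      refine tendsto_nhds_unique ((isBoundedBilinearMap_apply (𝕜 := ℂ)
        (E := t.Idx → t.Idx → ℂ) (F := ℂ)).continuous.continuousAt.tendsto.comp
        ((hF.fderiv.continuousAt.tendsto.comp hT).prodMk_nhds hV))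
        (tendsto_const_nhds.congr' ?_)
      filter_upwards [hcomm z₁ hz, hT.eventually hF.eventually_analyticAt,
        (tendsto_monodromy hz m).eventually hfF.eventually_nhds] with z ⟨hz, a, ha, _, h⟩ hFz hfz
      change _ = fderiv ℂ F (Matrix.of.symm (𝓜.monodromy z m)) (Matrix.of.symm
        (transportVariation _ _ _))
      rw [h]
      exact (IsCentralFunction.fderiv_commutator hf (monodromy_mem_group hz m)
        hFz.differentiableAt.hasFDerivAt hfz ha).symm
    -- f agrees with F only on the group; this suffices because monodromies along the curve never
    -- leave it.
    have hd : ∀ {γ : ℝ → M} {w : t.Mat}, γ 0 = m →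
        HasDerivAt (fun s => 𝓜.monodromy z₁ (γ s)) w 0 →
        HasDerivAt (fun s => f (𝓜.monodromy z₁ (γ s)))
          (fderiv ℂ F (Matrix.of.symm (𝓜.monodromy z₁ m)) (Matrix.of.symm w)) 0 :=
      fun {γ w} h0 hw => by
        have hw' : HasDerivAt (fun s => Matrix.of.symm (𝓜.monodromy z₁ (γ s)))
            (Matrix.of.symm w) 0 :=
          hasDerivAt_pi.2 fun i => hasDerivAt_pi.2 fun j => hasDerivAt_matrix.1 hw i j
        have hc : HasDerivAt (fun s => F (Matrix.of.symm (𝓜.monodromy z₁ (γ s))))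
            (fderiv ℂ F (Matrix.of.symm (𝓜.monodromy z₁ m)) (Matrix.of.symm w)) 0 :=
          HasFDerivAt.comp_hasDerivAt (f := fun s => Matrix.of.symm (𝓜.monodromy z₁ (γ s))) (0 : ℝ)
            (l' := (fderiv ℂ F (Matrix.of.symm (𝓜.monodromy z₁ m))).restrictScalars ℝ)
            (by rw [h0]; exact hF.differentiableAt.hasFDerivAt.restrictScalars ℝ) hw'
        refine hc.congr_of_eventuallyEq ?_
        have ht : Tendsto (fun s => 𝓜.monodromy z₁ (γ s)) (𝓝 0) (𝓝 (𝓜.monodromy z₁ m)) :=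
          h0 ▸ hw.continuousAt.tendsto
        exact (ht.eventually hfF).mono fun s hs => hs (monodromy_mem_group hz _)
    refine ⟨_, _, hd X.re_zero hu, hd X.im_zero hv, ?_⟩
    rw [← smul_eq_mul, ← map_smul, ← map_add]
    have e : Matrix.of.symm u + Complex.I • Matrix.of.symm v = -Matrix.of.symm
        (transportVariation .circle (𝓜.connection m z₁) (𝓜.varLax X z₁)) := huv
    rw [e, map_neg, h0, neg_zero]

/-- Functions in involution with the Hamiltonian are conserved. -/
lemma _root_.TwistModel.PoissonStructure.InInvolution.isConserved {H : P.obs} {G : M → ℂ}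
    (h : P.InInvolution H G) : P.IsConserved H G := by
  refine ⟨h, fun γ hγ => ?_⟩
  have hd : ∀ s, HasDerivAt (fun s => G (γ s)) 0 s := fun s => by
    -- The velocity of the motion, with a constant curve as imaginary part, is a Hamiltonian vector
    -- of H at γ(s).
    let X : CTangent (γ s) :=
      { re := fun r => γ (s + r)
        im := fun _ => γ s
        re_smooth := hγ.1.comp (contDiff_const.add contDiff_id).dSmooth
        im_smooth := dSmooth_const
        re_zero := by rw [add_zero]
        im_zero := rfl }
    have hshift : ∀ {K : M → ℂ} {k : ℂ}, HasDerivAt (fun r => K (γ r)) k s →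
        HasDerivAt (fun r => K (γ (s + r))) k 0 := fun {K k} hk => by
      have : HasDerivAt (fun r => K (γ r)) k (s + 0) := by rwa [add_zero]
      exact this.comp_const_add s 0
    obtain ⟨u, v, hu, hv, huv⟩ := h (γ s) X fun K =>
      ⟨_, 0, hshift (hγ.2 K s), hasDerivAt_const 0 ((K : M → ℂ) (γ s)), by
        rw [mul_zero, add_zero]⟩
    rw [hv.unique (hasDerivAt_const 0 (G (γ s))), mul_zero, add_zero] at huv
    subst huv
    have h2 := (show HasDerivAt (fun r => G (γ (s + r))) 0 (s - s) by simpa using hu).comp_sub_const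
      s s
    simpa using h2
  exact fun s r => is_const_of_deriv_eq_zero (fun s => (hd s).differentiableAt)
    (fun s => (hd s).deriv) s r

lemma eventually_eval_ne_zero {p : Polynomial ℂ} (hp : p ≠ 0) (z₁ : ℂ) :
    ∀ᶠ z in 𝓝[≠] z₁, p.eval z ≠ 0 := by
  have h : ({z | p.IsRoot z} \ {z₁}).Finite := (Polynomial.finite_setOfPred_isRoot hp).sdiff
  filter_upwards [nhdsWithin_le_nhds (h.isClosed.isOpen_compl.mem_nhds (by simp : z₁ ∈ _)),
    self_mem_nhdsWithin] with z hz hne h0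
  exact hz ⟨h0, hne⟩


lemma eventually_pow_ne {T : ℕ} (hT : 0 < T) (z₀ z₁ : ℂ) :
    ∀ᶠ z in 𝓝[≠] z₁, z ^ T ≠ z₀ ^ T := by
  filter_upwards [eventually_eval_ne_zero (Polynomial.X_pow_sub_C_ne_zero hT (z₀ ^ T)) z₁]
    with z hz h
  simp [h] at hz

/-- The excluded z are the zeros and poles of φ and the solutions of zᵀ = z₀ᵀ (T-th powers),
finitely many in all. For any other z a disc around z₀, depending on z, contains no w with the same
T-th power. -/
lemma eventually_isGauge_charge {z₀ : ℂ} {n : ℕ} (hreg : 𝓜.IsRegularZero z₀)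
    (hn : n ∈ 𝓜.degrees z₀) (hQ : 𝓜.charge z₀ n ∈ P.obs) (m : M) (z₁ : ℂ) :
    ∀ᶠ z in 𝓝[≠] z₁, ∃ N N', 𝓜.IsGauge ⟨𝓜.charge z₀ n, hQ⟩ z m N N' := by
  have h2 : 2 ≤ n := by
    have := hn.1
    cases t <;> exact this.1
  obtain ⟨G, Γ, hG, hW⟩ := 𝓜.exists_W_eq z₀ h2
  filter_upwards [eventually_eval_ne_zero (RatFunc.num_ne_zero 𝓜.φ_ne) z₁,
    eventually_eval_ne_zero 𝓜.φ.denom_ne_zero z₁, eventually_pow_ne 𝓜.T_pos z₀ z₁]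
    with z hnum hden hpow
  have hp : ∀ᶠ w in 𝓝 z₀, z ^ 𝓜.T ≠ w ^ 𝓜.T :=
    ((continuous_pow 𝓜.T).continuousAt.eventually_ne hpow.symm).mono fun w hw => hw.symm
  obtain ⟨R, ψ, hD, hR⟩ := exists_isDisc hreg hn.2 hp
  exact exists_isGauge_charge hQ hD hreg hG hW ⟨hnum, hden⟩ hR m

/-- In both cases r₂ ≡ −2 modulo T, because 2·T/2 = T. The value r₂ = T − 1 would make T divide 1,
contrary to T > 1. In type A, 2 ≡ 1 modulo d is impossible for d ≥ 2. -/
lemma two_mem_degrees (ht : t.Simple) (z₀ : ℂ) : 2 ∈ 𝓜.degrees z₀ := by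
  constructor
  · cases t with
    | A d =>
      refine ⟨le_rfl, fun h => ?_⟩
      have := (Nat.modEq_iff_dvd' (by norm_num : 1 ≤ 2)).1 h.symm
      have := Nat.le_of_dvd (by norm_num) this
      have : 2 ≤ d := ht
      omega
    | BD n => exact ⟨le_rfl, even_two⟩
    | C n => exact ⟨le_rfl, even_two⟩
  · rintro ⟨-, hT⟩ h
    have key : ∀ a : ℤ, (a + 2) % (𝓜.T : ℤ) = 0 → (a % (𝓜.T : ℤ)).toNat ≠ 𝓜.T - 1 :=
      fun a ha h => by
        have h1 := Int.emod_nonneg a (b := (𝓜.T : ℤ)) (by omega)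
        have h2 : a % (𝓜.T : ℤ) = 𝓜.T - 1 := by omega
        have h3 : (𝓜.T : ℤ) ∣ a - (𝓜.T - 1) :=
          ⟨a / 𝓜.T, by linarith [Int.mul_ediv_add_emod a 𝓜.T]⟩
        have h4 := dvd_sub (Int.dvd_of_emod_eq_zero ha) (dvd_add h3 (dvd_refl (𝓜.T : ℤ)))
        have h5 : (𝓜.T : ℤ) ∣ 1 := by
          convert! h4 using 1
          ring
        have := Int.le_of_dvd one_pos h5
        omega
    unfold TwistData.rem at h
    split_ifs at h
    · refine key _ ?_ h
      have : ((2 : ℕ) : ℤ) * (𝓜.T : ℤ) / 2 = 𝓜.T := by push_cast; omega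
      rw [this]
      push_cast
      ring_nf
      simp
    · exact key _ (by simp) h

/-- Gauge actions depend linearly on the generating observable, so their parameters add up; the
finitely many conditions on z hold simultaneously near each z₁. -/
lemma exists_sum_charge (ht : t.Simple) {Z : Finset ℂ} (hreg : ∀ z₀ ∈ Z, 𝓜.IsRegularZero z₀)
    (hQ : ∀ z₀ ∈ Z, 𝓜.charge z₀ 2 ∈ P.obs) (a : ℂ → ℂ) :
    ∃ K : P.obs, (K : M → ℂ) = ∑ z₀ ∈ Z, a z₀ • 𝓜.charge z₀ 2 ∧
      ∀ (m : M) (z₁ : ℂ), ∀ᶠ z in 𝓝[≠] z₁, ∃ N N', 𝓜.IsGauge K z m N N' := by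
  induction Z using Finset.induction_on with
  | empty => exact ⟨0, rfl, fun m z₁ => .of_forall fun z => ⟨_, _, isGauge_zero 𝓜 z m⟩⟩
  | insert z₀ Z hz₀ ih =>
    obtain ⟨K, hK, hKg⟩ := ih (fun z hz => hreg z (Finset.mem_insert_of_mem hz))
      fun z hz => hQ z (Finset.mem_insert_of_mem hz)
    have h0 := Finset.mem_insert_self z₀ Z
    refine ⟨K + a z₀ • ⟨𝓜.charge z₀ 2, hQ z₀ h0⟩, ?_, fun m z₁ => ?_⟩
    · rw [Finset.sum_insert hz₀, ← hK, add_comm]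
      rfl
    · filter_upwards [hKg m z₁, eventually_isGauge_charge (hreg z₀ h0) (two_mem_degrees ht z₀)
        (hQ z₀ h0) m z₁] with z ⟨N, N', h⟩ ⟨Q, Q', h'⟩
      exact ⟨_, _, h.add_smul h' (a z₀)⟩

lemma eventually_isGauge_hamiltonian (ht : t.Simple) {Z : Finset ℂ}
    (hreg : ∀ z₀ ∈ Z, 𝓜.IsRegularZero z₀) (hQ : ∀ z₀ ∈ Z, 𝓜.charge z₀ 2 ∈ P.obs) {H p : P.obs}
    (hp : 𝓜.IsMomentum p) {a : ℂ → ℂ} {b : ℂ}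
    (hH : (H : M → ℂ) = (∑ z₀ ∈ Z, a z₀ • 𝓜.charge z₀ 2) + b • (p : M → ℂ))
    (m : M) {z₁ : ℂ} (hz : z₁ ∈ 𝓜.D) :
    ∀ᶠ z in 𝓝[≠] z₁, ∃ N N', 𝓜.IsGauge H z m N N' := by
  obtain ⟨K, hK, hKg⟩ := exists_sum_charge ht hreg hQ a
  have hHK : H = K + b • p := Subtype.ext (by rw [hH, ← hK]; rfl)
  rw [hHK]
  filter_upwards [hKg m z₁, nhdsWithin_le_nhds (𝓜.D_open.mem_nhds hz)] with z ⟨N, N', h⟩ hz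
  exact ⟨_, _, h.add_smul (hp.isGauge hz m) b⟩

end Model

end TwistModel

end

theorem mainTheorem8 {t : TwistModel.ClassicalType} (ht : t.Simple) {S : TwistModel.Space}
    {M : Type*} [DiffeologicalSpace M] {P : TwistModel.PoissonStructure M}
    (𝓜 : TwistModel.Model t S P) (Z : Finset ℂ) (hZ : 𝓜.IsRegularZeroSet Z)
    (hQ : ∀ z₀ ∈ Z, ∀ n ∈ 𝓜.degrees z₀, 𝓜.charge z₀ n ∈ P.obs) :
    (∀ (z₀ : ℂ) (hz₀ : z₀ ∈ Z) (n : ℕ) (hn : n ∈ 𝓜.degrees z₀),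
      ∀ G ∈ 𝓜.nonLocalCharges, P.InInvolution ⟨𝓜.charge z₀ n, hQ z₀ hz₀ n hn⟩ G) ∧
    (∀ (H p : P.obs), 𝓜.IsMomentum p → ∀ (a : ℂ → ℂ) (b : ℂ),
      (H : M → ℂ) = (∑ z₀ ∈ Z, a z₀ • 𝓜.charge z₀ 2) + b • (p : M → ℂ) →
      ∀ G ∈ 𝓜.nonLocalCharges, P.IsConserved H G) := by
  refine ⟨fun z₀ hz₀ n hn G hG => TwistModel.Model.inInvolution_of_isGauge (fun m z₁ _ =>
      TwistModel.Model.eventually_isGauge_charge (hZ.1 z₀ hz₀) hn (hQ z₀ hz₀ n hn) m z₁) hG,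
    fun H p hp a b hH G hG => TwistModel.PoissonStructure.InInvolution.isConserved
      (TwistModel.Model.inInvolution_of_isGauge (fun m z₁ hz => TwistModel.Model.eventually_isGauge_hamiltonian ht hZ.1
        (fun z₀ hz₀ => hQ z₀ hz₀ 2 (TwistModel.Model.two_mem_degrees ht z₀)) hp hH m hz) hG)⟩
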